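/- Let $V_6$ be a complex vector space of dimension $6$, and equip $\bigwedge^3V_6$ with the symplectic form (defined up to a scalar) given by the wedge product with values in $\bigwedge^6V_6\simeq\mathbf C$. Let $\mathrm{LG}(\bigwedge^3V_6)$ be the Grassmannian of Lagrangian subspaces of $\bigwedge^3V_6$. For a $3$-dimensional subspace $U\subset V_6$, set $T_U:=\bigwedge^2U\wedge V_6\subset\bigwedge^3V_6$, a Lagrangian subspace of dimension $10$. For $k\ge 0$ consider the degeneracy loci $$\mathscr Z^{\ge k}:=\{([A],[U])\in \mathrm{LG}(\textstyle\bigwedge^3V_6)\times\mathrm{Gr}(3,V_6)\mid \dim(A\cap T_U)\ge k\},\qquad Z_A^{\ge k}:=\{[U]\in \mathrm{Gr}(3,V_6)\mid \dim(A\cap T_U)\ge k\},$$ with the scheme structures defined by the minors of size $11-k$ of the natural morphism $A\to \bigwedge^3V_6/T_U$ between vector bundles of rank $10$, and set $\mathscr Z^{k}:=\mathscr Z^{\ge k}\smallsetminus\mathscr Z^{\ge k+1}$, $Z_A^{k}:=Z_A^{\ge k}\smallsetminus Z_A^{\ge k+1}$. We view $Z_A^{\ge k}$ as a subscheme of $\mathscr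 Z^{\ge k}$ via $[U]\mapsto([A],[U])$. Let $A_0\subset\bigwedge^3V_6$ be a Lagrangian subspace that contains no decomposable vector (that is, no nonzero vector of the form $v_1\wedge v_2\wedge v_3$), and let $([A_0],[U_0])$ be a point of $\mathscr Z^{\ell}$, with $\ell\in\{0,\dots,4\}$. Set $K:=A_0\cap T_{U_0}$, so that $\dim K=\ell$, and let $\mathscr S_{\le i}\subset \mathrm{Sym}^2K^\vee$ be the scheme of quadratic forms on $K$ of rank at most $i$, defined by the minors of size $i+1$. Let $$r_K\colon \{\text{quadratic forms on } T_{U_0} \text{ that vanish on all decomposable vectors of } T_{U_0}\}\longrightarrow \mathrm{Sym}^2K^\vee$$ be the restriction map. Then the following hold. 1. For every $k\in\{0,\dots,\ell\}$, there is an isomorphism from the analytic germ of $\mathscr Z^{\ge k}$ at $([A_0],[U_0])$ to the product of a smooth germ $(M,0)$ and the germ $(\mathscr S_{\le \ell-k},0)$, under which the germ of $Z_{A_0}^{\ge k}$ at $[U_0]$ corresponds to the germ of $M'\times(\mathrm{Im}(r_K)\cap\mathscr S_{\le\ell-k})$ at $(0,0)$, where $(M',0)\subset(M,0)$ is a smooth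 germ of dimension $\max\bigl(0,\,9-\tfrac{\ell(\ell+1)}2\bigr)$. 2. In particular, if $\ell=4$, that is, if $[U_0]\in Z_{A_0}^4$, the analytic germ of $Z_{A_0}^{\ge 2}$ at $[U_0]$ is isomorphic to the germ of $\mathrm{Im}(r_K)\cap\mathscr S_{\le 2}$ at $0$. Moreover, in this case $\mathrm{Im}(r_K)$ is a general hyperplane of $\mathrm{Sym}^2K^\vee$, in the sense that it is the hyperplane defined by an element of $\mathrm{Sym}^2K$ of maximal rank $4$. -/

import Mathlib

open Module Topology

noncomputable section

namespace EPW

/-! ### Germs of holomorphic functions and analytic germs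

The germ at `0` of a closed analytic subspace of a finite dimensional complex vector space `E` is
given by an ideal `I` of the ring `HolGerm E` of germs at `0` of holomorphic functions on `E`; its
local analytic algebra is `HolGerm E ⧸ I`, and an isomorphism of analytic germs is an isomorphism
of these `ℂ`-algebras. -/

section Germs

variable (E : Type*) [AddCommGroup E] [Module ℂ E] [FiniteDimensional ℂ E]

/-- Linear coordinates on `E` (nothing below depends on the choice of the basis). -/
def coords : E ≃ₗ[ℂ] (Fin (finrank ℂ E) → ℂ) := (finBasis ℂ E).equivFun

/-- The algebra of functions on `E` that are holomorphic in a neighbourhood of `0`. -/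
def HolFun : Subalgebra ℂ (E → ℂ) where
  carrier := {f | AnalyticAt ℂ (fun z => f ((coords E).symm z)) 0}
  mul_mem' hf hg := AnalyticAt.mul hf hg
  add_mem' hf hg := AnalyticAt.add hf hg
  algebraMap_mem' _ := analyticAt_const

/-- The ideal of functions that vanish in a neighbourhood of `0`. -/
def nullIdeal : Ideal (HolFun E) where
  carrier := {f | ∀ᶠ z in 𝓝 (0 : Fin (finrank ℂ E) → ℂ), (f : E → ℂ) ((coords E).symm z) = 0}
  zero_mem' := Filter.Eventually.of_forall fun _ => rfl
  add_mem' {f g} hf hg := by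
    filter_upwards [hf, hg] with z h1 h2
    change (f : E → ℂ) _ + (g : E → ℂ) _ = 0
    rw [h1, h2, add_zero]
  smul_mem' c f hf := by
    filter_upwards [hf] with z h1
    change (c : E → ℂ) _ * (f : E → ℂ) _ = 0
    rw [h1, mul_zero]

/-- The ring of germs at `0` of holomorphic functions on `E`. -/
def HolGerm : Type _ := HolFun E ⧸ nullIdeal E

instance : CommRing (HolGerm E) := inferInstanceAs (CommRing (HolFun E ⧸ nullIdeal E))

instance : Algebra ℂ (HolGerm E) := inferInstanceAs (Algebra ℂ (HolFun E ⧸ nullIdeal E))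

variable {E} in
/-- The germ at `0` of a holomorphic function. -/
def HolFun.germ (f : HolFun E) : HolGerm E := Ideal.Quotient.mk (nullIdeal E) f

end Germs

section Pullback

variable {E F : Type*} [AddCommGroup E] [Module ℂ E] [FiniteDimensional ℂ E]
  [AddCommGroup F] [Module ℂ F] [FiniteDimensional ℂ F]

/-- A linear map in coordinates. -/
def coordMap (i : E →ₗ[ℂ] F) : (Fin (finrank ℂ E) → ℂ) →L[ℂ] (Fin (finrank ℂ F) → ℂ) :=
  LinearMap.toContinuousLinearMap
    ((coords F).toLinearMap ∘ₗ i ∘ₗ (coords E).symm.toLinearMap)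

theorem coords_symm_coordMap (i : E →ₗ[ℂ] F) (z) :
    (coords F).symm (coordMap i z) = i ((coords E).symm z) := by
  simp [coordMap]

/-- Composition of holomorphic functions with a linear map. -/
def HolFun.comp (i : E →ₗ[ℂ] F) : HolFun F →ₐ[ℂ] HolFun E where
  toFun f := ⟨fun x => (f : F → ℂ) (i x), by
    have hf : AnalyticAt ℂ (fun z => (f : F → ℂ) ((coords F).symm z)) (coordMap i 0) := by
      rw [map_zero]; exact f.2
    have h := hf.comp ((coordMap i).analyticAt 0)
    simp only [Function.comp_def, coords_symm_coordMap] at h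
    exact h⟩
  map_one' := rfl
  map_mul' _ _ := rfl
  map_zero' := rfl
  map_add' _ _ := rfl
  commutes' _ := rfl

/-- Pullback of germs of holomorphic functions along a linear map `i : E → F`. -/
def pullback (i : E →ₗ[ℂ] F) : HolGerm F →ₐ[ℂ] HolGerm E :=
  Ideal.quotientMapₐ (nullIdeal E) (HolFun.comp i) (by
    intro f hf
    have h1 : Filter.Tendsto (coordMap i) (𝓝 0) (𝓝 0) := by
      have := (coordMap i).continuous.tendsto 0
      rwa [map_zero] at this
    have h2 := h1.eventually (show ∀ᶠ z in 𝓝 (0 : Fin (finrank ℂ F) → ℂ),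
      (f : F → ℂ) ((coords F).symm z) = 0 from hf)
    refine Filter.Eventually.mono h2 fun z hz => ?_
    rw [coords_symm_coordMap] at hz
    exact hz)

/-- The product of the smooth germ `(E, 0)` with the germ in `F` defined by `J`. -/
def smoothProd (E : Type*) [AddCommGroup E] [Module ℂ E] [FiniteDimensional ℂ E]
    (J : Ideal (HolGerm F)) : Ideal (HolGerm (E × F)) :=
  J.map (pullback (LinearMap.snd ℂ E F))

/-- The intersection of the germ in `F` defined by `J` with a linear subspace `H`, as a germ
in `H`. -/
def interSubspace (H : Submodule ℂ F) (J : Ideal (HolGerm F)) : Ideal (HolGerm H) :=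
  J.map (pullback H.subtype)

/-- The image in `F`, under an injective linear map `i : E → F`, of the germ in `E` defined
by `J`. -/
def pushGerm (i : E →ₗ[ℂ] F) (J : Ideal (HolGerm E)) : Ideal (HolGerm F) :=
  J.comap (pullback i)

/-- For linear subspaces `M'` of `E` and `H` of `F` and a germ in `F` defined by `J`, the germ of
`M' × (H ∩ J)` as a germ in `E × F`. -/
def prodSubgerm (M' : Submodule ℂ E) (H : Submodule ℂ F) (J : Ideal (HolGerm F)) :
    Ideal (HolGerm (E × F)) :=
  pushGerm (M'.subtype.prodMap H.subtype) (smoothProd M' (interSubspace H J))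

/-- Isomorphisms between the analytic germs defined by `I` and by `J`. -/
abbrev GermIso (I : Ideal (HolGerm E)) (J : Ideal (HolGerm F)) : Type _ :=
  (HolGerm E ⧸ I) ≃ₐ[ℂ] (HolGerm F ⧸ J)

/-- `I'` and `J'` define subgerms of the germs defined by `I` and `J`, and the isomorphism `e`
identifies them. -/
def GermIso.Carries {I : Ideal (HolGerm E)} {J : Ideal (HolGerm F)} (e : GermIso I J)
    (I' : Ideal (HolGerm E)) (J' : Ideal (HolGerm F)) : Prop :=
  I ≤ I' ∧ J ≤ J' ∧ ∀ (f : HolGerm E) (g : HolGerm F),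
    e (Ideal.Quotient.mk I f) = Ideal.Quotient.mk J g → (f ∈ I' ↔ g ∈ J')

end Pullback

section Degeneracy

variable {E : Type*} [AddCommGroup E] [Module ℂ E] [FiniteDimensional ℂ E]
  {X Y : Type*} [AddCommGroup X] [Module ℂ X] [AddCommGroup Y] [Module ℂ Y]

/-- The germ at `0` of the degeneracy locus `{e | rank (Φ e) ≤ i}` of a family `Φ` of linear maps
`X → Y` parametrized holomorphically by `E`, with its scheme structure: the ideal generated by the
minors of size `i + 1`. -/
def rankLE (i : ℕ) (Φ : E → (X →ₗ[ℂ] Y)) : Ideal (HolGerm E) :=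
  Ideal.span {g | ∃ (x : Fin (i + 1) → X) (y : Fin (i + 1) → Dual ℂ Y)
    (h : (fun e => (Matrix.of fun r s => y r (Φ e (x s))).det) ∈ HolFun E),
    g = HolFun.germ ⟨_, h⟩}

end Degeneracy

/-! ### Symmetric forms -/

section Sym

variable (X : Type*) [AddCommGroup X] [Module ℂ X]

/-- The subspace of symmetric bilinear forms on `X`. -/
def symSubmodule : Submodule ℂ (X →ₗ[ℂ] X →ₗ[ℂ] ℂ) where
  carrier := {B | ∀ x y, B x y = B y x}
  zero_mem' _ _ := rfl
  add_mem' {B C} hB hC x y := by simp [hB x y, hC x y]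
  smul_mem' c B hB x y := by simp [hB x y]

/-- `Sym² X^∨`, the space of symmetric bilinear forms (equivalently, quadratic forms) on `X`. -/
def SymForms : Type _ := symSubmodule X

instance : AddCommGroup (SymForms X) := inferInstanceAs (AddCommGroup (symSubmodule X))

instance : Module ℂ (SymForms X) := inferInstanceAs (Module ℂ (symSubmodule X))

instance [FiniteDimensional ℂ X] : FiniteDimensional ℂ (SymForms X) :=
  inferInstanceAs (FiniteDimensional ℂ (symSubmodule X))

variable {X}

/-- The linear map `X → X^∨` associated with a symmetric form, so that `s.hom x y` is the value of
the form on `x` and `y`. -/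
def SymForms.hom (s : SymForms X) : X →ₗ[ℂ] Dual ℂ X := (symSubmodule X).subtype s

/-- Restriction of symmetric forms along a linear map. -/
def SymForms.restrict {Y : Type*} [AddCommGroup Y] [Module ℂ Y] (i : X →ₗ[ℂ] Y) :
    SymForms Y →ₗ[ℂ] SymForms X where
  toFun B := ⟨B.hom.compl₁₂ i i, fun x y => B.2 (i x) (i y)⟩
  map_add' _ _ := rfl
  map_smul' _ _ := rfl

/-- The germ at `0` of the scheme `𝒮_{≤ i}` of symmetric forms of rank `≤ i` on `X`. -/
def symRankLE (X : Type*) [AddCommGroup X] [Module ℂ X] [FiniteDimensional ℂ X] (i : ℕ) :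
    Ideal (HolGerm (SymForms X)) :=
  rankLE i fun s : SymForms X => s.hom

end Sym

/-! ### The space `⋀³ V` -/

section Wedge

variable (V : Type*) [AddCommGroup V] [Module ℂ V]

/-- The third exterior power `⋀³ V`. -/
def W3 : Type _ := ⋀[ℂ]^3 V

instance : AddCommGroup (W3 V) := inferInstanceAs (AddCommGroup (⋀[ℂ]^3 V))

instance : Module ℂ (W3 V) := inferInstanceAs (Module ℂ (⋀[ℂ]^3 V))

instance [FiniteDimensional ℂ V] : FiniteDimensional ℂ (W3 V) :=
  inferInstanceAs (Module.Finite ℂ (⋀[ℂ]^3 V))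

variable {V}

/-- `v₁ ∧ v₂ ∧ v₃`. -/
def wedge3 (v : Fin 3 → V) : W3 V := exteriorPower.ιMulti ℂ 3 v

/-- The endomorphism `⋀³ g` of `⋀³ V`. -/
def map3 (g : V →ₗ[ℂ] V) : W3 V →ₗ[ℂ] W3 V := exteriorPower.map 3 g

/-- The wedge product `⋀³ V × ⋀³ V → ⋀⁶ V`, with values in the exterior algebra. -/
def wedgeMul (x y : W3 V) : ExteriorAlgebra ℂ V :=
  Subtype.val (p := (· ∈ ⋀[ℂ]^3 V)) x * Subtype.val (p := (· ∈ ⋀[ℂ]^3 V)) y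

theorem wedgeMul_zero (x : W3 V) : wedgeMul x 0 = 0 := mul_zero _

theorem wedgeMul_add (x y z : W3 V) : wedgeMul x (y + z) = wedgeMul x y + wedgeMul x z :=
  mul_add _ _ _

theorem wedgeMul_smul (c : ℂ) (x y : W3 V) : wedgeMul x (c • y) = c • wedgeMul x y :=
  mul_smul_comm _ _ _

theorem zero_wedgeMul (x : W3 V) : wedgeMul 0 x = 0 := zero_mul _

theorem add_wedgeMul (x y z : W3 V) : wedgeMul (x + y) z = wedgeMul x z + wedgeMul y z :=
  add_mul _ _ _

theorem smul_wedgeMul (c : ℂ) (x y : W3 V) : wedgeMul (c • x) y = c • wedgeMul x y :=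
  smul_mul_assoc _ _ _

end Wedge

/-! ### Lagrangian subspaces of `⋀³ V` and the subspaces `T_U` -/

section Lagrangian

variable {V : Type*} [AddCommGroup V] [Module ℂ V]

/-- `A` is its own orthogonal for the (`⋀⁶ V`-valued) wedge product pairing on `⋀³ V`. -/
def IsLagrangian (A : Submodule ℂ (W3 V)) : Prop :=
  ∀ x : W3 V, x ∈ A ↔ ∀ a ∈ A, wedgeMul x a = 0

/-- A decomposable vector: a nonzero vector `v₁ ∧ v₂ ∧ v₃`. -/
def IsDecomposable (x : W3 V) : Prop :=
  x ≠ 0 ∧ ∃ v : Fin 3 → V, x = wedge3 v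

/-- `T_U = ⋀² U ∧ V`. -/
def TSub (U : Submodule ℂ V) : Submodule ℂ (W3 V) :=
  Submodule.span ℂ {x | ∃ u₁ ∈ U, ∃ u₂ ∈ U, ∃ v : V, x = wedge3 ![u₁, u₂, v]}

/-- `H⁰(P(T_U), I_{𝒞_U}(2))`: the quadratic forms on `T_U` that vanish on the cone `𝒞_U` of
decomposable vectors of `T_U`. -/
def conequadrics (U : Submodule ℂ V) : Submodule ℂ (SymForms (TSub U)) where
  carrier := {B | ∀ t : TSub U, IsDecomposable (t : W3 V) →
    B.hom t t = 0}
  zero_mem' _ _ := rfl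
  add_mem' {B C} hB hC t ht := by
    change B.hom t t + C.hom t t = 0
    rw [hB t ht, hC t ht, add_zero]
  smul_mem' c B hB t ht := by
    change c * B.hom t t = 0
    rw [hB t ht, mul_zero]

/-- The restriction map `r_K : H⁰(P(T_U), I_{𝒞_U}(2)) → Sym² K^∨`, where `K = A ∩ T_U`. -/
def rK (A : Submodule ℂ (W3 V)) (U : Submodule ℂ V) :
    conequadrics U →ₗ[ℂ] SymForms ↥(A ⊓ TSub U) :=
  (SymForms.restrict (Submodule.inclusion (inf_le_right : A ⊓ TSub U ≤ TSub U))).domRestrict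
    (conequadrics U)

/-- The image of `r_K`. -/
def imR (A : Submodule ℂ (W3 V)) (U : Submodule ℂ V) : Submodule ℂ (SymForms ↥(A ⊓ TSub U)) :=
  LinearMap.range (rK A U)

end Lagrangian

/-! ### Affine charts of `Gr(3, V)` and `LG(⋀³ V)`, and the degeneracy loci -/

section Charts

variable {V : Type*} [AddCommGroup V] [Module ℂ V]

/-- For `V = U₀ ⊕ U_∞` and `φ : U₀ → U_∞`, the automorphism `u + w ↦ u + φ(u) + w` of `V`; it maps
`U₀` onto the graph of `φ`, and its inverse is the one attached to `-φ`. -/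
def shear {U₀ Uinf : Submodule ℂ V} (hU : IsCompl U₀ Uinf) (φ : U₀ →ₗ[ℂ] Uinf) : V →ₗ[ℂ] V :=
  LinearMap.id + Uinf.subtype ∘ₗ φ ∘ₗ U₀.projectionOnto Uinf hU

/-- The subspace `{u + φ(u)}` of `V` (or `{a + q(a)}` of `⋀³ V`), graph of a linear map between
two complementary subspaces. -/
def graphSub {W : Type*} [AddCommGroup W] [Module ℂ W] {P Q : Submodule ℂ W} (φ : P →ₗ[ℂ] Q) :
    Submodule ℂ W :=
  LinearMap.range (P.subtype + Q.subtype ∘ₗ φ)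

/-- The linear maps `q : A₀ → L` that are symmetric for the symplectic form `ω`, that is, such that
`ω(a, q(b)) = ω(b, q(a))` for all `a`, `b`. When `A₀` and `L` are complementary Lagrangian
subspaces, these are the maps whose graph is Lagrangian. -/
def lgSubmodule (A₀ L : Submodule ℂ (W3 V)) : Submodule ℂ (A₀ →ₗ[ℂ] L) where
  carrier := {q | ∀ a b : A₀,
    wedgeMul (a : W3 V) (q b : W3 V) + wedgeMul (q a : W3 V) (b : W3 V) = 0}
  zero_mem' _ _ := by simp [wedgeMul_zero, zero_wedgeMul]
  add_mem' {p q} hp hq a b := by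
    simp only [LinearMap.add_apply, Submodule.coe_add, wedgeMul_add, add_wedgeMul]
    rw [add_add_add_comm, hp a b, hq a b, add_zero]
  smul_mem' c q hq a b := by
    simp only [LinearMap.smul_apply, Submodule.coe_smul, wedgeMul_smul, smul_wedgeMul]
    rw [← smul_add, hq a b, smul_zero]

/-- For complementary Lagrangian subspaces `A₀`, `L`, the vector space `LGChart A₀ L` of symmetric
maps `A₀ → L` parametrizes, by taking graphs, the affine open neighbourhood of `[A₀]` in the
Lagrangian Grassmannian that consists of the Lagrangian subspaces complementary to `L`. -/
def LGChart (A₀ L : Submodule ℂ (W3 V)) : Type _ := lgSubmodule A₀ L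

instance (A₀ L : Submodule ℂ (W3 V)) : AddCommGroup (LGChart A₀ L) :=
  inferInstanceAs (AddCommGroup (lgSubmodule A₀ L))

instance (A₀ L : Submodule ℂ (W3 V)) : Module ℂ (LGChart A₀ L) :=
  inferInstanceAs (Module ℂ (lgSubmodule A₀ L))

instance [FiniteDimensional ℂ V] (A₀ L : Submodule ℂ (W3 V)) :
    FiniteDimensional ℂ (LGChart A₀ L) :=
  inferInstanceAs (FiniteDimensional ℂ (lgSubmodule A₀ L))

/-- The linear map `A₀ → L` given by a point of `LGChart A₀ L`. -/
def LGChart.hom {A₀ L : Submodule ℂ (W3 V)} : LGChart A₀ L →ₗ[ℂ] (A₀ →ₗ[ℂ] L) :=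
  (lgSubmodule A₀ L).subtype

variable {U₀ Uinf : Submodule ℂ V} (hU : IsCompl U₀ Uinf) (A₀ L : Submodule ℂ (W3 V))

/-- The morphism `A → ⋀³ V ⧸ T_U` for `A = graphSub q` and `U = graphSub φ`, read in the
trivializations `A₀ ≃ A`, `a ↦ a + q(a)`, and `⋀³ V ⧸ T_U ≃ ⋀³ V ⧸ T_{U₀}` induced by the
inverse of `shear φ`. -/
def degMap (q : A₀ →ₗ[ℂ] L) (φ : U₀ →ₗ[ℂ] Uinf) : A₀ →ₗ[ℂ] (W3 V) ⧸ TSub U₀ :=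
  (TSub U₀).mkQ ∘ₗ map3 (shear hU (-φ)) ∘ₗ (A₀.subtype + L.subtype ∘ₗ q)

variable [FiniteDimensional ℂ V]

/-- The germ at `([A₀], [U₀])` of the scheme `𝒵^{≥ k} = {([A], [U]) | dim (A ∩ T_U) ≥ k}`, in the
charts given by `L` and `U_∞`: the locus where `A → ⋀³ V ⧸ T_U`, a morphism between vector
bundles of rank `10`, has rank at most `10 - k` (for `k ≤ 10`). -/
def ZFamily (k : ℕ) : Ideal (HolGerm (LGChart A₀ L × (U₀ →ₗ[ℂ] Uinf))) :=
  rankLE (10 - k) fun p : LGChart A₀ L × (U₀ →ₗ[ℂ] Uinf) =>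
    degMap hU A₀ L (LGChart.hom p.1) p.2

/-- The germ at `[U₀]` of the scheme `Z^{≥ k}_{A₀} = {[U] | dim (A₀ ∩ T_U) ≥ k}` in the chart of
`Gr(3, V)` given by `U_∞`. -/
def ZLocus (k : ℕ) : Ideal (HolGerm (U₀ →ₗ[ℂ] Uinf)) :=
  rankLE (10 - k) fun φ : U₀ →ₗ[ℂ] Uinf =>
    (TSub U₀).mkQ ∘ₗ map3 (shear hU (-φ)) ∘ₗ A₀.subtype

/-- The germ of `Z^{≥ k}_{A₀}`, embedded in `LG(⋀³ V) × Gr(3, V)` by `[U] ↦ ([A₀], [U])`. -/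
def ZFiber (k : ℕ) : Ideal (HolGerm (LGChart A₀ L × (U₀ →ₗ[ℂ] Uinf))) :=
  pushGerm (LinearMap.inr ℂ (LGChart A₀ L) (U₀ →ₗ[ℂ] Uinf)) (ZLocus hU A₀ k)

end Charts

/-! ### Compatibility checks -/

section Checks

section

variable {E : Type*} [AddCommGroup E] [Module ℂ E] [FiniteDimensional ℂ E]

theorem linear_mem_HolFun (f : E →ₗ[ℂ] ℂ) : (fun e => f e) ∈ HolFun E := by
  have h := (LinearMap.toContinuousLinearMap (f ∘ₗ (coords E).symm.toLinearMap)).analyticAt 0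
  exact h

theorem minor_mem_HolFun {X Y : Type*} [AddCommGroup X] [Module ℂ X] [AddCommGroup Y] [Module ℂ Y]
    {Φ : E → (X →ₗ[ℂ] Y)} (h : ∀ (x : X) (y : Dual ℂ Y), (fun e => y (Φ e x)) ∈ HolFun E)
    {n : ℕ} (x : Fin n → X) (y : Fin n → Dual ℂ Y) :
    (fun e => (Matrix.of fun r s => y r (Φ e (x s))).det) ∈ HolFun E := by
  have : (fun e => (Matrix.of fun r s => y r (Φ e (x s))).det) =
      ∑ σ : Equiv.Perm (Fin n), ((Equiv.Perm.sign σ : ℤ) : ℂ) •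
        ∏ i, (fun e => y (σ i) (Φ e (x i))) := by
    funext e
    simp [Matrix.det_apply, Finset.sum_apply, Units.smul_def]
  rw [this]
  exact sum_mem fun σ _ => Subalgebra.smul_mem _ (prod_mem fun i _ => h _ _) _

theorem multilinear_mem_HolFun {V : Type*} [AddCommGroup V] [Module ℂ V] [FiniteDimensional ℂ V]
    (m : MultilinearMap ℂ (fun _ : Fin 3 => V) ℂ) (F : Fin 3 → E → V)
    (hF : ∀ i (y : Dual ℂ V), (fun e => y (F i e)) ∈ HolFun E) :
    (fun e => m fun i => F i e) ∈ HolFun E := by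
  let b := finBasis ℂ V
  have : (fun e => m fun i => F i e) =
      ∑ r : Fin 3 → Fin (finrank ℂ V), (m fun i => b (r i)) •
        ∏ i, (fun e => b.coord (r i) (F i e)) := by
    funext e
    have h1 : (fun i => F i e) = fun i => ∑ j, b.coord j (F i e) • b j := by
      funext i
      simp
    rw [h1, MultilinearMap.map_sum]
    simp only [MultilinearMap.map_smul_univ, Finset.sum_apply, Pi.smul_apply, Finset.prod_apply,
      smul_eq_mul]
    exact Finset.sum_congr rfl fun r _ => mul_comm _ _
  rw [this]
  exact sum_mem fun r _ => Subalgebra.smul_mem _ (prod_mem fun i _ => hF _ _) _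

end

variable {V : Type*} [AddCommGroup V] [Module ℂ V]

theorem span_wedge3 : Submodule.span ℂ (Set.range (wedge3 (V := V))) = ⊤ :=
  exteriorPower.ιMulti_span ℂ 3 V

theorem map3_wedge3 (g : V →ₗ[ℂ] V) (v : Fin 3 → V) :
    map3 g (wedge3 v) = wedge3 fun i => g (v i) :=
  exteriorPower.map_apply_ιMulti g v

variable {U₀ Uinf : Submodule ℂ V} (hU : IsCompl U₀ Uinf) (A₀ L : Submodule ℂ (W3 V))

theorem map3_shear_mem_HolFun [FiniteDimensional ℂ V] {E : Type*} [AddCommGroup E] [Module ℂ E]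
    [FiniteDimensional ℂ E] (g : E →ₗ[ℂ] (U₀ →ₗ[ℂ] Uinf)) (lam : W3 V →ₗ[ℂ] ℂ) (w : W3 V) :
    (fun p : E => lam (map3 (shear hU (-(g p))) w)) ∈ HolFun E := by
  have hw : w ∈ Submodule.span ℂ (Set.range (wedge3 (V := V))) := by
    rw [span_wedge3]; trivial
  induction hw using Submodule.span_induction with
  | mem x hx =>
    obtain ⟨v, rfl⟩ := hx
    simp only [map3_wedge3]
    have hm := multilinear_mem_HolFun
      (lam.compMultilinearMap (exteriorPower.ιMulti ℂ 3 (M := V)).toMultilinearMap)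
      (fun i (p : E) => shear hU (-(g p)) (v i)) fun i z => by
        have h2 : (fun p : E => z (shear hU (-(g p)) (v i))) =
            algebraMap ℂ _ (z (v i)) + fun p => (-(z ∘ₗ Uinf.subtype ∘ₗ
              (LinearMap.applyₗ (U₀.projectionOnto Uinf hU (v i))) ∘ₗ g)) p := by
          funext p
          simp [shear]
        rw [h2]
        exact add_mem (Subalgebra.algebraMap_mem _ _) (linear_mem_HolFun _)
    exact hm
  | zero =>
    simp only [map_zero]
    exact zero_mem (HolFun E)
  | add x z _ _ hx hz =>
    simp only [map_add]
    exact add_mem hx hz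
  | smul c x _ hx =>
    simp only [map_smul]
    exact Subalgebra.smul_mem _ hx c

theorem degMap_mem_HolFun' [FiniteDimensional ℂ V] {E : Type*} [AddCommGroup E] [Module ℂ E]
    [FiniteDimensional ℂ E] (f : E →ₗ[ℂ] (A₀ →ₗ[ℂ] L)) (g : E →ₗ[ℂ] (U₀ →ₗ[ℂ] Uinf))
    (a : A₀) (y : Dual ℂ (W3 V ⧸ TSub U₀)) :
    (fun p : E => y (degMap hU A₀ L (f p) (g p) a)) ∈ HolFun E := by
  let lam : W3 V →ₗ[ℂ] ℂ := y ∘ₗ (TSub U₀).mkQ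
  let b := finBasis ℂ (W3 V)
  have h3 : (fun p : E => y (degMap hU A₀ L (f p) (g p) a)) =
      ∑ j, (algebraMap ℂ _ (b.coord j (a : W3 V)) + fun p => (b.coord j ∘ₗ L.subtype ∘ₗ
        (LinearMap.applyₗ a) ∘ₗ f) p) * fun p => lam (map3 (shear hU (-(g p))) (b j)) := by
    funext p
    have h4 : y (degMap hU A₀ L (f p) (g p) a) =
        lam (map3 (shear hU (-(g p))) ((a : W3 V) + (f p a : W3 V))) := rfl
    rw [h4, ← b.sum_repr ((a : W3 V) + (f p a : W3 V))]
    simp only [map_sum, map_smul, Finset.sum_apply]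
    refine Finset.sum_congr rfl fun j _ => ?_
    simp
  rw [h3]
  exact sum_mem fun j _ => mul_mem (add_mem (Subalgebra.algebraMap_mem _ _)
    (linear_mem_HolFun _)) (map3_shear_mem_HolFun hU g lam _)

/-- All the minors that define `ZFamily` are holomorphic. -/
theorem degMap_mem_HolFun [FiniteDimensional ℂ V] (a : A₀) (y : Dual ℂ (W3 V ⧸ TSub U₀)) :
    (fun p : LGChart A₀ L × (U₀ →ₗ[ℂ] Uinf) => y (degMap hU A₀ L (LGChart.hom p.1) p.2 a)) ∈
      HolFun (LGChart A₀ L × (U₀ →ₗ[ℂ] Uinf)) :=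
  degMap_mem_HolFun' hU A₀ L (E := LGChart A₀ L × (U₀ →ₗ[ℂ] Uinf))
    (LGChart.hom ∘ₗ LinearMap.fst ℂ (LGChart A₀ L) (U₀ →ₗ[ℂ] Uinf))
    (LinearMap.snd ℂ (LGChart A₀ L) (U₀ →ₗ[ℂ] Uinf)) a y

theorem shear_comp_neg (φ : U₀ →ₗ[ℂ] Uinf) : shear hU φ ∘ₗ shear hU (-φ) = LinearMap.id := by
  ext v
  simp [shear]

theorem map_shear (φ : U₀ →ₗ[ℂ] Uinf) : U₀.map (shear hU φ) = graphSub φ := by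
  ext v
  simp only [Submodule.mem_map, graphSub, LinearMap.mem_range]
  constructor
  · rintro ⟨u, hu, rfl⟩
    refine ⟨⟨u, hu⟩, ?_⟩
    have := Submodule.projectionOnto_apply_left hU ⟨u, hu⟩
    simp only at this
    simp [shear, this]
  · rintro ⟨u, rfl⟩
    exact ⟨u, u.2, by simp [shear]⟩

theorem map3_TSub_le (g : V →ₗ[ℂ] V) (U : Submodule ℂ V) :
    (TSub U).map (map3 g) ≤ TSub (U.map g) := by
  rw [TSub, Submodule.map_span, Submodule.span_le]
  rintro _ ⟨_, ⟨u₁, h₁, u₂, h₂, v, rfl⟩, rfl⟩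
  refine Submodule.subset_span ⟨g u₁, ⟨u₁, h₁, rfl⟩, g u₂, ⟨u₂, h₂, rfl⟩, g v, ?_⟩
  rw [map3_wedge3]
  congr 1
  funext i
  fin_cases i <;> rfl

theorem map3_comp (f g : V →ₗ[ℂ] V) (x : W3 V) : map3 f (map3 g x) = map3 (f ∘ₗ g) x :=
  (LinearMap.congr_fun (exteriorPower.map_comp (n := 3) g f) x).symm

theorem map3_id (x : W3 V) : map3 LinearMap.id x = x :=
  LinearMap.congr_fun (exteriorPower.map_id (R := ℂ) (M := V) (n := 3)) x

/-- The kernel of `degMap q φ` is `A ∩ T_U`, for `A = graphSub q` and `U = graphSub φ`. -/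
theorem degMap_eq_zero_iff (q : A₀ →ₗ[ℂ] L) (φ : U₀ →ₗ[ℂ] Uinf) (a : A₀) :
    degMap hU A₀ L q φ a = 0 ↔ (a : W3 V) + (q a : W3 V) ∈ TSub (graphSub φ) := by
  have h1 : degMap hU A₀ L q φ a = 0 ↔
      map3 (shear hU (-φ)) ((a : W3 V) + (q a : W3 V)) ∈ TSub U₀ :=
    Submodule.Quotient.mk_eq_zero _
  rw [h1]
  have h2 := shear_comp_neg hU φ
  have h3 : shear hU (-φ) ∘ₗ shear hU φ = LinearMap.id := by
    simpa using shear_comp_neg hU (-φ)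
  constructor
  · intro h
    have := map3_TSub_le (shear hU φ) U₀ (Submodule.mem_map_of_mem h)
    rwa [map3_comp, h2, map3_id, map_shear] at this
  · intro h
    have := map3_TSub_le (shear hU (-φ)) _ (Submodule.mem_map_of_mem h)
    rwa [← map_shear hU, ← Submodule.map_comp, h3, Submodule.map_id] at this

/-- The graphs of linear maps `P → Q` are exactly the complements of `Q`. -/
theorem isCompl_iff_graphSub {W : Type*} [AddCommGroup W] [Module ℂ W] {P Q : Submodule ℂ W}
    (h : IsCompl P Q) (B : Submodule ℂ W) :
    IsCompl B Q ↔ ∃! φ : P →ₗ[ℂ] Q, graphSub φ = B := by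
  constructor
  · intro hB
    have key : ∀ p : P, (p : W) - (B.projectionOnto Q hB p : W) ∈ Q := fun p => by
      rw [← Submodule.projectionOnto_apply_eq_zero_iff hB, map_sub,
        Submodule.projectionOnto_apply_left, sub_self]
    let φ : P →ₗ[ℂ] Q := LinearMap.codRestrict Q
      (-(P.subtype - B.subtype ∘ₗ B.projectionOnto Q hB ∘ₗ P.subtype)) fun p => by
        simpa using Q.neg_mem (key p)
    have hφ : ∀ p : P, (p : W) + (φ p : W) = (B.projectionOnto Q hB p : W) := fun p => by
      simp [φ]
    refine ⟨φ, ?_, ?_⟩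
    · apply le_antisymm
      · rintro _ ⟨p, rfl⟩
        change (p : W) + (φ p : W) ∈ B
        rw [hφ]; exact SetLike.coe_mem _
      · intro x hx
        refine ⟨P.projectionOnto Q h x, ?_⟩
        change ((P.projectionOnto Q h x : P) : W) + (φ (P.projectionOnto Q h x) : W) = x
        rw [hφ]
        have h1 : ((P.projectionOnto Q h x : P) : W) - x ∈ Q := by
          rw [← Submodule.projectionOnto_apply_eq_zero_iff h, map_sub,
            Submodule.projectionOnto_apply_left, sub_self]
        rw [← Submodule.projectionOnto_apply_eq_zero_iff hB, map_sub, sub_eq_zero] at h1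
        rw [h1]
        have := Submodule.projectionOnto_apply_left hB ⟨x, hx⟩
        exact congrArg Subtype.val this
    · intro ψ hψ
      ext p
      have h1 : (p : W) + (ψ p : W) ∈ B := by rw [← hψ]; exact ⟨p, rfl⟩
      have h2 : (p : W) + (φ p : W) ∈ B := by rw [hφ]; exact SetLike.coe_mem _
      have h3 : (ψ p : W) - (φ p : W) ∈ B := by
        have := B.sub_mem h1 h2
        rwa [add_sub_add_left_eq_sub] at this
      have h4 := Submodule.disjoint_def.1 hB.disjoint _ h3 (Q.sub_mem (ψ p).2 (φ p).2)
      exact sub_eq_zero.1 h4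
  · rintro ⟨φ, rfl, -⟩
    constructor
    · rw [Submodule.disjoint_def]
      rintro _ ⟨p, rfl⟩ hx
      have hx' : (p : W) + (φ p : W) ∈ Q := hx
      have hp : (p : W) ∈ Q := by simpa using Q.sub_mem hx' (φ p).2
      have h0 : p = 0 := Subtype.ext (Submodule.disjoint_def.1 h.disjoint _ p.2 hp)
      simp [h0]
    · rw [codisjoint_iff_le_sup]
      intro x _
      have hx : x ∈ P ⊔ Q := by rw [h.sup_eq_top]; trivial
      obtain ⟨p, hp, q, hq, rfl⟩ := Submodule.mem_sup.1 hx
      refine Submodule.mem_sup.2 ⟨p + φ ⟨p, hp⟩, ⟨⟨p, hp⟩, rfl⟩, q - φ ⟨p, hp⟩,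
        Q.sub_mem hq (SetLike.coe_mem _), by abel⟩

/-- The graph of a linear map `q : A₀ → L` between complementary Lagrangian subspaces is isotropic
if and only if `q` belongs to the chart. -/
theorem mem_lgSubmodule_iff (hA : IsLagrangian A₀) (hL : IsLagrangian L) (q : A₀ →ₗ[ℂ] L) :
    q ∈ lgSubmodule A₀ L ↔ ∀ x ∈ graphSub q, ∀ y ∈ graphSub q, wedgeMul x y = 0 := by
  have hexp : ∀ a b : A₀, wedgeMul ((a : W3 V) + (q a : W3 V)) ((b : W3 V) + (q b : W3 V)) =
      wedgeMul (a : W3 V) (q b : W3 V) + wedgeMul (q a : W3 V) (b : W3 V) := fun a b => by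
    rw [add_wedgeMul, wedgeMul_add, wedgeMul_add, (hA a).1 a.2 b b.2,
      (hL (q a)).1 (q a).2 (q b) (q b).2, zero_add, add_zero]
  constructor
  · rintro h _ ⟨a, rfl⟩ _ ⟨b, rfl⟩
    exact (hexp a b).trans (h a b)
  · intro h a b
    exact (hexp a b).symm.trans (h _ ⟨a, rfl⟩ _ ⟨b, rfl⟩)

end Checks

end EPW

end

/-! Near the base point the morphism A → ⋀³V/T_U becomes a family of quadratic forms on K. The shear
moves T_U back to the fixed space T_{U₀}. In Darboux coordinates adapted to A₀ and T_{U₀}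
(`exists_adapted_basis`), isotropy of the moving Lagrangian says that the Schur complement of the
invertible block is a symmetric ℓ×ℓ matrix Q of germs with Q(0) = 0, whose minor ideals are those of
the degeneracy loci up to a shift of sizes (`exists_symmetric_schurComplement`, `exists_localForm`).

The derivative of Q at (q, φ) is the form ω(q x, y) − ω(dφ x, y) on K. The first term alone is onto
Sym²K^∨ (`lgForm_surjective`), so the entries of Q extend to a coordinate system: this gives the
product structure of the universal locus. The second term, the derivative of the restriction Q₀ of Q
to A = A₀, has image Im(r_K): the decomposable vectors of T_{U₀} form the cone with vertex ⋀³U₀ over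
the Segre variety ℙ²×ℙ², and the quadrics through it are combinations of the nine 2×2 minors, which
are the forms ω(dφ t, t) (`exists_tangentForm_eq`).

To measure Im(r_K), view a linear form on Sym²K^∨ as a symmetric tensor P. If P ≠ 0 kills Im(r_K)
and has rank at most 3, pure linear algebra (`hasRankOne_of_finrank_le`) yields a nonzero vector of
K whose 3×3 matrix has rank at most one, that is, a decomposable vector of A₀, which is excluded
(`tensor_eq_zero`). So r_K is onto for ℓ ≤ 3. For ℓ = 4 the image has dimension at most 9 < 10, so a
nonzero P exists; all of them are nondegenerate, and since a pencil of tensors contains a singular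
member, P is unique up to a scalar.

When ℓ = 4 the family Q₀ sweeps out a hypersurface that is only tangent to the hyperplane Im(r_K).
As trace(P Q₀) vanishes to order two, it equals trace(N Q₀) with N symmetric and N(0) = 0. Solving
gPgᵗ = P − N gives trace(P gᵗQ₀g) = trace(gPgᵗQ₀) = 0: the change of frame g, which preserves minor
ideals, moves the family into the hyperplane (`exists_congruence_trace_eq_zero`,
`exists_normalized_family`). The inverse function theorem, applied with compatible coordinates to
the total space and to the fibre over A₀, concludes (`exists_germIso_carries`,
`nonempty_germIso_interSubspace`). -/

noncomputable section

namespace EPW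

set_option linter.unusedSectionVars false

/-! ### The local ring of holomorphic germs: value, derivative, units, Hadamard's lemma. -/

section GermRing

variable {E : Type*} [AddCommGroup E] [Module ℂ E] [FiniteDimensional ℂ E]

/-- A holomorphic function read in the coordinates of `E`. -/
def holChart (f : HolFun E) : (Fin (finrank ℂ E) → ℂ) → ℂ :=
  fun z => (f : E → ℂ) ((coords E).symm z)

theorem holChart_analyticAt (f : HolFun E) : AnalyticAt ℂ (holChart f) 0 := f.2

variable (E) in
/-- Taking germs, as a morphism of algebras. -/
def germHom : HolFun E →ₐ[ℂ] HolGerm E := Ideal.Quotient.mkₐ ℂ (nullIdeal E)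

theorem germHom_surjective : Function.Surjective (germHom E) := Ideal.Quotient.mk_surjective

theorem germHom_eq_iff {f g : HolFun E} : germHom E f = germHom E g ↔
    (holChart f) =ᶠ[𝓝 0] (holChart g) := by
  have h : germHom E f = germHom E g ↔ f - g ∈ nullIdeal E := Ideal.Quotient.eq
  rw [h]
  constructor
  · intro h1
    filter_upwards [show ∀ᶠ z in 𝓝 (0 : Fin (finrank ℂ E) → ℂ),
      ((f - g : HolFun E) : E → ℂ) ((coords E).symm z) = 0 from h1] with z hz
    exact sub_eq_zero.1 hz
  · intro h1
    refine Filter.Eventually.mono h1 fun z hz => ?_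
    exact sub_eq_zero.2 hz

variable (E) in
/-- Evaluation of holomorphic functions at `0`. -/
def evFun : HolFun E →ₐ[ℂ] ℂ := (Pi.evalAlgHom ℂ (fun _ : E => ℂ) 0).comp (HolFun E).val

theorem evFun_eq_chart (f : HolFun E) : evFun E f = (holChart f) 0 := by
  simp [evFun, holChart]

variable (E) in
/-- Evaluation of germs at `0`. -/
def ev : HolGerm E →ₐ[ℂ] ℂ :=
  Ideal.Quotient.liftₐ (nullIdeal E) (evFun E) fun f hf => by
    rw [evFun_eq_chart]
    have h : ∀ᶠ z in 𝓝 (0 : Fin (finrank ℂ E) → ℂ), holChart f z = 0 := hf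
    exact h.self_of_nhds

@[simp]
theorem ev_germHom (f : HolFun E) : ev E (germHom E f) = (f : E → ℂ) 0 := rfl

/-- Derivative at `0` of a holomorphic function. -/
def dFun (f : HolFun E) : Dual ℂ E :=
  (fderiv ℂ (holChart f) 0).toLinearMap ∘ₗ (coords E).toLinearMap

/-- Representative of a germ. -/
def rep (f : HolGerm E) : HolFun E := Function.surjInv germHom_surjective f

@[simp]
theorem germHom_rep (f : HolGerm E) : germHom E (rep f) = f :=
  Function.surjInv_eq germHom_surjective f

theorem dFun_congr {f g : HolFun E} (h : germHom E f = germHom E g) : dFun f = dFun g := by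
  rw [germHom_eq_iff] at h
  rw [dFun, dFun, h.fderiv_eq]

variable (E) in
/-- Derivative at `0` of a germ. -/
def dGerm : HolGerm E →ₗ[ℂ] Dual ℂ E where
  toFun f := dFun (rep f)
  map_add' f g := by
    have h : dFun (rep (f + g)) = dFun (rep f + rep g) := dFun_congr (by simp)
    rw [h]
    have h2 : (holChart (rep f + rep g)) = (holChart (rep f)) + (holChart (rep g)) := rfl
    rw [dFun, h2, fderiv_add (holChart_analyticAt (rep f)).differentiableAt
      (holChart_analyticAt (rep g)).differentiableAt]
    rfl
  map_smul' c f := by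
    have h : dFun (rep (c • f)) = dFun (c • rep f) := dFun_congr (by simp)
    rw [h]
    have h2 : (holChart (c • rep f)) = c • (holChart (rep f)) := rfl
    rw [dFun, h2, fderiv_const_smul (holChart_analyticAt (rep f)).differentiableAt]
    rfl

theorem dGerm_germHom (f : HolFun E) : dGerm E (germHom E f) = dFun f :=
  dFun_congr (by simp)

theorem dGerm_mul (f g : HolGerm E) :
    dGerm E (f * g) = ev E f • dGerm E g + ev E g • dGerm E f := by
  obtain ⟨f, rfl⟩ := germHom_surjective f
  obtain ⟨g, rfl⟩ := germHom_surjective g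
  rw [← map_mul, dGerm_germHom, dGerm_germHom, dGerm_germHom]
  have h2 : (holChart (f * g)) = (holChart f) * (holChart g) := rfl
  have h3 : ∀ f : HolFun E, ev E (germHom E f) = (holChart f) 0 := fun f => evFun_eq_chart f
  rw [dFun, h2, fderiv_mul (holChart_analyticAt f).differentiableAt
      (holChart_analyticAt g).differentiableAt, h3, h3]
  rfl

theorem dFun_apply (f : HolFun E) (x : E) :
    dFun f x = deriv (fun t : ℂ => (f : E → ℂ) (t • x)) 0 := by
  have h1 : HasFDerivAt (holChart f) (fderiv ℂ (holChart f) 0) ((0 : ℂ) • coords E x) := by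
    rw [zero_smul]; exact (holChart_analyticAt f).differentiableAt.hasFDerivAt
  have h2 : HasDerivAt (fun t : ℂ => t • coords E x) (coords E x) 0 := by
    simpa using (hasDerivAt_id (0 : ℂ)).smul_const (coords E x)
  have h3 := h1.comp_hasDerivAt (0 : ℂ) h2
  have h4 : ((holChart f) ∘ fun t : ℂ => t • coords E x) = fun t : ℂ => (f : E → ℂ) (t • x) := by
    funext t
    simp [holChart]
  rw [h4] at h3
  rw [h3.deriv]
  rfl

theorem isUnit_of_ev_ne_zero {f : HolGerm E} (h : ev E f ≠ 0) : IsUnit f := by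
  obtain ⟨f, rfl⟩ := germHom_surjective f
  have h0 : (holChart f) 0 ≠ 0 := by rwa [← evFun_eq_chart]
  -- At zeros of `f` the pointwise inverse takes the default value 0; the germ does not see them, as
  -- `f` has no zero near the origin.
  let g : HolFun E := ⟨fun x => ((f : E → ℂ) x)⁻¹, (holChart_analyticAt f).inv h0⟩
  refine IsUnit.of_mul_eq_one (germHom E g) ?_
  rw [← map_mul, ← map_one (germHom E), germHom_eq_iff]
  have h1 : ∀ᶠ z in 𝓝 (0 : Fin (finrank ℂ E) → ℂ), (holChart f) z ≠ 0 :=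
    (holChart_analyticAt f).continuousAt.eventually_ne h0
  filter_upwards [h1] with z hz
  exact mul_inv_cancel₀ hz

theorem isUnit_iff_ev_ne_zero {f : HolGerm E} : IsUnit f ↔ ev E f ≠ 0 :=
  ⟨fun h => (h.map (ev E)).ne_zero, isUnit_of_ev_ne_zero⟩

/-- The germ of a linear form. -/
def linGerm : Dual ℂ E →ₗ[ℂ] HolGerm E where
  toFun y := germHom E ⟨fun e => y e, linear_mem_HolFun y⟩
  map_add' y z := by rw [← map_add]; rfl
  map_smul' c y := by rw [RingHom.id_apply, ← map_smul]; rfl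

@[simp]
theorem ev_linGerm (y : Dual ℂ E) : ev E (linGerm y) = 0 := by
  simp [linGerm]

@[simp]
theorem dGerm_linGerm (y : Dual ℂ E) : dGerm E (linGerm y) = y := by
  ext x
  simp only [linGerm, LinearMap.coe_mk, AddHom.coe_mk, dGerm_germHom, dFun_apply, map_smul,
    smul_eq_mul]
  simp

/-- Any morphism of algebras is local: if `f` and `α f` had different values at 0, then `f` minus
the value of `α f` would be a unit whose image vanishes at 0. -/
theorem ev_algHom {F : Type*} [AddCommGroup F] [Module ℂ F] [FiniteDimensional ℂ F]
    (α : HolGerm F →ₐ[ℂ] HolGerm E) (f : HolGerm F) : ev E (α f) = ev F f := by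
  by_contra h
  have h1 : IsUnit (f - algebraMap ℂ _ (ev E (α f))) := by
    apply isUnit_of_ev_ne_zero
    simpa [sub_eq_zero] using fun h2 => h h2.symm
  have h2 := isUnit_iff_ev_ne_zero.1 (h1.map α)
  simp at h2

/-- A germ that vanishes at `0` is a combination of the coordinate functions. -/
theorem exists_eq_sum_linGerm (f : HolGerm E) (hf : ev E f = 0) :
    ∃ c : Fin (finrank ℂ E) → HolGerm E,
      f = ∑ i, linGerm ((finBasis ℂ E).coord i) * c i := by
  obtain ⟨f, rfl⟩ := germHom_surjective f
  -- Hadamard's lemma by shifting the power series: f(z) = f(0) + S(z)(z), where S = `p.shift.sum`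
  -- takes values in linear forms. The coefficients are the values of S(z) on the coordinate
  -- vectors.
  obtain ⟨p, r, hp⟩ := (holChart_analyticAt f)
  have hrad : 0 < p.shift.radius := by
    rw [FormalMultilinearSeries.radius_shift]; exact hp.r_pos.trans_le hp.r_le
  have hs := p.shift.hasFPowerSeriesOnBall hrad
  have han : ∀ i, AnalyticAt ℂ (fun z => p.shift.sum z (Pi.single i 1)) 0 := fun i =>
    ((ContinuousLinearMap.apply ℂ ℂ
      (Pi.single i (1 : ℂ) : Fin (finrank ℂ E) → ℂ)).analyticAt _).comp hs.analyticAt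
  let c : Fin (finrank ℂ E) → HolFun E := fun i =>
    ⟨fun x => p.shift.sum (coords E x) (Pi.single i 1), by
      change AnalyticAt ℂ _ _
      simpa using han i⟩
  refine ⟨fun i => germHom E (c i), ?_⟩
  have h0 : (holChart f) 0 = 0 := by rw [← evFun_eq_chart]; exact hf
  simp only [linGerm, LinearMap.coe_mk, AddHom.coe_mk, ← map_mul, ← map_sum]
  rw [germHom_eq_iff]
  have hu := hs.unshift (z := (0 : ℂ))
  have hball : ∀ᶠ z in 𝓝 (0 : Fin (finrank ℂ E) → ℂ), z ∈ Metric.eball 0 r :=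
    Metric.eball_mem_nhds _ hp.r_pos
  have hball2 : ∀ᶠ z in 𝓝 (0 : Fin (finrank ℂ E) → ℂ), z ∈ Metric.eball 0 p.shift.radius :=
    Metric.eball_mem_nhds _ hrad
  filter_upwards [hball, hball2] with z hz hz2
  have h1 := hp.hasSum hz
  have h2 := hu.hasSum hz2
  -- The constant term restored by `unshift` is 0 because `f` vanishes at the origin.
  have h3 : p.shift.unshift 0 = p := by
    funext n
    cases n with
    | zero =>
      ext v
      have := hp.coeff_zero v
      rw [h0] at this
      rw [this]
      simp [FormalMultilinearSeries.unshift]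
    | succ n =>
      ext v
      simp [FormalMultilinearSeries.unshift, FormalMultilinearSeries.shift]
  rw [h3] at h2
  have h4 := h1.unique h2
  rw [zero_add] at h4
  rw [h4]
  simp only [zero_add, sub_zero]
  have h5 : z = ∑ i, z i • (Pi.single i (1 : ℂ) : Fin (finrank ℂ E) → ℂ) := by
    ext j; simp [Finset.sum_apply, Pi.single_apply]
  have h6 : p.shift.sum z z = ∑ i, z i * p.shift.sum z (Pi.single i 1) := by
    have h7 := congrArg (p.shift.sum z) h5
    rw [map_sum] at h7
    simpa using h7
  rw [h6]
  simp only [holChart, AddSubmonoidClass.coe_finsetSum, Finset.sum_apply, MulMemClass.coe_mul,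
    Pi.mul_apply, c, LinearEquiv.apply_symm_apply]
  refine Finset.sum_congr rfl fun i _ => ?_
  congr 1
  simp [coords, Finsupp.single_apply]

end GermRing

/-! ### Holomorphic maps, the morphisms they induce on germs, and the inverse function theorem. -/

section Pull

variable {E F G : Type*} [AddCommGroup E] [Module ℂ E] [FiniteDimensional ℂ E]
  [AddCommGroup F] [Module ℂ F] [FiniteDimensional ℂ F]
  [AddCommGroup G] [Module ℂ G] [FiniteDimensional ℂ G]

/-- Maps that are holomorphic near `0` and fix `0`. -/
structure IsHolMap (Ψ : E → F) : Prop where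
  mem : ∀ y : Dual ℂ F, (fun e => y (Ψ e)) ∈ HolFun E
  apply_zero : Ψ 0 = 0

/-- A map read in coordinates. -/
def mapChart (Ψ : E → F) : (Fin (finrank ℂ E) → ℂ) → (Fin (finrank ℂ F) → ℂ) :=
  fun z => coords F (Ψ ((coords E).symm z))

namespace IsHolMap

variable {Ψ Ψ' : E → F}

theorem analyticAt (h : IsHolMap Ψ) : AnalyticAt ℂ (mapChart Ψ) 0 :=
  analyticAt_pi_iff.2 fun i =>
    h.mem (LinearMap.proj (φ := fun _ => ℂ) i ∘ₗ (coords F).toLinearMap)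

theorem mapChart_zero (h : IsHolMap Ψ) : mapChart Ψ 0 = 0 := by
  simp [mapChart, h.apply_zero]

theorem tendsto (h : IsHolMap Ψ) : Filter.Tendsto (mapChart Ψ) (𝓝 0) (𝓝 0) := by
  have := h.analyticAt.continuousAt.tendsto
  rwa [h.mapChart_zero] at this

theorem holChart_comp_analyticAt (h : IsHolMap Ψ) (f : HolFun F) :
    AnalyticAt ℂ (holChart f ∘ mapChart Ψ) 0 :=
  AnalyticAt.comp (by rw [h.mapChart_zero]; exact holChart_analyticAt f) h.analyticAt

theorem holChart_comp (f : HolFun F) :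
    holChart f ∘ mapChart Ψ = fun z => (f : F → ℂ) (Ψ ((coords E).symm z)) := by
  funext z
  simp [holChart, mapChart]

/-- Composition of holomorphic functions with a holomorphic map. -/
def comp (h : IsHolMap Ψ) : HolFun F →ₐ[ℂ] HolFun E where
  toFun f := ⟨fun x => (f : F → ℂ) (Ψ x), by
    have := h.holChart_comp_analyticAt f
    rw [holChart_comp] at this
    exact this⟩
  map_one' := rfl
  map_mul' _ _ := rfl
  map_zero' := rfl
  map_add' _ _ := rfl
  commutes' _ := rfl

theorem holChart_comp_eq (h : IsHolMap Ψ) (f : HolFun F) :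
    holChart (h.comp f) = holChart f ∘ mapChart Ψ := (holChart_comp f).symm

/-- Pullback of germs along a holomorphic map. -/
def pull (h : IsHolMap Ψ) : HolGerm F →ₐ[ℂ] HolGerm E :=
  Ideal.quotientMapₐ (nullIdeal E) h.comp (by
    intro f hf
    have h1 : ∀ᶠ z in 𝓝 (0 : Fin (finrank ℂ F) → ℂ), holChart f z = 0 := hf
    refine Filter.Eventually.mono (h.tendsto.eventually h1) fun z hz => ?_
    have := congrFun (h.holChart_comp_eq f) z
    exact this.trans hz)

theorem pull_germHom (h : IsHolMap Ψ) (f : HolFun F) :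
    h.pull (germHom F f) = germHom E (h.comp f) := rfl

theorem pull_linGerm (h : IsHolMap Ψ) (y : Dual ℂ F) :
    h.pull (linGerm y) = germHom E ⟨_, h.mem y⟩ := rfl

theorem pull_ext (h : IsHolMap Ψ) (h' : IsHolMap Ψ')
    (H : ∀ y, h.pull (linGerm y) = h'.pull (linGerm y)) : h.pull = h'.pull := by
  have h1 : mapChart Ψ =ᶠ[𝓝 0] mapChart Ψ' := by
    have h2 : ∀ i, ∀ᶠ z in 𝓝 0, mapChart Ψ z i = mapChart Ψ' z i := fun i => by
      have := H (LinearMap.proj (φ := fun _ => ℂ) i ∘ₗ (coords F).toLinearMap)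
      rw [pull_linGerm, pull_linGerm, germHom_eq_iff] at this
      exact this
    filter_upwards [Filter.eventually_all.2 h2] with z hz
    exact funext hz
  ext f
  obtain ⟨f, rfl⟩ := germHom_surjective f
  rw [pull_germHom, pull_germHom, germHom_eq_iff, holChart_comp_eq, holChart_comp_eq]
  filter_upwards [h1] with z hz
  simp [hz]

theorem linear (i : E →ₗ[ℂ] F) : IsHolMap i := ⟨fun y => linear_mem_HolFun (y ∘ₗ i), map_zero i⟩

theorem then_ {Φ : F → G} (h : IsHolMap Ψ) (h' : IsHolMap Φ) : IsHolMap (Φ ∘ Ψ) :=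
  ⟨fun y => (h.comp ⟨_, h'.mem y⟩).2, by simp [h.apply_zero, h'.apply_zero]⟩

theorem pull_comp_pull {Φ : F → G} (h : IsHolMap Ψ) (h' : IsHolMap Φ) :
    h.pull.comp h'.pull = (h.then_ h').pull := by
  ext f
  obtain ⟨f, rfl⟩ := germHom_surjective f
  rfl

end IsHolMap

/-- Morphisms of algebras of germs that come from holomorphic maps. -/
def IsPull (α : HolGerm F →ₐ[ℂ] HolGerm E) : Prop :=
  ∃ (Ψ : E → F) (h : IsHolMap Ψ), α = h.pull

/-- The images of the linear forms are the coordinates of the underlying map, hence determine its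
germ. An arbitrary morphism of algebras would need a separate argument; this is why `IsPull` is
carried along. -/
theorem IsPull.ext {α β : HolGerm F →ₐ[ℂ] HolGerm E} (hα : IsPull α) (hβ : IsPull β)
    (H : ∀ y, α (linGerm y) = β (linGerm y)) : α = β := by
  obtain ⟨Ψ, h, rfl⟩ := hα
  obtain ⟨Ψ', h', rfl⟩ := hβ
  exact h.pull_ext h' H

theorem IsPull.comp {α : HolGerm F →ₐ[ℂ] HolGerm E} {β : HolGerm G →ₐ[ℂ] HolGerm F}
    (hα : IsPull α) (hβ : IsPull β) : IsPull (α.comp β) := by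
  obtain ⟨Ψ, h, rfl⟩ := hα
  obtain ⟨Ψ', h', rfl⟩ := hβ
  exact ⟨_, h.then_ h', h.pull_comp_pull h'⟩

theorem isPull_pullback (i : E →ₗ[ℂ] F) : IsPull (pullback i) := ⟨_, IsHolMap.linear i, rfl⟩

theorem pullback_linGerm (i : E →ₗ[ℂ] F) (y : Dual ℂ F) :
    pullback i (linGerm y) = linGerm (y ∘ₗ i) := rfl

theorem pullback_germHom (i : E →ₗ[ℂ] F) (f : HolFun F) :
    pullback i (germHom F f) = germHom E (HolFun.comp i f) := rfl

theorem dGerm_pullback (i : E →ₗ[ℂ] F) (f : HolGerm F) :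
    dGerm E (pullback i f) = dGerm F f ∘ₗ i := by
  obtain ⟨f, rfl⟩ := germHom_surjective f
  rw [pullback_germHom, dGerm_germHom, dGerm_germHom]
  ext x
  rw [LinearMap.comp_apply, dFun_apply, dFun_apply]
  congr 1
  funext t
  exact congrArg (f : F → ℂ) (map_smul i t x)

/-- Elements of the maximal ideal of `HolGerm E`, prescribed linearly for the linear forms on `F`,
are the components of a holomorphic map `E → F`. -/
theorem exists_isHolMap (m : Dual ℂ F →ₗ[ℂ] HolGerm E) (hm : ∀ y, ev E (m y) = 0) :
    ∃ (Ψ : E → F) (h : IsHolMap Ψ), ∀ y, h.pull (linGerm y) = m y := by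
  let b := finBasis ℂ F
  let Ψ : E → F := fun e => ∑ i, (rep (m (b.coord i)) : E → ℂ) e • b i
  have hy : ∀ y : Dual ℂ F, (fun e => y (Ψ e)) =
      ((∑ i, y (b i) • rep (m (b.coord i)) : HolFun E) : E → ℂ) := fun y => by
    funext e
    simp only [Ψ, map_sum, map_smul, AddSubmonoidClass.coe_finsetSum, Finset.sum_apply,
      Subalgebra.coe_smul, Pi.smul_apply, smul_eq_mul]
    exact Finset.sum_congr rfl fun i _ => mul_comm _ _
  have h : IsHolMap Ψ := by
    refine ⟨fun y => by rw [hy]; exact SetLike.coe_mem _, ?_⟩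
    refine Finset.sum_eq_zero fun i _ => ?_
    have := hm (b.coord i)
    rw [← germHom_rep (m (b.coord i)), ev_germHom] at this
    rw [this, zero_smul]
  refine ⟨Ψ, h, fun y => ?_⟩
  rw [h.pull_linGerm]
  have h2 : (⟨_, h.mem y⟩ : HolFun E) = ∑ i, y (b i) • rep (m (b.coord i)) :=
    Subtype.ext (hy y)
  -- Representatives were chosen on the dual basis only; linearity of `m` gives the other linear
  -- forms, at the level of germs.
  have h3 : y = ∑ i, y (b i) • b.coord i := by
    refine b.ext fun j => ?_
    simp
  conv_rhs => rw [h3]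
  rw [h2, map_sum, map_sum]
  simp only [map_smul, germHom_rep]

/-- The morphism of algebras `HolGerm F → HolGerm E` with prescribed values on linear forms. -/
def pullLin (m : Dual ℂ F →ₗ[ℂ] HolGerm E) (hm : ∀ y, ev E (m y) = 0) :
    HolGerm F →ₐ[ℂ] HolGerm E :=
  (exists_isHolMap m hm).choose_spec.choose.pull

theorem isPull_pullLin (m : Dual ℂ F →ₗ[ℂ] HolGerm E) (hm : ∀ y, ev E (m y) = 0) :
    IsPull (pullLin m hm) := ⟨_, _, rfl⟩

@[simp]
theorem pullLin_linGerm (m : Dual ℂ F →ₗ[ℂ] HolGerm E) (hm : ∀ y, ev E (m y) = 0)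
    (y : Dual ℂ F) : pullLin m hm (linGerm y) = m y :=
  (exists_isHolMap m hm).choose_spec.choose_spec y

/-- Inverse function theorem. -/
theorem pull_bijective_of_bijective_dGerm {Ψ : E → F} (h : IsHolMap Ψ)
    (hd : Function.Bijective fun y : Dual ℂ F => dGerm E (h.pull (linGerm y))) :
    Function.Bijective h.pull := by
  have hf := h.analyticAt.hasStrictFDerivAt
  set Φ := fderiv ℂ (mapChart Ψ) 0 with hΦ
  -- The derivative of the pullback of `y` is `y` composed with the Jacobian Φ, so the hypothesis
  -- says that the transpose of Φ is bijective. Then so is Φ.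
  have hcomp : ∀ (y : Dual ℂ F) (x : E), dGerm E (h.pull (linGerm y)) x =
      y ((coords F).symm (Φ (coords E x))) := fun y x => by
    rw [h.pull_linGerm, dGerm_germHom, dFun]
    let y' : (Fin (finrank ℂ F) → ℂ) →L[ℂ] ℂ :=
      LinearMap.toContinuousLinearMap (y ∘ₗ (coords F).symm.toLinearMap)
    have h1 : holChart (⟨_, h.mem y⟩ : HolFun E) = y' ∘ mapChart Ψ := by
      funext z
      simp [holChart, mapChart, y']
    rw [h1, (y'.hasFDerivAt.comp 0 hf.hasFDerivAt).fderiv]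
    rfl
  have hinj : Function.Injective Φ := by
    rw [injective_iff_map_eq_zero]
    intro z hz
    obtain ⟨x, rfl⟩ := (coords E).surjective z
    rw [LinearEquiv.map_eq_zero_iff, ← Module.forall_dual_apply_eq_zero_iff ℂ]
    intro α
    obtain ⟨y, rfl⟩ := hd.2 α
    change dGerm E (h.pull (linGerm y)) x = 0
    rw [hcomp, hz, map_zero, map_zero]
  have hsurj : Function.Surjective Φ := by
    rw [← ContinuousLinearMap.coe_coe, ← LinearMap.range_eq_top]
    by_contra hne
    obtain ⟨g, hg0, hg⟩ := Submodule.exists_le_ker_of_lt_top _ (lt_top_iff_ne_top.2 hne)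
    have h2 : g ∘ₗ (coords F).toLinearMap = 0 := by
      apply hd.1
      ext x
      beta_reduce
      rw [hcomp, map_zero, map_zero]
      simpa using hg (LinearMap.mem_range_self _ (coords E x))
    apply hg0
    ext i
    have := LinearMap.congr_fun h2 ((coords F).symm (Pi.single i 1))
    simpa using this
  let Φe : (Fin (finrank ℂ E) → ℂ) ≃L[ℂ] (Fin (finrank ℂ F) → ℂ) :=
    (LinearEquiv.ofBijective Φ.toLinearMap ⟨hinj, hsurj⟩).toContinuousLinearEquiv
  have hΦe : (Φe : (Fin (finrank ℂ E) → ℂ) →L[ℂ] (Fin (finrank ℂ F) → ℂ)) = Φ := by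
    ext z; rfl
  have hf' : HasStrictFDerivAt (mapChart Ψ)
      (Φe : (Fin (finrank ℂ E) → ℂ) →L[ℂ] (Fin (finrank ℂ F) → ℂ)) 0 := by rw [hΦe]; exact hf
  -- The local inverse is analytic at 0, and composition with it inverts the pullback.
  let e := hf'.toOpenPartialHomeomorph (mapChart Ψ)
  have he : (e : (Fin (finrank ℂ E) → ℂ) → _) = mapChart Ψ :=
    hf'.toOpenPartialHomeomorph_coe
  have hsrc : (0 : Fin (finrank ℂ E) → ℂ) ∈ e.source :=
    hf'.mem_toOpenPartialHomeomorph_source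
  have he0 : e 0 = 0 := by rw [he, h.mapChart_zero]
  have htgt : (0 : Fin (finrank ℂ F) → ℂ) ∈ e.target := by
    rw [← he0]; exact e.map_source hsrc
  have hsymm : AnalyticAt ℂ e.symm 0 := by
    have := e.analyticAt_symm' (i := Φe) hsrc (by rw [he]; exact h.analyticAt)
      (by rw [he, hΦe])
    rwa [he0] at this
  have hs0 : e.symm 0 = 0 := by
    have := e.left_inv hsrc
    rwa [he0] at this
  have hts : Filter.Tendsto e.symm (𝓝 0) (𝓝 0) := by
    have := hsymm.continuousAt.tendsto
    rwa [hs0] at this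
  constructor
  · rw [injective_iff_map_eq_zero]
    intro f hf0
    obtain ⟨f, rfl⟩ := germHom_surjective f
    rw [h.pull_germHom, ← map_zero (germHom E), germHom_eq_iff, h.holChart_comp_eq] at hf0
    rw [← map_zero (germHom F), germHom_eq_iff]
    filter_upwards [hts.eventually hf0, e.open_target.mem_nhds htgt] with z hz hzt
    have h3 : mapChart Ψ (e.symm z) = z := by
      rw [← he]; exact e.right_inv hzt
    have hz' : holChart f (mapChart Ψ (e.symm z)) = 0 := hz
    rw [h3] at hz'
    exact hz'
  · intro f
    obtain ⟨f, rfl⟩ := germHom_surjective f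
    let g : HolFun F := ⟨fun x => holChart f (e.symm (coords F x)), by
      have : AnalyticAt ℂ (holChart f ∘ e.symm) 0 :=
        AnalyticAt.comp (by rw [hs0]; exact holChart_analyticAt f) hsymm
      change AnalyticAt ℂ _ _
      simpa [Function.comp_def] using this⟩
    refine ⟨germHom F g, ?_⟩
    rw [h.pull_germHom, germHom_eq_iff, h.holChart_comp_eq]
    filter_upwards [e.open_source.mem_nhds hsrc] with z hz
    have h3 : e.symm (mapChart Ψ z) = z := by
      rw [← he]; exact e.left_inv hz
    simp [g, holChart] at h3 ⊢
    rw [h3]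

theorem pullLin_bijective (m : Dual ℂ F →ₗ[ℂ] HolGerm E) (hm : ∀ y, ev E (m y) = 0)
    (hd : Function.Bijective fun y => dGerm E (m y)) : Function.Bijective (pullLin m hm) := by
  refine pull_bijective_of_bijective_dGerm _ ?_
  have : ∀ y, dGerm E (pullLin m hm (linGerm y)) = dGerm E (m y) := fun y => by
    rw [pullLin_linGerm]
  exact (funext this) ▸ hd

end Pull

/-! ### Determinantal ideals of matrices over a commutative ring. -/

section MinorIdeal

variable {R : Type*} [CommRing R] {m n : Type*}

/-- The ideal generated by the minors of size `k` of a matrix. -/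
def minorIdeal (k : ℕ) (M : Matrix m n R) : Ideal R :=
  Ideal.span {r | ∃ (f : Fin k → m) (g : Fin k → n), r = (M.submatrix f g).det}

theorem det_submatrix_mem_minorIdeal {k : ℕ} (M : Matrix m n R) (f : Fin k → m) (g : Fin k → n) :
    (M.submatrix f g).det ∈ minorIdeal k M := Ideal.subset_span ⟨f, g, rfl⟩

theorem minorIdeal_le {k : ℕ} {M : Matrix m n R} {I : Ideal R}
    (h : ∀ (f : Fin k → m) (g : Fin k → n), (M.submatrix f g).det ∈ I) : minorIdeal k M ≤ I := by
  rw [minorIdeal, Ideal.span_le]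
  rintro _ ⟨f, g, rfl⟩
  exact h f g

theorem map_minorIdeal {S : Type*} [CommRing S] (φ : R →+* S) (k : ℕ) (M : Matrix m n R) :
    (minorIdeal k M).map φ = minorIdeal k (M.map φ) := by
  rw [minorIdeal, Ideal.map_span, minorIdeal]
  congr 1
  ext r
  simp only [Set.mem_image, Set.mem_ofPred_eq]
  constructor
  · rintro ⟨_, ⟨f, g, rfl⟩, rfl⟩
    exact ⟨f, g, by rw [RingHom.map_det]; rfl⟩
  · rintro ⟨f, g, rfl⟩
    exact ⟨_, ⟨f, g, rfl⟩, by rw [RingHom.map_det]; rfl⟩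

theorem minorIdeal_submatrix_le {m' n' : Type*} (k : ℕ) (M : Matrix m n R) (e : m' → m)
    (e' : n' → n) : minorIdeal k (M.submatrix e e') ≤ minorIdeal k M :=
  minorIdeal_le fun f g => det_submatrix_mem_minorIdeal M (e ∘ f) (e' ∘ g)

theorem minorIdeal_submatrix_equiv {m' n' : Type*} (k : ℕ) (M : Matrix m n R) (e : m' ≃ m)
    (e' : n' ≃ n) : minorIdeal k (M.submatrix e e') = minorIdeal k M := by
  refine le_antisymm (minorIdeal_submatrix_le k M e e') ?_
  have h := minorIdeal_submatrix_le k (M.submatrix e e') e.symm e'.symm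
  simpa using h

/-- Expand the determinant multilinearly in its rows: each row of `C * N` is a combination of rows
of `N`. The chosen rows may repeat, which only adds zero minors and spares the grouping of
Cauchy–Binet. -/
theorem det_mul_mem {k : ℕ} [Fintype m] (C : Matrix (Fin k) m R) (N : Matrix m (Fin k) R)
    {I : Ideal R} (h : ∀ f : Fin k → m, (N.submatrix f id).det ∈ I) : (C * N).det ∈ I := by
  classical
  have h1 : (C * N) = fun i => ∑ j, C i j • N j := by
    ext i l
    simp [Matrix.mul_apply]
  have h2 : (C * N).det = Matrix.detRowAlternating.toMultilinearMap (C * N) := rfl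
  rw [h2, h1, MultilinearMap.map_sum]
  refine Ideal.sum_mem _ fun f _ => ?_
  rw [MultilinearMap.map_smul_univ]
  exact Ideal.mul_mem_left _ _ (h f)

theorem det_mul_mul_mem_minorIdeal {k : ℕ} [Fintype m] [Fintype n] (C : Matrix (Fin k) m R)
    (M : Matrix m n R) (B : Matrix n (Fin k) R) : (C * M * B).det ∈ minorIdeal k M := by
  rw [Matrix.mul_assoc]
  refine det_mul_mem _ _ fun f => ?_
  have h : ((M * B).submatrix f id).det = (B.transpose * (M.submatrix f id).transpose).det := by
    rw [← Matrix.det_transpose, ← Matrix.transpose_mul]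
    rfl
  rw [h]
  refine det_mul_mem _ _ fun g => ?_
  rw [← Matrix.det_transpose]
  exact det_submatrix_mem_minorIdeal M f g

theorem minorIdeal_mul_mul_le {m' n' : Type*} [Fintype m] [Fintype n] (k : ℕ) (P : Matrix m' m R)
    (M : Matrix m n R) (Q : Matrix n n' R) : minorIdeal k (P * M * Q) ≤ minorIdeal k M :=
  minorIdeal_le fun f g => det_mul_mul_mem_minorIdeal (P.submatrix f id) M (Q.submatrix id g)

theorem minorIdeal_mul_mul [Fintype m] [Fintype n] [DecidableEq m] [DecidableEq n] (k : ℕ)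
    {P : Matrix m m R} (M : Matrix m n R) {Q : Matrix n n R} (hP : IsUnit P) (hQ : IsUnit Q) :
    minorIdeal k (P * M * Q) = minorIdeal k M := by
  refine le_antisymm (minorIdeal_mul_mul_le k P M Q) ?_
  obtain ⟨P, rfl⟩ := hP
  obtain ⟨Q, rfl⟩ := hQ
  have h := minorIdeal_mul_mul_le k (↑P⁻¹ : Matrix m m R) ((P : Matrix m m R) * M * (Q : Matrix n n R))
    (↑Q⁻¹ : Matrix n n R)
  have h2 : (↑P⁻¹ : Matrix m m R) * ((P : Matrix m m R) * M * (Q : Matrix n n R)) *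
      (↑Q⁻¹ : Matrix n n R) = M := by
    rw [Matrix.mul_assoc (P : Matrix m m R), ← Matrix.mul_assoc (↑P⁻¹ : Matrix m m R), Units.inv_mul,
      Matrix.one_mul, Matrix.mul_assoc, Units.mul_inv, Matrix.mul_one]
  rwa [h2] at h

theorem minorIdeal_transpose (k : ℕ) (M : Matrix m n R) :
    minorIdeal k M.transpose = minorIdeal k M := by
  refine le_antisymm ?_ ?_
  · refine minorIdeal_le fun f g => ?_
    rw [← Matrix.det_transpose]
    exact det_submatrix_mem_minorIdeal M g f
  · refine minorIdeal_le fun f g => ?_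
    rw [← Matrix.det_transpose]
    exact det_submatrix_mem_minorIdeal M.transpose g f

/-- The matrix `diag(1, S)`. -/
def oneBlock (S : Matrix m n R) : Matrix (Option m) (Option n) R :=
  Matrix.of fun i j => match i, j with
    | none, none => 1
    | some i, some j => S i j
    | _, _ => 0

/-- Laplace expansion removes the extra row and column from a minor; conversely, bordering a minor
of `S` by the entry 1 does not change it. -/
theorem minorIdeal_oneBlock (k : ℕ) (S : Matrix m n R) :
    minorIdeal (k + 1) (oneBlock S) = minorIdeal k S := by
  refine le_antisymm (minorIdeal_le fun f g => ?_) (minorIdeal_le fun f g => ?_)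
  · by_cases hf : Function.Injective f
    -- An injective `f` takes the value `none` at most once. Expand along that row, or along row 0
    -- if `none` does not occur; the remaining rows come from `S`.
    · obtain ⟨r, hr⟩ : ∃ r, ∀ i, f (Fin.succAbove r i) ≠ none := by
        by_cases h : ∃ r, f r = none
        · obtain ⟨r, hr⟩ := h
          exact ⟨r, fun i hi => Fin.succAbove_ne r i (hf (hi.trans hr.symm))⟩
        · push Not at h
          exact ⟨0, fun i => h _⟩
      rw [Matrix.det_succ_row _ r]
      refine Ideal.sum_mem _ fun j _ => Ideal.mul_mem_left _ _ ?_
      choose f' hf' using fun i => Option.ne_none_iff_exists'.1 (hr i)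
      by_cases hg : ∃ i, g (j.succAbove i) = none
      · obtain ⟨i, hi⟩ := hg
        rw [Matrix.det_eq_zero_of_column_eq_zero i]
        · exact zero_mem _
        · intro l
          simp [oneBlock, hf', hi]
      · push Not at hg
        choose g' hg' using fun i => Option.ne_none_iff_exists'.1 (hg i)
        convert det_submatrix_mem_minorIdeal S f' g' using 2
        ext a b
        simp [oneBlock, hf', hg']
    · rw [Function.Injective] at hf
      push Not at hf
      obtain ⟨a, b, hab, hne⟩ := hf
      rw [Matrix.det_zero_of_row_eq hne]
      · exact zero_mem _
      · funext j
        simp [hab]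
  · have h := det_submatrix_mem_minorIdeal (oneBlock S) (Fin.cons none (some ∘ f))
      (Fin.cons none (some ∘ g))
    rw [Matrix.det_succ_row_zero, Fin.sum_univ_succ] at h
    convert h using 1
    rw [Finset.sum_eq_zero]
    · simp only [oneBlock, Fin.val_zero, pow_zero, Matrix.submatrix_apply, Fin.cons_zero,
        Matrix.of_apply, mul_one, one_mul, add_zero, Matrix.submatrix_submatrix]
      congr 1
    · intro j _
      simp [oneBlock]

theorem minorIdeal_fromBlocks_one {l : Type*} [DecidableEq l] (k a : ℕ) (S : Matrix l l R) :
    minorIdeal (k + a) (Matrix.fromBlocks S 0 0 (1 : Matrix (Fin a) (Fin a) R)) =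
      minorIdeal k S := by
  induction a with
  | zero =>
    have : Matrix.fromBlocks S 0 0 (1 : Matrix (Fin 0) (Fin 0) R) =
        S.submatrix (Equiv.sumEmpty l (Fin 0)) (Equiv.sumEmpty l (Fin 0)) := by
      ext i j
      rcases i with i | i
      · rcases j with j | j
        · rfl
        · exact j.elim0
      · exact i.elim0
    rw [this, minorIdeal_submatrix_equiv, add_zero]
  | succ a ih =>
    let e : Option (l ⊕ Fin a) ≃ l ⊕ Fin (a + 1) :=
      { toFun := fun i => match i with
          | none => Sum.inr 0
          | some (Sum.inl i) => Sum.inl i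
          | some (Sum.inr j) => Sum.inr j.succ
        invFun := fun i => match i with
          | Sum.inl i => some (Sum.inl i)
          | Sum.inr j => Fin.cases none (fun j => some (Sum.inr j)) j
        left_inv := by
          rintro (_ | (i | j)) <;> rfl
        right_inv := by
          rintro (i | j)
          · rfl
          · refine Fin.cases ?_ (fun j => ?_) j <;> rfl }
    rw [← ih, ← minorIdeal_submatrix_equiv _ _ e e, ← add_assoc, ← minorIdeal_oneBlock (k + a)]
    congr 1
    ext i j
    rcases i with _ | (i | i) <;> rcases j with _ | (j | j) <;>
      simp [oneBlock, e, Matrix.one_apply, (Fin.succ_ne_zero _).symm]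

end MinorIdeal

/-! ### Degeneracy ideals computed by a single matrix. -/

section RankMinors

variable {E : Type*} [AddCommGroup E] [Module ℂ E] [FiniteDimensional ℂ E]

theorem minor_eq_det {n : ℕ} (f : Fin n → Fin n → HolFun E)
    (h : (fun e => (Matrix.of fun r s => (f r s : E → ℂ) e).det) ∈ HolFun E) :
    germHom E ⟨_, h⟩ = (Matrix.of fun r s => germHom E (f r s)).det := by
  have h1 : (⟨_, h⟩ : HolFun E) = (Matrix.of f).det := by
    apply Subtype.ext
    funext e
    have h2 := RingHom.map_det ((Pi.evalRingHom (fun _ : E => ℂ) e).comp (HolFun E).val.toRingHom)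
      (Matrix.of f)
    exact h2.symm
  have h3 := RingHom.map_det (germHom E).toRingHom (Matrix.of f)
  rw [h1]
  exact h3

/-- The ideal of a degeneracy locus is generated by the minors of the matrix of the family with
respect to generators of the source and of the dual of the target. -/
theorem rankLE_eq_minorIdeal {X Y : Type*} [AddCommGroup X] [Module ℂ X] [AddCommGroup Y]
    [Module ℂ Y] {m n : Type*} [Fintype m] [Fintype n] (i : ℕ) (Φ : E → (X →ₗ[ℂ] Y))
    (hΦ : ∀ (x : X) (y : Dual ℂ Y), (fun e => y (Φ e x)) ∈ HolFun E)
    (x : m → X) (hx : Submodule.span ℂ (Set.range x) = ⊤)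
    (y : n → Dual ℂ Y) (hy : Submodule.span ℂ (Set.range y) = ⊤) :
    rankLE i Φ = minorIdeal (i + 1)
      (Matrix.of fun r s => germHom E ⟨_, hΦ (x s) (y r)⟩ : Matrix n m (HolGerm E)) := by
  let θ : X → Dual ℂ Y → HolGerm E := fun x y => germHom E ⟨_, hΦ x y⟩
  -- By bilinearity, the matrix of an arbitrary minor is `C * M * B` with constant matrices `C` and
  -- `B`.
  have hθ : ∀ (x' : X) (y' : Dual ℂ Y) (B : m → ℂ) (C : n → ℂ), ∑ s, B s • x s = x' →
      ∑ r, C r • y r = y' → θ x' y' = ∑ r, ∑ s, algebraMap ℂ _ (C r) * θ (x s) (y r) *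
        algebraMap ℂ _ (B s) := by
    rintro x' y' B C rfl rfl
    simp only [θ, ← AlgHom.commutes (germHom E), ← map_mul (germHom E), ← map_sum (germHom E)]
    congr 1
    apply Subtype.ext
    funext e
    simp only [LinearMap.sum_apply, LinearMap.smul_apply, map_sum, map_smul, smul_eq_mul,
      AddSubmonoidClass.coe_finsetSum, Finset.sum_apply, MulMemClass.coe_mul, Pi.mul_apply,
      Finset.mul_sum]
    rw [Finset.sum_comm]
    refine Finset.sum_congr rfl fun r _ => Finset.sum_congr rfl fun s _ => ?_
    change B s * (C r * _) = C r * _ * B s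
    ring
  apply le_antisymm
  · rw [rankLE, Ideal.span_le]
    rintro _ ⟨x', y', h, rfl⟩
    have hx' : ∀ s, ∃ B : m → ℂ, ∑ j, B j • x j = x' s := fun s => by
      rw [← Submodule.mem_span_range_iff_exists_fun, hx]; trivial
    have hy' : ∀ r, ∃ C : n → ℂ, ∑ j, C j • y j = y' r := fun r => by
      rw [← Submodule.mem_span_range_iff_exists_fun, hy]; trivial
    choose B hB using hx'
    choose C hC using hy'
    have h1 := minor_eq_det (fun r s => ⟨_, hΦ (x' s) (y' r)⟩) h
    have h2 : HolFun.germ ⟨_, h⟩ = (Matrix.of fun r s => θ (x' s) (y' r)).det := h1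
    rw [SetLike.mem_coe, h2]
    convert det_mul_mul_mem_minorIdeal
      (Matrix.of fun r j => algebraMap ℂ (HolGerm E) (C r j))
      (Matrix.of fun r s => germHom E ⟨_, hΦ (x s) (y r)⟩ : Matrix n m (HolGerm E))
      (Matrix.of fun j s => algebraMap ℂ (HolGerm E) (B s j)) using 2
    ext r s
    rw [Matrix.of_apply, hθ _ _ _ _ (hB s) (hC r), Matrix.mul_apply, Finset.sum_comm]
    simp only [Matrix.mul_apply, Finset.sum_mul]
    rfl
  · refine minorIdeal_le fun f g => Ideal.subset_span ⟨fun s => x (g s), fun r => y (f r),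
      minor_mem_HolFun hΦ _ _, ?_⟩
    exact (minor_eq_det (fun r s => ⟨_, hΦ (x (g s)) (y (f r))⟩) _).symm

end RankMinors

/-! ### Symmetric forms in coordinates and substitution into the generic symmetric matrix. -/

section SymPull

variable {K : Type*} [AddCommGroup K] [Module ℂ K]

/-- The symmetrized product of two linear forms. -/
def symOf (α β : Dual ℂ K) : SymForms K :=
  ⟨(2⁻¹ : ℂ) • (α.smulRight β + β.smulRight α), fun x y => by
    simp only [LinearMap.smul_apply, LinearMap.add_apply, LinearMap.smulRight_apply, smul_eq_mul]
    ring⟩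

theorem symOf_hom (α β : Dual ℂ K) (x y : K) :
    (symOf α β).hom x y = 2⁻¹ * (α x * β y + β x * α y) := by
  change ((2⁻¹ : ℂ) • (α.smulRight β + β.smulRight α)) x y = _
  simp [mul_add]

theorem SymForms.ext {s t : SymForms K} (h : ∀ x y, s.hom x y = t.hom x y) : s = t :=
  Subtype.ext (LinearMap.ext₂ h)

theorem SymForms.symm (s : SymForms K) (x y : K) : s.hom x y = s.hom y x := s.2 x y

/-- The value of symmetric forms at two given vectors. -/
def symEntry (x y : K) : Dual ℂ (SymForms K) where
  toFun s := s.hom x y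
  map_add' _ _ := rfl
  map_smul' _ _ := rfl

@[simp]
theorem symEntry_apply (x y : K) (s : SymForms K) : symEntry x y s = s.hom x y := rfl

variable {ι : Type*} [Fintype ι] [DecidableEq ι] (b : Basis ι ℂ K)

theorem SymForms.ext_basis {s t : SymForms K} (h : ∀ i j, s.hom (b i) (b j) = t.hom (b i) (b j)) :
    s = t :=
  Subtype.ext (LinearMap.ext_basis b b h)

theorem SymForms.eq_sum (s : SymForms K) :
    s = ∑ i, ∑ j, s.hom (b i) (b j) • symOf (b.coord i) (b.coord j) := by
  refine SymForms.ext_basis b fun k l => ?_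
  rw [← symEntry_apply, ← symEntry_apply, map_sum]
  simp only [map_sum, map_smul, symEntry_apply, symOf_hom, Basis.coord_apply, Basis.repr_self,
    Finsupp.single_apply, smul_eq_mul]
  have h : ∀ i j : ι, s.hom (b i) (b j) * (2⁻¹ * ((if k = i then 1 else 0) *
      (if l = j then 1 else 0) + (if k = j then 1 else 0) * (if l = i then 1 else 0))) =
      (if k = i then (if l = j then 2⁻¹ * s.hom (b i) (b j) else 0) else 0) +
      (if l = i then (if k = j then 2⁻¹ * s.hom (b i) (b j) else 0) else 0) := fun i j => by
    split_ifs <;> ring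
  simp only [h, Finset.sum_add_distrib, Finset.sum_ite_eq, Finset.mem_univ, if_true,
    Finset.sum_const_zero, Finset.sum_ite_irrel]
  rw [s.symm (b l) (b k)]
  ring

theorem dual_symForms_eq_sum (y : Dual ℂ (SymForms K)) :
    y = ∑ i, ∑ j, y (symOf (b.coord i) (b.coord j)) • symEntry (b i) (b j) := by
  ext s
  conv_lhs => rw [s.eq_sum b]
  simp only [map_sum, map_smul, LinearMap.sum_apply, LinearMap.smul_apply, symEntry_apply,
    smul_eq_mul, mul_comm]

variable {A : Type*} [AddCommGroup A] [Module ℂ A]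

/-- The linear map on the dual of the space of symmetric forms with prescribed values at the
entries. -/
def symLin (Q : Matrix ι ι A) : Dual ℂ (SymForms K) →ₗ[ℂ] A where
  toFun y := ∑ i, ∑ j, y (symOf (b.coord i) (b.coord j)) • Q i j
  map_add' y z := by
    simp only [LinearMap.add_apply, add_smul, Finset.sum_add_distrib]
  map_smul' c y := by
    simp only [LinearMap.smul_apply, Finset.smul_sum, smul_smul, smul_eq_mul, RingHom.id_apply]

theorem symLin_apply (Q : Matrix ι ι A) (y : Dual ℂ (SymForms K)) :
    symLin b Q y = ∑ i, ∑ j, y (symOf (b.coord i) (b.coord j)) • Q i j := rfl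

theorem map_symLin {B : Type*} [AddCommGroup B] [Module ℂ B] (f : A →ₗ[ℂ] B) (Q : Matrix ι ι A)
    (y : Dual ℂ (SymForms K)) : f (symLin b Q y) = symLin b (Q.map f) y := by
  simp [symLin_apply]

/-- The double sum gives the average of `Q k l` and `Q l k`, because of the factor 1/2 in `symOf`;
this is where symmetry of `Q` is needed. -/
theorem symLin_symEntry {Q : Matrix ι ι A} (hQ : Q.transpose = Q) (k l : ι) :
    symLin b Q (symEntry (b k) (b l)) = Q k l := by
  simp only [symLin_apply, symEntry_apply, symOf_hom, Basis.coord_apply, Basis.repr_self,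
    Finsupp.single_apply]
  have h : ∀ i j : ι, (2⁻¹ * ((if k = i then (1 : ℂ) else 0) *
      (if l = j then 1 else 0) + (if k = j then 1 else 0) * (if l = i then 1 else 0))) • Q i j =
      (if k = i then (if l = j then (2⁻¹ : ℂ) • Q i j else 0) else 0) +
      (if l = i then (if k = j then (2⁻¹ : ℂ) • Q i j else 0) else 0) := fun i j => by
    split_ifs <;> (simp [← add_smul]; try norm_num)
  simp only [h, Finset.sum_add_distrib, Finset.sum_ite_eq, Finset.mem_univ, if_true,
    Finset.sum_const_zero, Finset.sum_ite_irrel]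
  rw [show Q l k = Q k l from congrFun (congrFun hQ k) l, ← add_smul]
  norm_num

/-- The generic symmetric matrix. -/
def genericSym [FiniteDimensional ℂ K] : Matrix ι ι (HolGerm (SymForms K)) :=
  Matrix.of fun i j => linGerm (symEntry (b i) (b j))

variable [FiniteDimensional ℂ K]

theorem genericSym_transpose : (genericSym b).transpose = genericSym b := by
  ext i j
  simp only [genericSym, Matrix.transpose_apply, Matrix.of_apply]
  congr 1
  ext s
  exact s.symm _ _

theorem symRankLE_eq_minorIdeal (i : ℕ) : symRankLE K i = minorIdeal (i + 1) (genericSym b) := by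
  have h := rankLE_eq_minorIdeal i (fun s : SymForms K => s.hom)
    (fun x y => linear_mem_HolFun ({ toFun := fun s => y (s.hom x)
                                     map_add' := fun s t => map_add y _ _
                                     map_smul' := fun c s => map_smul y _ _ } : Dual ℂ (SymForms K)))
    b b.span_eq (fun j => Dual.eval ℂ K (b j)) (by
      have h2 : (fun j => Dual.eval ℂ K (b j)) = b.map (evalEquiv ℂ K) := by
        funext j; simp
      rw [h2]; exact Basis.span_eq _)
  rw [symRankLE, h, ← minorIdeal_transpose]
  rfl

variable {E : Type*} [AddCommGroup E] [Module ℂ E] [FiniteDimensional ℂ E]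

theorem ev_symLin {Q : Matrix ι ι (HolGerm E)} (h : ∀ i j, ev E (Q i j) = 0)
    (y : Dual ℂ (SymForms K)) : ev E (symLin b Q y) = 0 := by
  simp [symLin_apply, h]

theorem map_genericSym {α : HolGerm (SymForms K) →ₐ[ℂ] HolGerm E} {Q : Matrix ι ι (HolGerm E)}
    (hQ : Q.transpose = Q) (hα : ∀ y, α (linGerm y) = symLin b Q y) :
    (genericSym b).map α = Q := by
  ext i j
  simp [genericSym, hα, symLin_symEntry b hQ]

end SymPull

/-! ### Congruence of symmetric matrices of germs, and straightening onto a hyperplane. -/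

section SquareRoot

variable {E : Type*} [AddCommGroup E] [Module ℂ E] [FiniteDimensional ℂ E]

/-- A symmetric matrix of germs that is close to an invertible constant matrix is congruent to
it. -/
theorem exists_congruence {n : ℕ} {P : Matrix (Fin n) (Fin n) ℂ} (hP : IsUnit P)
    (hPt : P.transpose = P) {N : Matrix (Fin n) (Fin n) (HolGerm E)} (hN : N.transpose = N)
    (hN0 : ∀ i j, ev E (N i j) = 0) :
    ∃ g : Matrix (Fin n) (Fin n) (HolGerm E), g.map (ev E) = 1 ∧
      g * P.map (algebraMap ℂ _) * g.transpose = P.map (algebraMap ℂ _) - N := by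
  have hPd : IsUnit P.det := (Matrix.isUnit_iff_isUnit_det P).1 hP
  have hPit : P⁻¹.transpose = P⁻¹ := by rw [Matrix.transpose_nonsing_inv, hPt]
  let K := Fin n → ℂ
  let b : Basis (Fin n) ℂ K := Pi.basisFun ℂ (Fin n)
  let X : Matrix (Fin n) (Fin n) (HolGerm (SymForms K)) := genericSym b
  have hX : X.transpose = X := genericSym_transpose b
  let Pi : Matrix (Fin n) (Fin n) (HolGerm (SymForms K)) := P⁻¹.map (algebraMap ℂ _)
  -- For symmetric h and g = 1 + hP⁻¹ one has gPgᵗ = P + 2h + hP⁻¹h, so the equation is 2h + hP⁻¹h =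
  -- −N. The map X ↦ 2X + XP⁻¹X on symmetric matrices has derivative 2 at 0, hence is locally
  -- invertible.
  let Y := X + X + X * Pi * X
  have hY : Y.transpose = Y := by
    have : Pi.transpose = Pi := by
      simp only [Pi, ← Matrix.transpose_map, hPit]
    simp only [Y, Matrix.transpose_add, Matrix.transpose_mul, hX, this, Matrix.mul_assoc]
  have hX0 : ∀ i j, ev _ (X i j) = 0 := fun i j => ev_linGerm _
  have hY0 : ∀ i j, ev _ (Y i j) = 0 := fun i j => by
    simp [Y, Matrix.mul_apply, hX0]
  have hdY : Y.map (dGerm (SymForms K)) = (2 : ℂ) • X.map (dGerm (SymForms K)) := by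
    ext1 i j
    simp only [Y, Matrix.map_apply, Matrix.add_apply, map_add, Matrix.mul_apply, map_sum,
      dGerm_mul, hX0, zero_smul, map_mul, zero_mul, Finset.sum_const_zero, add_zero,
      Matrix.smul_apply, two_smul]
  have hbij : Function.Bijective fun y => dGerm (SymForms K) (symLin b Y y) := by
    have h1 : ∀ y, dGerm (SymForms K) (symLin b Y y) = (2 : ℂ) • y := fun y => by
      rw [map_symLin, hdY, symLin_apply]
      conv_rhs => rw [dual_symForms_eq_sum b y]
      simp [X, genericSym, Finset.smul_sum, smul_comm (2 : ℂ)]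
    simp only [h1]
    exact (LinearEquiv.smulOfNeZero ℂ (Dual ℂ (SymForms K)) (2 : ℂ) two_ne_zero).bijective
  let G := AlgEquiv.ofBijective _ (pullLin_bijective (symLin b Y) (ev_symLin b hY0) hbij)
  let νN := pullLin (symLin b (-N)) (ev_symLin (E := E) b (fun i j => by simp [hN0]))
  -- `G` sends the generic matrix X to Y and `νN` sends X to −N, so `τ` sends Y to −N. The image h
  -- of X under `τ` then solves the equation.
  let τ : HolGerm (SymForms K) →ₐ[ℂ] HolGerm E := νN.comp G.symm.toAlgHom
  let h := X.map τ
  have hh : h + h + h * P⁻¹.map (algebraMap ℂ _) * h = -N := by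
    have h1 : Y.map τ = -N := by
      have h2 : X.map G = Y := map_genericSym b hY fun y => pullLin_linGerm _ _ y
      have h3 : X.map νN = -N := map_genericSym b (by simp [hN]) fun y => pullLin_linGerm _ _ y
      rw [← h2, ← h3]
      ext i j
      simp [τ]
    rw [← h1]
    ext i j
    simp [h, Y, Matrix.mul_apply, Pi]
  have hht : h.transpose = h := by
    simp only [h, ← Matrix.transpose_map, hX]
  have hPP : P.map (algebraMap ℂ (HolGerm E)) * P⁻¹.map (algebraMap ℂ _) = 1 := by
    rw [← Matrix.map_mul, Matrix.mul_nonsing_inv _ hPd]; simp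
  have hPP' : P⁻¹.map (algebraMap ℂ (HolGerm E)) * P.map (algebraMap ℂ _) = 1 := by
    rw [← Matrix.map_mul, Matrix.nonsing_inv_mul _ hPd]; simp
  refine ⟨1 + h * P⁻¹.map (algebraMap ℂ _), ?_, ?_⟩
  · ext i j
    have h0 : ∀ i j, ev E (h i j) = 0 := fun i j => by
      simp only [h, Matrix.map_apply, ev_algHom, hX0]
    simp [Matrix.mul_apply, h0, Matrix.one_apply, apply_ite (ev E)]
  · rw [Matrix.transpose_add, Matrix.transpose_mul, hht, Matrix.transpose_one,
      ← Matrix.transpose_map, hPit, sub_eq_add_neg, ← hh]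
    rw [Matrix.add_mul, Matrix.mul_assoc h, hPP', Matrix.mul_one, Matrix.one_mul, Matrix.add_mul,
      Matrix.mul_add, Matrix.mul_add, ← Matrix.mul_assoc, hPP, Matrix.one_mul, Matrix.mul_one,
      Matrix.mul_one, ← Matrix.mul_assoc]
    abel

/-- If the derivatives of the germs `q κ`, all zero at the origin, generate the cotangent space,
then germs that vanish to order two are combinations of the `q κ` with coefficients that vanish at
the origin. -/
theorem exists_eq_sum_mul {κ : Type*} [Fintype κ] (q : κ → HolGerm E) (hq : ∀ k, ev E (q k) = 0)
    (hspan : Submodule.span ℂ (Set.range fun k => dGerm E (q k)) = ⊤) (f : HolGerm E)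
    (hf : ev E f = 0) (hdf : dGerm E f = 0) :
    ∃ c : κ → HolGerm E, (∀ k, ev E (c k) = 0) ∧ f = ∑ k, c k * q k := by
  let x := fun i => linGerm ((finBasis ℂ E).coord i)
  have ht : ∀ a, ∃ t : κ → ℂ, ∑ k, t k • dGerm E (q k) = (finBasis ℂ E).coord a := fun a => by
    rw [← Submodule.mem_span_range_iff_exists_fun, hspan]; trivial
  choose t ht using ht
  -- Combinations of the `q k` with the same derivatives as the coordinates x. Hence y = Cx with
  -- C(0) = 1, and inverting C writes the coordinates in terms of the `q k`.
  let y : Fin (finrank ℂ E) → HolGerm E := fun a => ∑ k, t a k • q k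
  have hy : ∀ a, ev E (y a) = 0 := fun a => by simp [y, hq]
  choose C hC using fun a => exists_eq_sum_linGerm (y a) (hy a)
  have hd : ∀ c : Fin (finrank ℂ E) → HolGerm E,
      dGerm E (∑ i, x i * c i) = ∑ i, ev E (c i) • (finBasis ℂ E).coord i := fun c => by
    simp [x, dGerm_mul]
  have hcoef : ∀ c d : Fin (finrank ℂ E) → ℂ, ∑ i, c i • (finBasis ℂ E).coord i =
      ∑ i, d i • (finBasis ℂ E).coord i → c = d := fun c d h => by
    funext j
    have := LinearMap.congr_fun h (finBasis ℂ E j)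
    simpa [Finsupp.single_apply] using this
  let Cm : Matrix (Fin (finrank ℂ E)) (Fin (finrank ℂ E)) (HolGerm E) := Matrix.of C
  have hC1 : Cm.map (ev E) = 1 := by
    ext a i
    have h1 : dGerm E (y a) = (finBasis ℂ E).coord a := by
      rw [← ht a]; simp [y]
    rw [hC a, hd] at h1
    have h2 := hcoef (fun i => ev E (C a i)) (fun i => if a = i then 1 else 0) (by
      rw [h1]; simp)
    exact congrFun h2 i
  have hCu : IsUnit Cm.det := by
    apply isUnit_of_ev_ne_zero
    have h1 := RingHom.map_det (ev E).toRingHom Cm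
    have h2 : (ev E).toRingHom.mapMatrix Cm = 1 := hC1
    rw [h2, Matrix.det_one] at h1
    exact fun h3 => one_ne_zero (h1.symm.trans h3)
  have hyx : y = Cm.mulVec x := by
    funext a
    rw [hC a]
    simp [Matrix.mulVec, dotProduct, Cm, x, mul_comm]
  have hxy : x = Cm⁻¹.mulVec y := by
    rw [hyx, Matrix.mulVec_mulVec, Matrix.nonsing_inv_mul _ hCu, Matrix.one_mulVec]
  obtain ⟨c, hc⟩ := exists_eq_sum_linGerm f hf
  -- Since the derivative of `f` is zero, its coefficients on the coordinates vanish at 0;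
  -- substituting x = C⁻¹y keeps this property.
  have hc0 : ∀ i, ev E (c i) = 0 := by
    have h1 := hdf
    rw [hc, hd] at h1
    exact congrFun (hcoef (fun i => ev E (c i)) 0 (by rw [h1]; simp))
  refine ⟨fun k => ∑ i, c i * ∑ a, Cm⁻¹ i a * algebraMap ℂ _ (t a k), fun k => ?_, ?_⟩
  · simp [hc0]
  · have h1 : f = ∑ i, x i * c i := hc
    rw [h1, hxy]
    simp only [Matrix.mulVec, dotProduct, y, Finset.sum_mul, Finset.mul_sum, Algebra.smul_def]
    rw [Finset.sum_comm' (t' := Finset.univ) (s' := fun _ => Finset.univ) (by simp)]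
    conv_rhs => rw [Finset.sum_comm]
    rw [Finset.sum_comm]
    refine Finset.sum_congr rfl fun i _ => ?_
    rw [Finset.sum_comm]
    refine Finset.sum_congr rfl fun k _ => Finset.sum_congr rfl fun a _ => ?_
    ring

/-- A family of symmetric forms tangent to the hyperplane defined by a nondegenerate tensor can be
moved into this hyperplane by a change of basis. -/
theorem exists_congruence_trace_eq_zero {n : ℕ} {P : Matrix (Fin n) (Fin n) ℂ} (hP : IsUnit P)
    (hPt : P.transpose = P) {Q : Matrix (Fin n) (Fin n) (HolGerm E)} (hQ : Q.transpose = Q)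
    (hQ0 : ∀ i j, ev E (Q i j) = 0)
    (hspan : Submodule.span ℂ (Set.range fun k : Fin n × Fin n => dGerm E (Q k.1 k.2)) = ⊤)
    (hd : ∑ i, ∑ j, P i j • dGerm E (Q i j) = 0) :
    ∃ g : Matrix (Fin n) (Fin n) (HolGerm E), g.map (ev E) = 1 ∧
      (P.map (algebraMap ℂ _) * (g.transpose * Q * g)).trace = 0 := by
  have htr : ∀ A : Matrix (Fin n) (Fin n) (HolGerm E),
      (A * Q).trace = ∑ k : Fin n × Fin n, A k.1 k.2 * Q k.1 k.2 := fun A => by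
    rw [Fintype.sum_prod_type]
    simp only [Matrix.trace, Matrix.diag, Matrix.mul_apply]
    refine Finset.sum_congr rfl fun i _ => Finset.sum_congr rfl fun j _ => ?_
    rw [show Q j i = Q i j from congrFun (congrFun hQ i) j]
  -- trace(PQ) vanishes to order two by `hd`, so it is a combination of the entries of Q with
  -- coefficients vanishing at 0. Symmetrizing the coefficients does not change trace(NQ), as Q is
  -- symmetric.
  obtain ⟨c, hc0, hc⟩ := exists_eq_sum_mul (fun k : Fin n × Fin n => Q k.1 k.2)
    (fun k => hQ0 _ _) hspan ((P.map (algebraMap ℂ _) * Q).trace)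
    (by rw [htr]; simp [hQ0])
    (by
      rw [htr, Fintype.sum_prod_type, ← hd]
      simp [dGerm_mul, hQ0])
  let N₀ : Matrix (Fin n) (Fin n) (HolGerm E) := Matrix.of fun i j => c (i, j)
  let N := (2⁻¹ : ℂ) • (N₀ + N₀.transpose)
  have hN : N.transpose = N := by
    simp only [N, Matrix.transpose_smul, Matrix.transpose_add, Matrix.transpose_transpose, add_comm]
  have hNQ : (N * Q).trace = (P.map (algebraMap ℂ _) * Q).trace := by
    have h1 : (N₀.transpose * Q).trace = (N₀ * Q).trace := by
      rw [← Matrix.trace_transpose, Matrix.transpose_mul, hQ, Matrix.transpose_transpose,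
        Matrix.trace_mul_comm]
    have h2 : (N₀ * Q).trace = (P.map (algebraMap ℂ _) * Q).trace := by
      rw [htr N₀, hc]; rfl
    simp only [N, Matrix.smul_mul, Matrix.add_mul, Matrix.trace_smul, Matrix.trace_add, h1, h2,
      ← two_smul ℂ, smul_smul]
    norm_num
  obtain ⟨g, hg1, hg⟩ := exists_congruence hP hPt hN (fun i j => by simp [N, N₀, hc0])
  refine ⟨g, hg1, ?_⟩
  -- Cyclicity of the trace moves the change of frame from Q to P, where it was chosen to produce P
  -- − N.
  have h3 : (P.map (algebraMap ℂ (HolGerm E)) * (g.transpose * Q * g)).trace =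
      (g * P.map (algebraMap ℂ _) * g.transpose * Q).trace := by
    rw [← Matrix.mul_assoc, Matrix.trace_mul_comm]
    simp only [Matrix.mul_assoc]
  rw [h3, hg, Matrix.sub_mul, Matrix.trace_sub, hNQ, sub_self]

end SquareRoot

/-! ### Calculus in ⋀³V: multilinearity, derivations, Taylor expansion of ⋀³(1 − tN). -/

section Wedge3Calculus

variable {V : Type*} [AddCommGroup V] [Module ℂ V]

/-- `a ∧ b ∧ c`. -/
def w3 (a b c : V) : W3 V := wedge3 ![a, b, c]

theorem wedge3_eq_w3 (v : Fin 3 → V) : wedge3 v = w3 (v 0) (v 1) (v 2) := by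
  rw [w3]; congr 1; funext i; fin_cases i <;> rfl

theorem update_vec3 (a b c x : V) : Function.update ![a, b, c] 0 x = ![x, b, c] ∧
    Function.update ![a, b, c] 1 x = ![a, x, c] ∧ Function.update ![a, b, c] 2 x = ![a, b, x] := by
  refine ⟨?_, ?_, ?_⟩ <;> (funext i; fin_cases i <;> rfl)

theorem w3_add₁ (a a' b c : V) : w3 (a + a') b c = w3 a b c + w3 a' b c := by
  have h := (exteriorPower.ιMulti ℂ 3 (M := V)).map_update_add ![a, b, c] 0 a a'
  simp only [update_vec3] at h
  exact h

theorem w3_add₂ (a b b' c : V) : w3 a (b + b') c = w3 a b c + w3 a b' c := by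
  have h := (exteriorPower.ιMulti ℂ 3 (M := V)).map_update_add ![a, b, c] 1 b b'
  simp only [update_vec3] at h
  exact h

theorem w3_add₃ (a b c c' : V) : w3 a b (c + c') = w3 a b c + w3 a b c' := by
  have h := (exteriorPower.ιMulti ℂ 3 (M := V)).map_update_add ![a, b, c] 2 c c'
  simp only [update_vec3] at h
  exact h

theorem w3_smul₁ (r : ℂ) (a b c : V) : w3 (r • a) b c = r • w3 a b c := by
  have h := (exteriorPower.ιMulti ℂ 3 (M := V)).map_update_smul ![a, b, c] 0 r a
  simp only [update_vec3] at h
  exact h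

theorem w3_smul₂ (r : ℂ) (a b c : V) : w3 a (r • b) c = r • w3 a b c := by
  have h := (exteriorPower.ιMulti ℂ 3 (M := V)).map_update_smul ![a, b, c] 1 r b
  simp only [update_vec3] at h
  exact h

theorem w3_smul₃ (r : ℂ) (a b c : V) : w3 a b (r • c) = r • w3 a b c := by
  have h := (exteriorPower.ιMulti ℂ 3 (M := V)).map_update_smul ![a, b, c] 2 r c
  simp only [update_vec3] at h
  exact h

theorem w3_self₁₂ (a c : V) : w3 a a c = 0 :=
  (exteriorPower.ιMulti ℂ 3 (M := V)).map_eq_zero_of_eq ![a, a, c] (i := 0) (j := 1) rfl (by decide)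

theorem w3_self₂₃ (a c : V) : w3 a c c = 0 :=
  (exteriorPower.ιMulti ℂ 3 (M := V)).map_eq_zero_of_eq ![a, c, c] (i := 1) (j := 2) rfl (by decide)

theorem w3_self₁₃ (a c : V) : w3 a c a = 0 :=
  (exteriorPower.ιMulti ℂ 3 (M := V)).map_eq_zero_of_eq ![a, c, a] (i := 0) (j := 2) rfl (by decide)

theorem w3_swap₁₂ (a b c : V) : w3 a b c = -w3 b a c := by
  have h := w3_self₁₂ (a + b) c
  rw [w3_add₁, w3_add₂, w3_add₂, w3_self₁₂, w3_self₁₂, zero_add, add_zero] at h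
  exact eq_neg_of_add_eq_zero_left h

theorem w3_swap₂₃ (a b c : V) : w3 a b c = -w3 a c b := by
  have h := w3_self₂₃ a (b + c)
  rw [w3_add₂, w3_add₃, w3_add₃, w3_self₂₃, w3_self₂₃, zero_add, add_zero] at h
  exact eq_neg_of_add_eq_zero_left h

theorem w3_rotate (a b c : V) : w3 a b c = w3 b c a := by
  rw [w3_swap₁₂, w3_swap₂₃, neg_neg]

theorem W3.hom_ext {M : Type*} [AddCommGroup M] [Module ℂ M] {f g : W3 V →ₗ[ℂ] M}
    (h : ∀ a b c, f (w3 a b c) = g (w3 a b c)) : f = g := by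
  refine LinearMap.ext_on span_wedge3 ?_
  rintro _ ⟨v, rfl⟩
  rw [wedge3_eq_w3, h]

theorem map3_w3 (g : V →ₗ[ℂ] V) (a b c : V) : map3 g (w3 a b c) = w3 (g a) (g b) (g c) := by
  rw [w3, map3_wedge3, wedge3_eq_w3]; rfl

theorem w3_zero₃ (b c : V) : w3 b c 0 = 0 := by simpa using w3_smul₃ 0 b c 0

/-- The derivation of `⋀³ V` that extends `N`. -/
def der (N : V →ₗ[ℂ] V) : W3 V →ₗ[ℂ] W3 V :=
  (2⁻¹ : ℂ) • (map3 (LinearMap.id + N) - map3 (LinearMap.id - N)) - map3 N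

theorem w3_neg₁ (a b c : V) : w3 (-a) b c = -w3 a b c := by simpa using w3_smul₁ (-1) a b c
theorem w3_neg₂ (a b c : V) : w3 a (-b) c = -w3 a b c := by simpa using w3_smul₂ (-1) a b c
theorem w3_neg₃ (a b c : V) : w3 a b (-c) = -w3 a b c := by simpa using w3_smul₃ (-1) a b c

/-- The odd part in t of ⋀³(1 + tN), taken at t = 1, is the Leibniz term plus ⋀³N; the definition of
`der` subtracts the latter. -/
theorem der_w3 (N : V →ₗ[ℂ] V) (a b c : V) :
    der N (w3 a b c) = w3 (N a) b c + w3 a (N b) c + w3 a b (N c) := by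
  simp only [der, LinearMap.smul_apply, map3_w3, LinearMap.add_apply,
    LinearMap.id_apply, LinearMap.neg_apply, sub_eq_add_neg, w3_add₁, w3_add₂, w3_add₃, w3_neg₁, w3_neg₂, w3_neg₃]
  module

/-- The second order term of `map3 (1 + N)`. -/
def der₂ (N : V →ₗ[ℂ] V) : W3 V →ₗ[ℂ] W3 V :=
  (2⁻¹ : ℂ) • (map3 (LinearMap.id + N) + map3 (LinearMap.id - N)) - LinearMap.id

theorem map3_id_sub_smul (N : V →ₗ[ℂ] V) (t : ℂ) :
    map3 (LinearMap.id - t • N) = LinearMap.id - t • der N + t ^ 2 • der₂ N - t ^ 3 • map3 N := by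
  refine W3.hom_ext fun a b c => ?_
  simp only [der, der₂, LinearMap.smul_apply, map3_w3, LinearMap.add_apply,
    LinearMap.id_apply, LinearMap.neg_apply, sub_eq_add_neg, w3_add₁, w3_add₂, w3_add₃, w3_neg₁, w3_neg₂, w3_neg₃,
    w3_smul₁, w3_smul₂, w3_smul₃]
  module

theorem der_add (N N' : V →ₗ[ℂ] V) : der (N + N') = der N + der N' := by
  refine W3.hom_ext fun a b c => ?_
  simp only [LinearMap.add_apply, der_w3, w3_add₁, w3_add₂, w3_add₃]
  abel

theorem der_smul (r : ℂ) (N : V →ₗ[ℂ] V) : der (r • N) = r • der N := by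
  refine W3.hom_ext fun a b c => ?_
  simp only [LinearMap.smul_apply, der_w3, w3_smul₁, w3_smul₂, w3_smul₃, smul_add]

end Wedge3Calculus

/-! ### The scalar symplectic form on ⋀³V attached to a splitting of V. -/

section Omega

variable {V : Type*} [AddCommGroup V] [Module ℂ V] {U₀ Uinf : Submodule ℂ V}
  (hU : IsCompl U₀ Uinf) (u : Basis (Fin 3) ℂ U₀) (w : Basis (Fin 3) ℂ Uinf)

/-- The basis of `V` made of bases of two complementary subspaces. -/
def sumBasis : Basis (Fin 3 ⊕ Fin 3) ℂ V :=
  (u.prod w).map (Submodule.prodEquivOfIsCompl U₀ Uinf hU)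

/-- The determinant in the basis `sumBasis`. -/
def vol6 : V [⋀^Fin (3 + 3)]→ₗ[ℂ] ℂ := ((sumBasis hU u w).reindex finSumFinEquiv).det

/-- The linear form on the exterior algebra that extends the determinant on `⋀⁶ V`. -/
def vol : ExteriorAlgebra ℂ V →ₗ[ℂ] ℂ :=
  ExteriorAlgebra.liftAlternating fun i => if h : i = 3 + 3 then h ▸ vol6 hU u w else 0

theorem vol_ιMulti (v : Fin (3 + 3) → V) :
    vol hU u w (ExteriorAlgebra.ιMulti ℂ (3 + 3) v) = vol6 hU u w v := by
  rw [vol, ExteriorAlgebra.liftAlternating_apply_ιMulti, dif_pos rfl]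

/-- The symplectic form on `⋀³ V`. -/
def omega : W3 V →ₗ[ℂ] W3 V →ₗ[ℂ] ℂ :=
  LinearMap.mk₂ ℂ (fun x y => vol hU u w (wedgeMul x y))
    (fun x y z => by rw [add_wedgeMul, map_add])
    (fun c x y => by rw [smul_wedgeMul, map_smul])
    (fun x y z => by rw [wedgeMul_add, map_add])
    (fun c x y => by rw [wedgeMul_smul, map_smul])

theorem omega_apply (x y : W3 V) : omega hU u w x y = vol hU u w (wedgeMul x y) := rfl

theorem wedgeMul_wedge3 (v v' : Fin 3 → V) : wedgeMul (wedge3 v) (wedge3 v') =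
    ExteriorAlgebra.ιMulti ℂ (3 + 3) (Fin.append v v') :=
  ExteriorAlgebra.ιMulti_mul_ιMulti v v'

theorem omega_wedge3 (v v' : Fin 3 → V) :
    omega hU u w (wedge3 v) (wedge3 v') = vol6 hU u w (Fin.append v v') := by
  rw [omega_apply, wedgeMul_wedge3, vol_ιMulti]

/-- ⋀⁶V is a line on which `vol` does not vanish. This allows the ⋀⁶V-valued pairing to be replaced
by the scalar form `omega`. -/
theorem wedgeMul_eq_zero_iff [FiniteDimensional ℂ V] (x y : W3 V) :
    wedgeMul x y = 0 ↔ omega hU u w x y = 0 := by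
  rw [omega_apply]
  refine ⟨fun h => by rw [h, map_zero], fun h => ?_⟩
  have hfin : finrank ℂ V = 6 := by
    rw [finrank_eq_card_basis (sumBasis hU u w)]; rfl
  have hone : finrank ℂ (⋀[ℂ]^(3 + 3) V) = 1 := by
    rw [exteriorPower.finrank_eq, hfin]; rfl
  have hmem : wedgeMul x y ∈ ⋀[ℂ]^(3 + 3) V := SetLike.mul_mem_graded
    (A := fun i : ℕ => ⋀[ℂ]^i V) (show x.1 ∈ ⋀[ℂ]^3 V from x.2) (show y.1 ∈ ⋀[ℂ]^3 V from y.2)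
  let e : ⋀[ℂ]^(3 + 3) V :=
    exteriorPower.ιMulti ℂ (3 + 3) ((sumBasis hU u w).reindex finSumFinEquiv)
  have he : vol hU u w (e : ExteriorAlgebra ℂ V) = 1 := by
    have h1 : (e : ExteriorAlgebra ℂ V) = ExteriorAlgebra.ιMulti ℂ (3 + 3)
      ((sumBasis hU u w).reindex finSumFinEquiv) := rfl
    rw [h1, vol_ιMulti, vol6, Basis.det_self]
  have he0 : e ≠ 0 := by
    intro h0
    rw [h0] at he
    simp at he
  obtain ⟨c, hc⟩ := exists_smul_eq_of_finrank_eq_one hone he0 ⟨_, hmem⟩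
  have hc' : wedgeMul x y = c • (e : ExteriorAlgebra ℂ V) := (congrArg Subtype.val hc).symm
  rw [hc', map_smul, he, smul_eq_mul, mul_one] at h
  rw [hc', h, zero_smul]

/-- Exchanging two blocks of three vectors is a product of three transpositions, an odd permutation.
-/
theorem omega_antisymm (x y : W3 V) : omega hU u w x y = -omega hU u w y x := by
  have h : omega hU u w = -(omega hU u w).flip := by
    refine W3.hom_ext fun a b c => W3.hom_ext fun a' b' c' => ?_
    simp only [LinearMap.neg_apply, LinearMap.flip_apply, w3, omega_wedge3]
    let σ : Equiv.Perm (Fin (3 + 3)) := Equiv.addRight 3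
    have h1 := (vol6 hU u w).map_perm (Fin.append ![a', b', c'] ![a, b, c]) σ
    have h2 : Equiv.Perm.sign σ = -1 := by decide
    have h3 : Fin.append ![a', b', c'] ![a, b, c] ∘ σ = Fin.append ![a, b, c] ![a', b', c'] := by
      funext i; fin_cases i <;> rfl
    rw [h2, h3] at h1
    simpa using h1
  have := LinearMap.congr_fun₂ h x y
  simpa using this

theorem vol6_append (a : Fin 3 → U₀) (c : Fin 3 → Uinf) :
    vol6 hU u w (Fin.append (fun i => (a i : V)) (fun i => (c i : V))) = u.det a * w.det c := by
  rw [vol6, Basis.det_reindex, Basis.det_apply, Basis.det_apply, Basis.det_apply]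
  have h : (sumBasis hU u w).toMatrix
      (Fin.append (fun i => (a i : V)) (fun i => (c i : V)) ∘ finSumFinEquiv) =
      Matrix.fromBlocks (u.toMatrix a) 0 0 (w.toMatrix c) := by
    have h1 : ∀ j, Fin.append (fun i => (a i : V)) (fun i => (c i : V))
        (finSumFinEquiv (Sum.inl j)) = a j := fun j => by
      rw [finSumFinEquiv_apply_left, Fin.append_left]
    have h2 : ∀ j, Fin.append (fun i => (a i : V)) (fun i => (c i : V))
        (finSumFinEquiv (Sum.inr j)) = c j := fun j => by
      rw [finSumFinEquiv_apply_right, Fin.append_right]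
    ext i j
    rcases i with i | i <;> rcases j with j | j <;>
      simp [h1, h2, Basis.toMatrix_apply, sumBasis, Submodule.prodEquivOfIsCompl_symm_apply]
  rw [h, Matrix.det_fromBlocks_zero₂₁]

theorem omega_uuw_uww (a a' a'' : U₀) (c c' c'' : Uinf) :
    omega hU u w (w3 (a : V) a' c) (w3 (a'' : V) c' c'') =
      -(u.det ![a, a', a''] * w.det ![c, c', c'']) := by
  rw [w3, w3, omega_wedge3, ← vol6_append hU]
  have h1 := (vol6 hU u w).map_swap (Fin.append (fun i => (![a, a', a''] i : V))
    (fun i => (![c, c', c''] i : V))) (i := 2) (j := 3) (by decide)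
  rw [← h1]
  congr 1
  funext i; fin_cases i <;> rfl

theorem omega_wuw_uuw (a a' a'' : U₀) (c c' c'' : Uinf) :
    omega hU u w (w3 (c : V) a c') (w3 (a' : V) a'' c'') =
      -(u.det ![a, a', a''] * w.det ![c, c', c'']) := by
  rw [w3_swap₁₂, map_neg, LinearMap.neg_apply, omega_antisymm, neg_neg, omega_uuw_uww]
  have h1 := u.det.map_perm ![a, a', a''] (finRotate 3)
  have h2 := w.det.map_perm ![c, c', c''] (finRotate 3)⁻¹
  have h3 : Equiv.Perm.sign (finRotate 3) = 1 := by decide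
  have h4 : Equiv.Perm.sign (finRotate 3)⁻¹ = 1 := by decide
  rw [h3, one_smul] at h1
  rw [h4, one_smul] at h2
  rw [← h1, ← h2]
  congr 3
  · funext i; fin_cases i <;> rfl
  · funext i; fin_cases i <;> rfl

theorem vol6_eq_zero_of_four [FiniteDimensional ℂ V] {S : Submodule ℂ V} (hS : finrank ℂ S = 3)
    (v : Fin (3 + 3) → V) (f : Fin 4 → Fin (3 + 3)) (hf : Function.Injective f)
    (hv : ∀ i, v (f i) ∈ S) : vol6 hU u w v = 0 := by
  refine (vol6 hU u w).map_linearDependent v fun hli => ?_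
  have h1 : LinearIndependent ℂ (fun i : Fin 4 => (⟨v (f i), hv i⟩ : S)) := by
    apply LinearIndependent.of_comp S.subtype
    exact hli.comp f hf
  have h2 := h1.fintype_card_le_finrank
  rw [hS] at h2
  simp at h2

theorem omega_eq_zero_of_mem [FiniteDimensional ℂ V] {S : Submodule ℂ V} (hS : finrank ℂ S = 3)
    {a b a' b' : V} (ha : a ∈ S) (hb : b ∈ S) (ha' : a' ∈ S) (hb' : b' ∈ S) (c c' : V) :
    omega hU u w (w3 a b c) (w3 a' b' c') = 0 := by
  rw [w3, w3, omega_wedge3]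
  refine vol6_eq_zero_of_four hU u w hS _ ![0, 1, 3, 4] (by decide) fun i => ?_
  fin_cases i
  · exact ha
  · exact hb
  · exact ha'
  · exact hb'

theorem omega_eq_zero_of_mem' [FiniteDimensional ℂ V] {S : Submodule ℂ V} (hS : finrank ℂ S = 3)
    {a b c a' : V} (ha : a ∈ S) (hb : b ∈ S) (hc : c ∈ S) (ha' : a' ∈ S) (b' c' : V) :
    omega hU u w (w3 a b c) (w3 a' b' c') = 0 := by
  rw [w3, w3, omega_wedge3]
  refine vol6_eq_zero_of_four hU u w hS _ ![0, 1, 2, 3] (by decide) fun i => ?_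
  fin_cases i
  · exact ha
  · exact hb
  · exact hc
  · exact ha'

/-- `map3 g` is the restriction of the endomorphism of the exterior algebra induced by `g`, which
respects products. So the shears preserve isotropy, with no determinant to compute. -/
theorem omega_map3_eq_zero (g : V →ₗ[ℂ] V) {x y : W3 V} (h : wedgeMul x y = 0) :
    wedgeMul (map3 g x) (map3 g y) = 0 := by
  have h1 : ∀ z : W3 V, (map3 g z).1 = ExteriorAlgebra.map g z.1 := by
    intro z
    let f₁ : W3 V →ₗ[ℂ] ExteriorAlgebra ℂ V := (⋀[ℂ]^3 V).subtype ∘ₗ map3 g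
    let f₂ : W3 V →ₗ[ℂ] ExteriorAlgebra ℂ V :=
      (ExteriorAlgebra.map g).toLinearMap ∘ₗ (⋀[ℂ]^3 V).subtype
    have h2 : f₁ = f₂ := by
      refine W3.hom_ext fun a b c => ?_
      change Subtype.val (map3 g (w3 a b c)) = ExteriorAlgebra.map g (w3 a b c).1
      rw [map3_w3]
      have h3 : ∀ a b c : V, Subtype.val (w3 a b c) = ExteriorAlgebra.ιMulti ℂ 3 ![a, b, c] :=
        fun _ _ _ => rfl
      rw [h3, h3, ExteriorAlgebra.map_apply_ιMulti]
      congr 1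
      funext i; fin_cases i <;> rfl
    exact LinearMap.congr_fun h2 z
  have h2 : x.1 * y.1 = 0 := h
  change (map3 g x).1 * (map3 g y).1 = 0
  rw [h1, h1, ← map_mul, h2, map_zero]

end Omega

/-! ### Coordinates on T_{U₀}, the quadrics ω(dφ t, t), and the cone of decomposable vectors. -/

section TangentQuadrics

variable {V : Type*} [AddCommGroup V] [Module ℂ V] {U₀ Uinf : Submodule ℂ V}
  (hU : IsCompl U₀ Uinf) (u : Basis (Fin 3) ℂ U₀) (w : Basis (Fin 3) ℂ Uinf)

/-- Indices in `Fin 3` are read modulo 3, so (i + 1, i + 2, i) is always an even permutation: the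
bases indexed by cyclic complements carry no sign. -/
theorem det_basis_cyclic {M : Type*} [AddCommGroup M] [Module ℂ M] (b : Basis (Fin 3) ℂ M)
    (i k : Fin 3) : b.det ![b (i + 1), b (i + 2), b k] = if i = k then 1 else 0 := by
  rw [Basis.det_apply, Matrix.det_fin_three]
  simp only [Basis.toMatrix_apply, Matrix.cons_val_zero, Matrix.cons_val_one, Matrix.cons_val,
    Basis.repr_self, Finsupp.single_apply]
  fin_cases i <;> fin_cases k <;> simp +decide

theorem det_basis_cyclic' {M : Type*} [AddCommGroup M] [Module ℂ M] (b : Basis (Fin 3) ℂ M)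
    (i k : Fin 3) : b.det ![b k, b (i + 1), b (i + 2)] = if k = i then 1 else 0 := by
  rw [Basis.det_apply, Matrix.det_fin_three]
  simp only [Basis.toMatrix_apply, Matrix.cons_val_zero, Matrix.cons_val_one, Matrix.cons_val,
    Basis.repr_self, Finsupp.single_apply]
  fin_cases i <;> fin_cases k <;> simp +decide

/-- The Levi-Civita symbol. -/
def sg (a i k : Fin 3) : ℂ :=
  (if i = a + 1 ∧ k = a + 2 then 1 else 0) - (if i = a + 2 ∧ k = a + 1 then 1 else 0)

theorem sg_swap (a i k : Fin 3) : sg a k i = -sg a i k := by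
  simp only [sg, neg_sub, and_comm]

theorem sum_mul_sg (f : Fin 3 → ℂ) (i k : Fin 3) : ∑ a, f a * sg a i k =
    (if k = i + 1 then f (i + 2) else 0) - (if k = i + 2 then f (i + 1) else 0) := by
  rw [Fin.sum_univ_three]
  fin_cases i <;> fin_cases k <;> simp +decide [sg]

theorem det_basis_apply {M : Type*} [AddCommGroup M] [Module ℂ M] (b : Basis (Fin 3) ℂ M)
    (c : M) (j l : Fin 3) : b.det ![c, b j, b l] = ∑ a, b.repr c a * sg a j l := by
  rw [Basis.det_apply, Matrix.det_fin_three, sum_mul_sg]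
  simp only [Basis.toMatrix_apply, Matrix.cons_val_zero, Matrix.cons_val_one, Matrix.cons_val,
    Basis.repr_self, Finsupp.single_apply]
  fin_cases j <;> fin_cases l <;> simp +decide

/-- The basis of `T_{U₀}`. -/
def eT : Option (Fin 3 × Fin 3) → W3 V
  | none => w3 (u 0 : V) (u 1) (u 2)
  | some (i, j) => w3 (u (i + 1) : V) (u (i + 2)) (w j)

/-- The dual family of `eT`, up to sign. -/
def eS : Option (Fin 3 × Fin 3) → W3 V
  | none => -w3 (w 0 : V) (w 1) (w 2)
  | some (k, l) => w3 (u k : V) (w (l + 1)) (w (l + 2))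

theorem eT_mem (α) : eT u w α ∈ TSub U₀ := by
  rcases α with _ | ⟨i, j⟩
  · exact Submodule.subset_span ⟨_, (u 0).2, _, (u 1).2, _, rfl⟩
  · exact Submodule.subset_span ⟨_, (u (i + 1)).2, _, (u (i + 2)).2, _, rfl⟩

/-- The nilpotent endomorphism of `V` attached to `φ : U₀ → U_∞`. -/
def nilp : (U₀ →ₗ[ℂ] Uinf) →ₗ[ℂ] (V →ₗ[ℂ] V) where
  toFun φ := Uinf.subtype ∘ₗ φ ∘ₗ U₀.projectionOnto Uinf hU
  map_add' φ ψ := by ext; simp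
  map_smul' c φ := by ext; simp

theorem nilp_left (φ : U₀ →ₗ[ℂ] Uinf) (a : U₀) : nilp hU φ a = φ a := by
  simp [nilp]

theorem nilp_right (φ : U₀ →ₗ[ℂ] Uinf) (c : Uinf) : nilp hU φ c = 0 := by
  simp [nilp]

theorem shear_neg (φ : U₀ →ₗ[ℂ] Uinf) : shear hU (-φ) = LinearMap.id - nilp hU φ := by
  ext v
  simp [shear, nilp, sub_eq_add_neg]

/-- The derivation of `⋀³ V` attached to `φ`, linearly in `φ`. -/
def derU : (U₀ →ₗ[ℂ] Uinf) →ₗ[ℂ] (W3 V →ₗ[ℂ] W3 V) where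
  toFun φ := der (nilp hU φ)
  map_add' φ ψ := by rw [map_add, der_add]
  map_smul' c φ := by rw [map_smul, der_smul]; rfl

theorem derU_apply (φ : U₀ →ₗ[ℂ] Uinf) : derU hU φ = der (nilp hU φ) := rfl

/-- Each term of the Leibniz rule keeps two of the three factors, so a vector is repeated in the
determinant of size 6. -/
theorem omega_derU_decomposable (φ : U₀ →ₗ[ℂ] Uinf) (v : Fin 3 → V) :
    omega hU u w (derU hU φ (wedge3 v)) (wedge3 v) = 0 := by
  have key : ∀ a b c a' b' c' : V, (b = b' ∨ c = c' ∨ a = a') →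
      omega hU u w (w3 a b c) (w3 a' b' c') = 0 := by
    intro a b c a' b' c' h
    rw [w3, w3, omega_wedge3]
    rcases h with h | h | h
    · exact (vol6 hU u w).map_eq_zero_of_eq _ (i := 1) (j := 4) h (by decide)
    · exact (vol6 hU u w).map_eq_zero_of_eq _ (i := 2) (j := 5) h (by decide)
    · exact (vol6 hU u w).map_eq_zero_of_eq _ (i := 0) (j := 3) h (by decide)
  rw [wedge3_eq_w3, derU_apply, der_w3, map_add, map_add, LinearMap.add_apply,
    LinearMap.add_apply, key, key, key]
  · simp
  · exact Or.inr (Or.inr rfl)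
  · exact Or.inr (Or.inl rfl)
  · exact Or.inl rfl

variable [FiniteDimensional ℂ V]

theorem finrank_left (u : Basis (Fin 3) ℂ U₀) : finrank ℂ U₀ = 3 := by
  rw [finrank_eq_card_basis u]; rfl

theorem TSub_isotropic {x y : W3 V} (hx : x ∈ TSub U₀) (hy : y ∈ TSub U₀) :
    omega hU u w x y = 0 := by
  have h : TSub U₀ ≤ LinearMap.ker ((omega hU u w).flip y) := by
    rw [TSub, Submodule.span_le]
    rintro _ ⟨a, ha, b, hb, c, rfl⟩
    have h2 : TSub U₀ ≤ LinearMap.ker (omega hU u w (w3 a b c)) := by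
      rw [TSub, Submodule.span_le]
      rintro _ ⟨a', ha', b', hb', c', rfl⟩
      exact omega_eq_zero_of_mem hU u w (finrank_left u) ha hb ha' hb' c c'
    exact h2 hy
  exact h hx

theorem omega_eS_eS (α β) : omega hU u w (eS u w α) (eS u w β) = 0 := by
  have h : ∀ α, ∃ (a b : Uinf) (c : V), eS u w α = w3 (a : V) b c := by
    rintro (_ | ⟨k, l⟩)
    · exact ⟨-w 0, w 1, w 2, by simp [eS, w3_neg₁]⟩
    · exact ⟨w (l + 1), w (l + 2), u k, by rw [eS, w3_rotate]⟩
  obtain ⟨a, b, c, h1⟩ := h α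
  obtain ⟨a', b', c', h2⟩ := h β
  rw [h1, h2]
  exact omega_eq_zero_of_mem hU u w (finrank_left w) a.2 b.2 a'.2 b'.2 c c'

theorem omega_eT_eS (α β) :
    omega hU u w (eT u w α) (eS u w β) = if α = β then -1 else 0 := by
  rcases α with _ | ⟨i, j⟩ <;> rcases β with _ | ⟨k, l⟩
  · have h := vol6_append hU u w u w
    rw [Basis.det_self, Basis.det_self, mul_one, ← omega_wedge3] at h
    rw [wedge3_eq_w3, wedge3_eq_w3] at h
    simp [eT, eS, h]
  · simp only [eT, eS, reduceCtorEq, if_false]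
    exact omega_eq_zero_of_mem' hU u w (finrank_left u) (u 0).2 (u 1).2 (u 2).2 (u k).2 _ _
  · simp only [eT, eS, reduceCtorEq, if_false, map_neg, neg_eq_zero]
    rw [omega_antisymm, neg_eq_zero, ← w3_rotate (w j : V)]
    exact omega_eq_zero_of_mem' hU u w (finrank_left w) (w 0).2 (w 1).2 (w 2).2 (w j).2 _ _
  · simp only [eT, eS, Option.some.injEq, Prod.mk.injEq]
    rw [omega_uuw_uww, det_basis_cyclic, det_basis_cyclic']
    by_cases h1 : i = k <;> by_cases h2 : j = l <;> simp [h1, h2]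

theorem omega_eS_eT (α β) :
    omega hU u w (eS u w α) (eT u w β) = if α = β then 1 else 0 := by
  rw [omega_antisymm, omega_eT_eS, apply_ite Neg.neg]
  simp [eq_comm]

theorem omega_eT_eT (α β) : omega hU u w (eT u w α) (eT u w β) = 0 :=
  TSub_isotropic hU u w (eT_mem u w α) (eT_mem u w β)

theorem linearIndependent_eT_eS (hU : IsCompl U₀ Uinf) (u : Basis (Fin 3) ℂ U₀)
    (w : Basis (Fin 3) ℂ Uinf) : LinearIndependent ℂ (Sum.elim (eT u w) (eS u w)) := by
  rw [Fintype.linearIndependent_iff]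
  intro g hg
  rw [Fintype.sum_sum_type] at hg
  simp only [Sum.elim_inl, Sum.elim_inr] at hg
  rintro (α | α)
  · have := congrArg (fun x => omega hU u w x (eS u w α)) hg
    simpa [-Fintype.sum_option, omega_eT_eS, omega_eS_eS, Finset.sum_ite_eq, LinearMap.sum_apply] using this
  · have := congrArg (fun x => omega hU u w x (eT u w α)) hg
    simpa [-Fintype.sum_option, omega_eT_eT, omega_eS_eT, Finset.sum_ite_eq, LinearMap.sum_apply] using this

theorem finrank_W3 (hU : IsCompl U₀ Uinf) (u : Basis (Fin 3) ℂ U₀) (w : Basis (Fin 3) ℂ Uinf) :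
    finrank ℂ (W3 V) = 20 := by
  have hfin : finrank ℂ V = 6 := by
    rw [finrank_eq_card_basis (sumBasis hU u w)]; rfl
  have h : finrank ℂ (W3 V) = Nat.choose (finrank ℂ V) 3 := exteriorPower.finrank_eq ℂ 3
  rw [h, hfin]; rfl

theorem eq_sum_eT_add_sum_eS (x : W3 V) :
    x = ∑ α, (-omega hU u w x (eS u w α)) • eT u w α + ∑ α, omega hU u w x (eT u w α) • eS u w α := by
  let b := basisOfLinearIndependentOfCardEqFinrank (linearIndependent_eT_eS hU u w) (by
    rw [finrank_W3 hU u w]; rfl)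
  have hx := b.sum_repr x
  rw [Fintype.sum_sum_type] at hx
  simp only [b, coe_basisOfLinearIndependentOfCardEqFinrank, Sum.elim_inl, Sum.elim_inr] at hx
  have h1 : ∀ α, b.repr x (Sum.inl α) = -omega hU u w x (eS u w α) := fun α => by
    conv_rhs => rw [← hx]
    simp [-Fintype.sum_option, omega_eT_eS, omega_eS_eS, LinearMap.sum_apply, b]
  have h2 : ∀ α, b.repr x (Sum.inr α) = omega hU u w x (eT u w α) := fun α => by
    conv_rhs => rw [← hx]
    simp [-Fintype.sum_option, omega_eT_eT, omega_eS_eT, LinearMap.sum_apply, b]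
  conv_lhs => rw [← hx]
  simp only [b] at h1 h2
  simp only [h1, h2]

theorem omega_nondegenerate {x : W3 V} (h : ∀ y, omega hU u w x y = 0) : x = 0 := by
  rw [eq_sum_eT_add_sum_eS hU u w x]
  simp [h]

theorem eq_sum_eT {t : W3 V} (ht : ∀ s ∈ TSub U₀, omega hU u w t s = 0) :
    t = ∑ α, (-omega hU u w t (eS u w α)) • eT u w α := by
  conv_lhs => rw [eq_sum_eT_add_sum_eS hU u w t]
  simp [ht _ (eT_mem u w _)]

/-- T_{U₀} is Lagrangian: in the expansion along the dual families `eT` and `eS`, orthogonality to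
T_{U₀} kills the `eS` part. -/
theorem mem_TSub_iff {t : W3 V} : t ∈ TSub U₀ ↔ ∀ s ∈ TSub U₀, omega hU u w t s = 0 := by
  refine ⟨fun h s hs => TSub_isotropic hU u w h hs, fun h => ?_⟩
  rw [eq_sum_eT hU u w h]
  exact Submodule.sum_mem _ fun α _ => Submodule.smul_mem _ _ (eT_mem u w α)

theorem finrank_TSub (hU : IsCompl U₀ Uinf) (u : Basis (Fin 3) ℂ U₀) (w : Basis (Fin 3) ℂ Uinf) :
    finrank ℂ (TSub U₀) = 10 := by
  have h1 : LinearIndependent ℂ (eT u w) :=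
    (linearIndependent_eT_eS hU u w).comp Sum.inl Sum.inl_injective
  have h2 : TSub U₀ = Submodule.span ℂ (Set.range (eT u w)) := by
    apply le_antisymm
    · intro t ht
      rw [eq_sum_eT hU u w ((mem_TSub_iff hU u w).1 ht)]
      exact Submodule.sum_mem _ fun α _ => Submodule.smul_mem _ _
        (Submodule.subset_span ⟨α, rfl⟩)
    · rw [Submodule.span_le]
      rintro _ ⟨α, rfl⟩
      exact eT_mem u w α
  rw [h2, finrank_span_eq_card h1]; rfl

/-- The coordinates `m_{ij}` on `T_{U₀}`. -/
def mT (i j : Fin 3) : Dual ℂ (W3 V) := -(omega hU u w).flip (eS u w (some (i, j)))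

theorem eq_smul_add_sum_mT {t : W3 V} (ht : t ∈ TSub U₀) :
    ∃ c : ℂ, t = c • eT u w none + ∑ i, ∑ j, mT hU u w i j t • eT u w (some (i, j)) := by
  refine ⟨-omega hU u w t (eS u w none), ?_⟩
  conv_lhs => rw [eq_sum_eT hU u w ((mem_TSub_iff hU u w).1 ht)]
  rw [Fintype.sum_option, Fintype.sum_prod_type]
  rfl

/-- The coefficients of the quadric attached to `φ` in the coordinates `m_{ij}`. -/
def coefG (f : Fin 3 → Fin 3 → ℂ) (i j k l : Fin 3) : ℂ :=
  ∑ a, (∑ b, f a b * sg b j l) * sg a i k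

theorem coefG_symm (f : Fin 3 → Fin 3 → ℂ) (i j k l : Fin 3) :
    coefG f k l i j = coefG f i j k l := by
  simp only [coefG]
  refine Finset.sum_congr rfl fun a _ => ?_
  rw [sg_swap a, mul_neg, ← neg_mul, ← Finset.sum_neg_distrib]
  congr 1
  refine Finset.sum_congr rfl fun b _ => ?_
  rw [sg_swap b, mul_neg, neg_neg]

/-- The coefficients are those of a combination of the 2×2 minors of (m_{ij}): the entry (a, b) of
the matrix of φ multiplies twice the minor complementary to row a and column b. -/
theorem omega_derU_eT_eT (φ : U₀ →ₗ[ℂ] Uinf) (i j k l : Fin 3) :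
    omega hU u w (derU hU φ (eT u w (some (i, j)))) (eT u w (some (k, l))) =
      coefG (fun a b => w.repr (φ (u a)) b) i j k l := by
  rw [coefG, sum_mul_sg]
  simp only [eT, derU_apply, der_w3, nilp_left, nilp_right, w3_zero₃, add_zero]
  rw [w3_swap₁₂ (u (i + 1) : V), map_add, map_neg, LinearMap.add_apply, LinearMap.neg_apply,
    omega_wuw_uuw, omega_wuw_uuw, det_basis_cyclic', det_basis_cyclic', det_basis_apply,
    det_basis_apply]
  by_cases h1 : k = i + 1
  · subst h1
    simp
  · by_cases h2 : k = i + 2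
    · subst h2; simp
    · simp [h1, h2, Ne.symm h1, Ne.symm h2]

/-- ⋀³U₀ is the vertex of the cone, and it lies in the kernel of every tangent quadric: its
derivative stays in the isotropic space T_{U₀}. -/
theorem omega_derU_none_left (φ : U₀ →ₗ[ℂ] Uinf) {t : W3 V} (ht : t ∈ TSub U₀) :
    omega hU u w (derU hU φ (eT u w none)) t = 0 := by
  refine TSub_isotropic hU u w ?_ ht
  simp only [eT, derU_apply, der_w3, nilp_left]
  refine add_mem (add_mem ?_ ?_) ?_
  · rw [w3_rotate]; exact Submodule.subset_span ⟨_, (u 1).2, _, (u 2).2, _, rfl⟩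
  · rw [← w3_rotate]; exact Submodule.subset_span ⟨_, (u 2).2, _, (u 0).2, _, rfl⟩
  · exact Submodule.subset_span ⟨_, (u 0).2, _, (u 1).2, _, rfl⟩

theorem omega_derU_none_right (φ : U₀ →ₗ[ℂ] Uinf) (i j : Fin 3) :
    omega hU u w (derU hU φ (eT u w (some (i, j)))) (eT u w none) = 0 := by
  simp only [eT, derU_apply, der_w3, nilp_left, nilp_right, w3_zero₃, add_zero]
  rw [omega_antisymm, neg_eq_zero, map_add, w3_rotate (φ _ : V),
    omega_eq_zero_of_mem' hU u w (finrank_left u) (u 0).2 (u 1).2 (u 2).2 (u (i + 2)).2,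
    omega_eq_zero_of_mem' hU u w (finrank_left u) (u 0).2 (u 1).2 (u 2).2 (u (i + 1)).2, add_zero]

theorem omega_derU (φ : U₀ →ₗ[ℂ] Uinf) {t t' : W3 V} (ht : t ∈ TSub U₀) (ht' : t' ∈ TSub U₀) :
    omega hU u w (derU hU φ t) t' = ∑ i, ∑ j, ∑ k, ∑ l, mT hU u w i j t * mT hU u w k l t' *
      coefG (fun a b => w.repr (φ (u a)) b) i j k l := by
  obtain ⟨c, hc⟩ := eq_smul_add_sum_mT hU u w ht
  obtain ⟨c', hc'⟩ := eq_smul_add_sum_mT hU u w ht'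
  have h1 : omega hU u w (derU hU φ t) t' = ∑ i, ∑ j, mT hU u w i j t *
      omega hU u w (derU hU φ (eT u w (some (i, j)))) t' := by
    conv_lhs => rw [hc]
    simp [omega_derU_none_left hU u w φ ht', LinearMap.sum_apply]
  rw [h1]
  refine Finset.sum_congr rfl fun i _ => Finset.sum_congr rfl fun j _ => ?_
  conv_lhs => rw [hc']
  simp [omega_derU_none_right, omega_derU_eT_eT, Finset.mul_sum, mul_assoc]

theorem omega_derU_symm (φ : U₀ →ₗ[ℂ] Uinf) {t t' : W3 V} (ht : t ∈ TSub U₀) (ht' : t' ∈ TSub U₀) :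
    omega hU u w (derU hU φ t) t' = omega hU u w (derU hU φ t') t := by
  rw [omega_derU hU u w φ ht ht', omega_derU hU u w φ ht' ht]
  have h1 : ∀ F : Fin 3 → Fin 3 → Fin 3 → Fin 3 → ℂ, ∑ i, ∑ j, ∑ k, ∑ l, F i j k l =
      ∑ k, ∑ l, ∑ i, ∑ j, F i j k l := fun F => by
    have h2 := Finset.sum_comm (s := (Finset.univ : Finset (Fin 3 × Fin 3)))
      (t := (Finset.univ : Finset (Fin 3 × Fin 3))) (f := fun p q => F p.1 p.2 q.1 q.2)
    simpa only [Fintype.sum_prod_type] using h2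
  rw [h1]
  refine Finset.sum_congr rfl fun i _ => Finset.sum_congr rfl fun j _ =>
    Finset.sum_congr rfl fun k _ => Finset.sum_congr rfl fun l _ => ?_
  rw [coefG_symm, mul_comm (mT hU u w k l t)]

/-- The cone over the Segre variety consists of wedges. If x_r ≠ 0, the vectors x_r u_{r+1} −
x_{r+1} u_r and x_r u_{r+2} − x_{r+2} u_r span the required plane of U₀, and the multiple of u_r
added to the third factor adjusts the coefficient c of the vertex. -/
theorem exists_wedge3_of_rank_one (c : ℂ) (x y : Fin 3 → ℂ) :
    ∃ v : Fin 3 → V, wedge3 v =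
      c • eT u w none + ∑ i, ∑ j, (x i * y j) • eT u w (some (i, j)) := by
  let W : V := ∑ j, y j • (w j : V)
  have hsum : ∀ i, ∑ j, (x i * y j) • eT u w (some (i, j)) =
      x i • w3 (u (i + 1) : V) (u (i + 2)) W := fun i => by
    simp only [eT, W, Fin.sum_univ_three, w3_add₃, w3_smul₃, smul_add, smul_smul]
  simp only [hsum]
  have key : ∀ (a₀ a₁ a₂ : V) (x₀ x₁ x₂ : ℂ), x₀ ≠ 0 →
      w3 (x₀ • a₁ - x₁ • a₀) (x₀ • a₂ - x₂ • a₀) (x₀⁻¹ • W + (c * x₀⁻¹ * x₀⁻¹) • a₀) =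
      c • w3 a₀ a₁ a₂ + (x₀ • w3 a₁ a₂ W + x₁ • w3 a₂ a₀ W + x₂ • w3 a₀ a₁ W) := by
    intro a₀ a₁ a₂ x₀ x₁ x₂ h
    simp only [sub_eq_add_neg, ← neg_smul, w3_add₁, w3_add₂, w3_add₃, w3_smul₁, w3_smul₂,
      w3_smul₃, w3_self₁₂, w3_self₁₃, w3_self₂₃, smul_zero, add_zero]
    rw [w3_swap₁₂ a₁ a₀ W, w3_swap₁₂ a₀ a₂ W, ← w3_rotate a₀ a₁ a₂]
    match_scalars <;> field_simp
  by_cases hx : x = 0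
  · refine ⟨![c • (u 0 : V), u 1, u 2], ?_⟩
    have h : wedge3 ![c • (u 0 : V), u 1, u 2] = c • w3 (u 0 : V) (u 1) (u 2) := w3_smul₁ _ _ _ _
    simp [h, hx, eT]
  · obtain ⟨r, hr⟩ : ∃ r, x r ≠ 0 := by
      by_contra h
      push Not at h
      exact hx (funext h)
    refine ⟨![x r • (u (r + 1) : V) - x (r + 1) • (u r : V),
      x r • (u (r + 2) : V) - x (r + 2) • (u r : V),
      (x r)⁻¹ • W + (c * (x r)⁻¹ * (x r)⁻¹) • (u r : V)], ?_⟩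
    have h := key (u r) (u (r + 1)) (u (r + 2)) (x r) (x (r + 1)) (x (r + 2)) hr
    refine h.trans ?_
    rw [Fin.sum_univ_three]
    fin_cases r
    · simp only [eT]; rfl
    · have e : w3 (u 1 : V) (u 2) (u 0) = w3 (u 0 : V) (u 1) (u 2) := (w3_rotate _ _ _).symm
      change c • w3 (u 1 : V) (u 2) (u 0) + (x 1 • w3 (u 2 : V) (u 0) W +
        x 2 • w3 (u 0 : V) (u 1) W + x 0 • w3 (u 1 : V) (u 2) W) = c • w3 (u 0 : V) (u 1) (u 2) +
        (x 0 • w3 (u 1 : V) (u 2) W + x 1 • w3 (u 2 : V) (u 0) W + x 2 • w3 (u 0 : V) (u 1) W)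
      rw [e]; abel
    · have e : w3 (u 2 : V) (u 0) (u 1) = w3 (u 0 : V) (u 1) (u 2) := w3_rotate _ _ _
      change c • w3 (u 2 : V) (u 0) (u 1) + (x 2 • w3 (u 0 : V) (u 1) W +
        x 0 • w3 (u 1 : V) (u 2) W + x 1 • w3 (u 2 : V) (u 0) W) = c • w3 (u 0 : V) (u 1) (u 2) +
        (x 0 • w3 (u 1 : V) (u 2) W + x 1 • w3 (u 2 : V) (u 0) W + x 2 • w3 (u 0 : V) (u 1) W)
      rw [e]; abel

end TangentQuadrics

/-! ### Linear algebra: a rank-one member in a space of 3×3 matrices. -/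

section RankOne

/-- A commuting family of endomorphisms has a common eigenvector. -/
theorem exists_common_eigenvector {R ι : Type*} [AddCommGroup R] [Module ℂ R]
    [FiniteDimensional ℂ R] [Nontrivial R] (S : ι → End ℂ R) (hS : ∀ i j, Commute (S i) (S j)) :
    ∃ θ : R, θ ≠ 0 ∧ ∀ i, ∃ μ : ℂ, S i θ = μ • θ := by
  -- Take a minimal nonzero subspace stable under all the operators. Its intersection with an
  -- eigenspace of one of them is stable by commutation, hence is everything.
  let 𝒮 : Set (Submodule ℂ R) := {E | E ≠ ⊥ ∧ ∀ i, ∀ x ∈ E, S i x ∈ E}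
  obtain ⟨E, ⟨hE0, hE⟩, hmin⟩ := (wellFounded_lt (α := Submodule ℂ R)).has_min 𝒮
    ⟨⊤, top_ne_bot, fun _ _ _ => trivial⟩
  obtain ⟨θ, hθE, hθ⟩ := Submodule.exists_mem_ne_zero_of_ne_bot hE0
  refine ⟨θ, hθ, fun i => ?_⟩
  have : Nontrivial E := Submodule.nontrivial_iff_ne_bot.2 hE0
  obtain ⟨μ, hμ⟩ := Module.End.exists_eigenvalue ((S i).restrict (hE i))
  obtain ⟨v, hv⟩ := hμ.exists_hasEigenvector
  have hv1 : S i v = μ • (v : R) := congrArg Subtype.val hv.apply_eq_smul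
  let E' := E ⊓ Module.End.eigenspace (S i) μ
  have hE' : E' ∈ 𝒮 := by
    refine ⟨?_, fun j x hx => ⟨hE j x hx.1, ?_⟩⟩
    · rw [Submodule.ne_bot_iff]
      exact ⟨v, ⟨v.2, Module.End.mem_eigenspace_iff.2 hv1⟩, fun h => hv.2 (Subtype.ext h)⟩
    · have h1 := Module.End.mem_eigenspace_iff.1 hx.2
      rw [SetLike.mem_coe, Module.End.mem_eigenspace_iff]
      have h2 := LinearMap.congr_fun (hS i j) x
      simp only [Module.End.mul_apply] at h2
      rw [h2, h1, map_smul]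
  have h3 : E' = E := by
    by_contra h
    exact hmin E' hE' (lt_of_le_of_ne inf_le_left h)
  have h4 : θ ∈ E' := by rw [h3]; exact hθE
  exact ⟨μ, Module.End.mem_eigenspace_iff.1 h4.2⟩

theorem exists_basis_eq {A : Type*} [AddCommGroup A] [Module ℂ A] [FiniteDimensional ℂ A]
    (hA : finrank ℂ A = 3) {a : A} (ha : a ≠ 0) : ∃ e : Basis (Fin 3) ℂ A, e 0 = a := by
  have hli : LinearIndepOn ℂ id ({a} : Set A) := by
    exact LinearIndepOn.singleton (v := id) ha
  let e := Basis.extend hli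
  have := FiniteDimensional.fintypeBasisIndex e
  have hcard : Fintype.card (hli.extend (Set.subset_univ _)) = Fintype.card (Fin 3) := by
    rw [← finrank_eq_card_basis e, hA]; rfl
  let σ := Fintype.equivOfCardEq hcard
  let i₀ : hli.extend (Set.subset_univ _) := ⟨a, hli.subset_extend _ rfl⟩
  refine ⟨e.reindex (σ.trans (Equiv.swap (σ i₀) 0)), ?_⟩
  simp [e, i₀]

theorem exists_eq_mul_of_det_eq_zero {p q r s : ℂ} (h : p * s = q * r) :
    ∃ x₁ x₂ y₁ y₂ : ℂ, p = x₁ * y₁ ∧ q = x₁ * y₂ ∧ r = x₂ * y₁ ∧ s = x₂ * y₂ := by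
  by_cases hp : p = 0
  · by_cases hq : q = 0
    · exact ⟨0, 1, r, s, by simp [hp], by simp [hq], by simp, by simp⟩
    · have hr : r = 0 := by
        rw [hp, zero_mul] at h
        exact (mul_eq_zero.1 h.symm).resolve_left hq
      exact ⟨1, s / q, 0, q, by simp [hp], by simp, by simp [hr], by field_simp⟩
  · exact ⟨1, r / p, p, q, by simp, by simp, by field_simp, by field_simp; linear_combination h⟩

variable {A B R : Type*} [AddCommGroup A] [Module ℂ A] [AddCommGroup B] [Module ℂ B]
  [AddCommGroup R] [Module ℂ R]

/-- Some nonzero `θ` makes the bilinear form `(a, b) ↦ β θ (c a b)` of rank at most one. -/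
def HasRankOne (β : R →ₗ[ℂ] R →ₗ[ℂ] ℂ) (c : A →ₗ[ℂ] B →ₗ[ℂ] R) : Prop :=
  ∃ θ : R, θ ≠ 0 ∧ ∃ (α : Dual ℂ A) (γ : Dual ℂ B), ∀ a b, β θ (c a b) = α a * γ b

variable {β : R →ₗ[ℂ] R →ₗ[ℂ] ℂ} {c : A →ₗ[ℂ] B →ₗ[ℂ] R}

theorem HasRankOne.of_flip (h : HasRankOne β c.flip) : HasRankOne β c := by
  obtain ⟨θ, hθ, α, γ, H⟩ := h
  exact ⟨θ, hθ, γ, α, fun a b => by rw [mul_comm]; exact H b a⟩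

/-- Take θ = c a₀ b. If c a b = s(a) θ, then `hc` turns β(θ, c a b') into β(c a₀ b', c a b) = s(a)
β(c a₀ b', θ), a product. The functional f only serves to read off s(a). -/
theorem hasRankOne_of_slice
    (hc : ∀ a b a' b', β (c a b) (c a' b') = β (c a b') (c a' b)) {a₀ : A} {b : B}
    (h0 : c a₀ b ≠ 0) (h : ∀ a, c a b ∈ Submodule.span ℂ {c a₀ b}) : HasRankOne β c := by
  obtain ⟨f, hf⟩ : ∃ f : Dual ℂ R, f (c a₀ b) ≠ 0 := by
    by_contra h1
    push Not at h1
    exact h0 ((Module.forall_dual_apply_eq_zero_iff ℂ _).1 h1)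
  refine ⟨c a₀ b, h0, (f (c a₀ b))⁻¹ • (f ∘ₗ c.flip b), (β.flip (c a₀ b)) ∘ₗ c a₀, fun a b' => ?_⟩
  obtain ⟨s, hs⟩ := Submodule.mem_span_singleton.1 (h a)
  rw [hc, ← hs]
  simp only [LinearMap.smul_apply, LinearMap.comp_apply, LinearMap.flip_apply, ← hs, map_smul,
    smul_eq_mul]
  field_simp

variable [FiniteDimensional ℂ A] [FiniteDimensional ℂ B] [FiniteDimensional ℂ R]

theorem hasRankOne_of_finrank_range_le_one
    (hc : ∀ a b a' b', β (c a b) (c a' b') = β (c a b') (c a' b)) {b : B}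
    (h0 : c.flip b ≠ 0) (h : finrank ℂ (LinearMap.range (c.flip b)) ≤ 1) : HasRankOne β c := by
  obtain ⟨a₀, ha₀⟩ : ∃ a, c.flip b a ≠ 0 := by
    by_contra h1
    push Not at h1
    exact h0 (LinearMap.ext h1)
  refine hasRankOne_of_slice hc ha₀ fun a => ?_
  have h1 : Submodule.span ℂ {c.flip b a₀} = LinearMap.range (c.flip b) := by
    apply Submodule.eq_of_le_of_finrank_le
    · rw [Submodule.span_singleton_le_iff_mem]; exact ⟨a₀, rfl⟩
    · rw [finrank_span_singleton ha₀]; exact h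
  change c.flip b a ∈ Submodule.span ℂ {c.flip b a₀}
  rw [h1]
  exact ⟨a, rfl⟩

/-- The slice at b identifies A with R, and the other slices become operators on R. By `hc` they are
self-adjoint for β and commute; a common eigenvector θ gives β(θ, S x) = μ β(θ, x), a product of a
function of b' and a function of a. -/
theorem hasRankOne_of_bijective
    (hnd : ∀ x, (∀ y, β x y = 0) → x = 0)
    (hc : ∀ a b a' b', β (c a b) (c a' b') = β (c a b') (c a' b)) [Nontrivial R] {b : B}
    (hb : Function.Bijective (c.flip b)) : HasRankOne β c := by
  let e := LinearEquiv.ofBijective _ hb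
  have he : ∀ x, c (e.symm x) b = x := fun x => e.apply_symm_apply x
  let S : B → End ℂ R := fun b' => (c.flip b') ∘ₗ e.symm.toLinearMap
  have hS : ∀ b' x, S b' x = c (e.symm x) b' := fun _ _ => rfl
  have hsymm : ∀ b' x y, β (S b' x) y = β x (S b' y) := fun b' x y => by
    rw [hS, hS]
    conv_lhs => rw [← he y]
    conv_rhs => rw [← he x]
    rw [hc]
  have hcomm : ∀ b₁ b₂, Commute (S b₁) (S b₂) := fun b₁ b₂ => by
    refine LinearMap.ext fun x => ?_
    simp only [Module.End.mul_apply]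
    rw [← sub_eq_zero]
    refine hnd _ fun y => ?_
    rw [map_sub, LinearMap.sub_apply, hsymm b₁ (S b₂ x), hsymm b₂ (S b₁ x), sub_eq_zero, hS, hS, hS, hS, hc]
  obtain ⟨θ, hθ, hμ⟩ := exists_common_eigenvector S hcomm
  obtain ⟨x₀, hx₀⟩ : ∃ x, β θ x ≠ 0 := by
    by_contra h
    push Not at h
    exact hθ (hnd θ h)
  refine ⟨θ, hθ, (β θ) ∘ₗ c.flip b, (β θ x₀)⁻¹ • ((β θ) ∘ₗ c (e.symm x₀)), fun a b' => ?_⟩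
  obtain ⟨μ, hμ⟩ := hμ b'
  have h1 : ∀ x, β θ (c (e.symm x) b') = μ * β θ x := fun x => by
    rw [← hS, ← hsymm, hμ, map_smul]; rfl
  have h2 := h1 (c a b)
  have h3 : e.symm (c a b) = a := e.symm_apply_apply a
  rw [h3] at h2
  simp only [LinearMap.comp_apply, LinearMap.flip_apply, LinearMap.smul_apply, h1, h2, smul_eq_mul]
  field_simp

/-- If some slice of rank two exists and no slice has rank one, some transverse slice vanishes. -/
theorem exists_slice_eq_zero (hA : finrank ℂ A = 3) (hR : finrank ℂ R ≤ 3)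
    (hβ : ∀ x y, β x y = β y x) (hnd : ∀ x, (∀ y, β x y = 0) → x = 0)
    (hc : ∀ a b a' b', β (c a b) (c a' b') = β (c a b') (c a' b)) {b : B}
    (hb : finrank ℂ (LinearMap.range (c.flip b)) = 2) :
    HasRankOne β c ∨ ∃ a : A, a ≠ 0 ∧ c a = 0 := by
  have hker : LinearMap.ker (c.flip b) ≠ ⊥ := by
    intro h
    have h1 := LinearMap.finrank_range_add_finrank_ker (c.flip b)
    rw [h, hb, hA, finrank_bot] at h1
    omega
  obtain ⟨a, ha, ha0⟩ := Submodule.exists_mem_ne_zero_of_ne_bot hker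
  have hab : c a b = 0 := ha
  by_cases h0 : c a = 0
  · exact Or.inr ⟨a, ha0, h0⟩
  left
  apply HasRankOne.of_flip
  refine hasRankOne_of_finrank_range_le_one (c := c.flip) (b := a) (fun b₁ a₁ b₂ a₂ => ?_) h0 ?_
  · simp only [LinearMap.flip_apply]
    rw [hc, hβ]
  · let β' : LinearMap.BilinForm ℂ R := β
    have hnd' : β'.Nondegenerate := by
      refine ⟨fun x hx => hnd x hx, fun x hx => hnd x fun y => ?_⟩
      rw [hβ]; exact hx y
    have h1 := LinearMap.BilinForm.finrank_orthogonal hnd' (LinearMap.range (c.flip b))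
    -- Since c a b = 0, `hc` makes the range of `c a` orthogonal to the 2-dimensional range of the
    -- slice at b. In dimension at most 3 it has rank at most one.
    have h2 : LinearMap.range (c.flip.flip a) ≤ β'.orthogonal (LinearMap.range (c.flip b)) := by
      rintro _ ⟨b', rfl⟩
      rw [LinearMap.BilinForm.mem_orthogonal_iff]
      rintro _ ⟨a', rfl⟩
      change β (c a' b) (c a b') = 0
      rw [hc, hab, map_zero]
    have h3 := Submodule.finrank_mono h2
    rw [h1, hb] at h3
    omega

/-- In bases starting with a and b only a 2×2 block of the matrix of (a, b) ↦ β θ (c a b) survives.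
Its entries are linear in θ, so on a pencil of θ the determinant is a binary quadratic form, with a
nontrivial zero over ℂ. -/
theorem hasRankOne_of_two_by_two (hA : finrank ℂ A = 3) (hB : finrank ℂ B = 3)
    (hR : 2 ≤ finrank ℂ R) {a : A} (ha : a ≠ 0) (hca : c a = 0) {b : B} (hb : b ≠ 0)
    (hcb : c.flip b = 0) : HasRankOne β c := by
  obtain ⟨e, rfl⟩ := exists_basis_eq hA ha
  obtain ⟨f, rfl⟩ := exists_basis_eq hB hb
  have hcb' : ∀ a, c a (f 0) = 0 := fun a => LinearMap.congr_fun hcb a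
  let N : Fin 3 → Fin 3 → R → ℂ := fun i j θ => β θ (c (e i) (f j))
  suffices h : ∃ θ : R, θ ≠ 0 ∧ N 1 1 θ * N 2 2 θ = N 1 2 θ * N 2 1 θ by
    obtain ⟨θ, hθ, hdet⟩ := h
    obtain ⟨x₁, x₂, y₁, y₂, h1, h2, h3, h4⟩ := exists_eq_mul_of_det_eq_zero hdet
    refine ⟨θ, hθ, x₁ • e.coord 1 + x₂ • e.coord 2, y₁ • f.coord 1 + y₂ • f.coord 2,
      fun a b => ?_⟩
    conv_lhs => rw [← e.sum_repr a, ← f.sum_repr b]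
    simp only [Fin.sum_univ_three, map_add, map_smul, LinearMap.add_apply, LinearMap.smul_apply,
      hca, hcb', LinearMap.zero_apply, smul_eq_mul, Basis.coord_apply, map_zero]
    simp only [N] at h1 h2 h3 h4
    rw [h1, h2, h3, h4]
    ring
  obtain ⟨θ, hli⟩ := exists_linearIndependent_of_le_finrank hR
  have hN : ∀ i j x y, N i j (x • θ 0 + y • θ 1) = x * N i j (θ 0) + y * N i j (θ 1) :=
    fun i j x y => by simp [N]
  have hne : ∀ x y : ℂ, x ≠ 0 ∨ y ≠ 0 → x • θ 0 + y • θ 1 ≠ 0 := by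
    intro x y hxy h
    have := Fintype.linearIndependent_iff.1 hli ![x, y] (by simpa using h)
    rcases hxy with hx | hy
    · exact hx (this 0)
    · exact hy (this 1)
  let p : ℂ := N 1 1 (θ 0) * N 2 2 (θ 0) - N 1 2 (θ 0) * N 2 1 (θ 0)
  by_cases hp : p = 0
  · exact ⟨θ 0, hli.ne_zero 0, sub_eq_zero.1 hp⟩
  let q : ℂ := N 1 1 (θ 0) * N 2 2 (θ 1) + N 1 1 (θ 1) * N 2 2 (θ 0) -
    N 1 2 (θ 0) * N 2 1 (θ 1) - N 1 2 (θ 1) * N 2 1 (θ 0)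
  let r : ℂ := N 1 1 (θ 1) * N 2 2 (θ 1) - N 1 2 (θ 1) * N 2 1 (θ 1)
  obtain ⟨s, hs⟩ := IsAlgClosed.exists_eq_mul_self (discrim p q r)
  obtain ⟨x, hx⟩ := exists_quadratic_eq_zero hp ⟨s, hs⟩
  refine ⟨x • θ 0 + (1 : ℂ) • θ 1, hne _ _ (Or.inr one_ne_zero), ?_⟩
  simp only [hN]
  simp only [p, q, r] at hx
  linear_combination hx

/-- The main linear algebra fact: a nondegenerate symmetric form on a space `R` of dimension at
most `3` and a map `c : A × B → R` such that `β (c a b) (c a' b')` is symmetric in `b`, `b'` give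
a form of rank one. -/
theorem hasRankOne_of_finrank_le (hA : finrank ℂ A = 3) (hB : finrank ℂ B = 3)
    (hR : finrank ℂ R ≤ 3) [Nontrivial R] (hβ : ∀ x y, β x y = β y x)
    (hspan : ∀ x, (∀ a b, β x (c a b) = 0) → x = 0)
    (hc : ∀ a b a' b', β (c a b) (c a' b') = β (c a b') (c a' b)) : HasRankOne β c := by
  have hnd : ∀ x, (∀ y, β x y = 0) → x = 0 := fun x hx => hspan x fun a b => hx _
  have hc' : ∀ b a b' a', β (c.flip b a) (c.flip b' a') = β (c.flip b a') (c.flip b' a) :=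
    fun b a b' a' => by
      simp only [LinearMap.flip_apply]
      rw [hc, hβ]
  by_contra hno
  obtain ⟨a, b, hab⟩ : ∃ a b, c a b ≠ 0 := by
    by_contra h
    push Not at h
    obtain ⟨x, hx⟩ := exists_ne (0 : R)
    exact hx (hspan x fun a b => by rw [h, map_zero])
  have hbne : c.flip b ≠ 0 := fun h => hab (LinearMap.congr_fun h a)
  have hane : c a ≠ 0 := fun h => hab (LinearMap.congr_fun h b)
  -- Slices of rank one and of rank three are already settled, so under `hno` this nonzero slice has
  -- rank exactly two.
  have hLb : finrank ℂ (LinearMap.range (c.flip b)) = 2 := by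
    have h1 : ¬ finrank ℂ (LinearMap.range (c.flip b)) ≤ 1 := fun h =>
      hno (hasRankOne_of_finrank_range_le_one hc hbne h)
    have h2 : finrank ℂ (LinearMap.range (c.flip b)) ≠ 3 := fun h => by
      have h3 := Submodule.finrank_le (LinearMap.range (c.flip b))
      have h4 : finrank ℂ R = 3 := by omega
      refine hno (hasRankOne_of_bijective hnd hc (b := b) ?_)
      have hsur : Function.Surjective (c.flip b) := by
        rw [← LinearMap.range_eq_top]
        exact Submodule.eq_top_of_finrank_eq (by omega)
      exact ⟨(LinearMap.injective_iff_surjective_of_finrank_eq_finrank (by omega)).2 hsur, hsur⟩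
    have h3 := Submodule.finrank_le (LinearMap.range (c.flip b))
    omega
  have hMa : finrank ℂ (LinearMap.range (c.flip.flip a)) = 2 := by
    have h1 : ¬ finrank ℂ (LinearMap.range (c.flip.flip a)) ≤ 1 := fun h =>
      hno (hasRankOne_of_finrank_range_le_one hc' hane h).of_flip
    have h2 : finrank ℂ (LinearMap.range (c.flip.flip a)) ≠ 3 := fun h => by
      have h3 := Submodule.finrank_le (LinearMap.range (c.flip.flip a))
      have h4 : finrank ℂ R = 3 := by omega
      refine hno (hasRankOne_of_bijective hnd hc' (b := a) ?_).of_flip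
      have hsur : Function.Surjective (c.flip.flip a) := by
        rw [← LinearMap.range_eq_top]
        exact Submodule.eq_top_of_finrank_eq (by omega)
      exact ⟨(LinearMap.injective_iff_surjective_of_finrank_eq_finrank (by omega)).2 hsur, hsur⟩
    have h3 := Submodule.finrank_le (LinearMap.range (c.flip.flip a))
    omega
  -- A slice vanishes in each direction, which leaves the 2×2 case.
  obtain ⟨a₀, ha₀, hca₀⟩ := (exists_slice_eq_zero hA hR hβ hnd hc hLb).resolve_left hno
  obtain ⟨b₀, hb₀, hcb₀⟩ := (exists_slice_eq_zero hB hR hβ hnd hc' hMa).resolve_left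
    fun h => hno h.of_flip
  have h2 : 2 ≤ finrank ℂ R := hLb ▸ Submodule.finrank_le _
  exact hno (hasRankOne_of_two_by_two hA hB h2 ha₀ hca₀ hb₀ hcb₀)

end RankOne

/-! ### Quadrics through the cone of decomposable vectors are tangent quadrics. -/

section ConeQuadrics

variable {V : Type*} [AddCommGroup V] [Module ℂ V] [FiniteDimensional ℂ V]
  {U₀ Uinf : Submodule ℂ V}
  (hU : IsCompl U₀ Uinf) (u : Basis (Fin 3) ℂ U₀) (w : Basis (Fin 3) ℂ Uinf)

/-- The quadratic form `t ↦ ω(dφ(t), t)` on a subspace of `T_{U₀}`. -/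
def tangentForm (S : Submodule ℂ (W3 V)) (hS : S ≤ TSub U₀) :
    (U₀ →ₗ[ℂ] Uinf) →ₗ[ℂ] SymForms S where
  toFun φ := ⟨(omega hU u w ∘ₗ derU hU φ).compl₁₂ S.subtype S.subtype, fun x y =>
    omega_derU_symm hU u w φ (hS x.2) (hS y.2)⟩
  map_add' φ ψ := by
    refine SymForms.ext fun x y => ?_
    change omega hU u w (derU hU (φ + ψ) x) y = omega hU u w (derU hU φ x) y +
      omega hU u w (derU hU ψ x) y
    rw [map_add, LinearMap.add_apply, map_add, LinearMap.add_apply]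
  map_smul' r φ := by
    refine SymForms.ext fun x y => ?_
    change omega hU u w (derU hU (r • φ) x) y = r * omega hU u w (derU hU φ x) y
    rw [map_smul, LinearMap.smul_apply, map_smul]; rfl

theorem tangentForm_hom (S : Submodule ℂ (W3 V)) (hS : S ≤ TSub U₀) (φ : U₀ →ₗ[ℂ] Uinf) (x y : S) :
    (tangentForm hU u w S hS φ).hom x y = omega hU u w (derU hU φ x) y := rfl

/-- The linear map `U₀ → U_∞` with a given matrix. -/
def ofMatrix (f : Fin 3 → Fin 3 → ℂ) : U₀ →ₗ[ℂ] Uinf := u.constr ℂ fun a => ∑ b, f a b • w b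

theorem repr_ofMatrix (f : Fin 3 → Fin 3 → ℂ) :
    (fun a b => w.repr (ofMatrix u w f (u a)) b) = f := by
  funext a b
  simp [ofMatrix, Finsupp.single_apply]

theorem fin3_arith (i : Fin 3) : i + 1 + 1 = i + 2 ∧ i + 1 + 2 = i ∧ i + 2 + 1 = i ∧
    i + 2 + 2 = i + 1 ∧ i ≠ i + 1 ∧ i ≠ i + 2 ∧ i + 1 ≠ i + 2 := by
  revert i; decide

theorem fin3_cases (i k : Fin 3) : k = i ∨ k = i + 1 ∨ k = i + 2 := by
  revert i k; decide

/-- Antisymmetry in the column indices and symmetry under exchange of pairs force antisymmetry in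
the row indices, so the array is determined by nine values, one for each 2×2 minor. -/
theorem coefG_eq (f : Fin 3 → Fin 3 → ℂ) (g : Fin 3 → Fin 3 → Fin 3 → Fin 3 → ℂ)
    (hf : ∀ a b, f a b = g (a + 1) (b + 1) (a + 2) (b + 2))
    (hsymm : ∀ i j k l, g i j k l = g k l i j) (hswap : ∀ i j k l, g i j k l = -g i l k j)
    (i j k l : Fin 3) : g i j k l = coefG f i j k l := by
  have hjj : ∀ i j k, g i j k j = 0 := fun i j k => self_eq_neg.1 (hswap i j k j)
  have hii : ∀ i j l, g i j i l = 0 := fun i j l => by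
    have h1 := hswap i j i l
    rw [hsymm i l i j] at h1
    exact self_eq_neg.1 h1
  obtain ⟨i1, i2, i3, i4, i5, i6, i7⟩ := fin3_arith i
  obtain ⟨j1, j2, j3, j4, j5, j6, j7⟩ := fin3_arith j
  rw [coefG, sum_mul_sg]
  simp only [sum_mul_sg, hf]
  rcases fin3_cases i k with rfl | rfl | rfl <;> rcases fin3_cases j l with rfl | rfl | rfl
  · simp [hjj, i5, i6]
  · simp [hii, i5, i6]
  · simp [hii, i5, i6]
  · simp [hjj, i7, j5, j6]
  · simp [i7, j7, i3, i4, j3, j4]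
  · simp only [i7, if_true, if_false, j7.symm, sub_zero, i3, i4, j1, j2, zero_sub]
    rw [hswap]
  · simp [hjj, i7.symm, j5, j6]
  · simp only [i7.symm, if_true, if_false, j7, sub_zero, i1, i2, j3, j4, zero_sub]
    rw [hsymm, hswap]
  · simp only [i7.symm, if_true, if_false, j7.symm, i1, i2, j1, j2, zero_sub, neg_neg]
    rw [hsymm]

/-- The quadrics that contain the cone of decomposable vectors of `T_{U₀}` are the tangent ones. -/
theorem exists_tangentForm_eq (B : SymForms (TSub U₀)) (hB : B ∈ conequadrics U₀) :
    ∃ φ, tangentForm hU u w (TSub U₀) le_rfl φ = B := by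
  let e : Option (Fin 3 × Fin 3) → TSub U₀ := fun α => ⟨eT u w α, eT_mem u w α⟩
  have hdec : ∀ (c : ℂ) (x y : Fin 3 → ℂ),
      B.hom (c • e none + ∑ i, ∑ j, (x i * y j) • e (some (i, j)))
        (c • e none + ∑ i, ∑ j, (x i * y j) • e (some (i, j))) = 0 := by
    intro c x y
    set t := c • e none + ∑ i, ∑ j, (x i * y j) • e (some (i, j)) with ht
    obtain ⟨v, hv⟩ := exists_wedge3_of_rank_one u w c x y
    have htv : (t : W3 V) = wedge3 v := by
      rw [hv, ht]; simp [e]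
    by_cases h0 : t = 0
    · rw [h0]; simp
    · exact hB t ⟨fun h => h0 (Subtype.ext h), v, htv⟩
  let g : Fin 3 → Fin 3 → Fin 3 → Fin 3 → ℂ := fun i j k l =>
    B.hom (e (some (i, j))) (e (some (k, l)))
  have hsymm : ∀ i j k l, g i j k l = g k l i j := fun i j k l => B.symm _ _
  have hexp : ∀ x y : Fin 3 → ℂ,
      ∑ i, ∑ j, ∑ k, ∑ l, (x i * y j) * ((x k * y l) * g i j k l) = 0 := by
    intro x y
    have h := hdec 0 x y
    have h0 : ∑ i, ∑ j, ∑ k, ∑ l, (x i * y j) * ((x k * y l) * g k l i j) = 0 := by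
      simpa [LinearMap.sum_apply, Finset.mul_sum, g] using h
    rw [← h0]
    refine Finset.sum_congr rfl fun i _ => Finset.sum_congr rfl fun j _ =>
      Finset.sum_congr rfl fun k _ => Finset.sum_congr rfl fun l _ => ?_
    rw [hsymm]
  -- The vertex is decomposable, and so is its sum with a rank-one vector: every value of B that
  -- involves the vertex vanishes.
  have hnn : B.hom (e none) (e none) = 0 := by
    have := hdec 1 0 0
    simpa using this
  have hnone : ∀ i j, B.hom (e none) (e (some (i, j))) = 0 := by
    intro i j
    have hs : ∑ i', ∑ j', ((Pi.single i 1 : Fin 3 → ℂ) i' * (Pi.single j 1 : Fin 3 → ℂ) j') •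
        e (some (i', j')) = e (some (i, j)) := by
      simp [Pi.single_apply, ite_smul]
    have h1 := hdec 1 (Pi.single i 1) (Pi.single j 1)
    have h2 := hdec 0 (Pi.single i 1) (Pi.single j 1)
    rw [hs] at h1 h2
    rw [zero_smul, zero_add] at h2
    simp only [one_smul, map_add, LinearMap.add_apply, hnn, h2, zero_add, add_zero] at h1
    rw [B.symm (e (some (i, j))) (e none), ← two_mul] at h1
    simpa using h1
  have hswap : ∀ i j k l, g i j k l = -g i l k j := by
    -- Polarization of the vanishing on rank-one matrices, separately in the row vector and in the
    -- column vector.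
    have hpol : ∀ (x x' y y' : Fin 3 → ℂ),
        ∑ i, ∑ j, ∑ k, ∑ l, (x i * y j) * ((x' k * y' l) * g i j k l) +
        ∑ i, ∑ j, ∑ k, ∑ l, (x i * y' j) * ((x' k * y l) * g i j k l) +
        (∑ i, ∑ j, ∑ k, ∑ l, (x' i * y j) * ((x k * y' l) * g i j k l) +
        ∑ i, ∑ j, ∑ k, ∑ l, (x' i * y' j) * ((x k * y l) * g i j k l)) = 0 := by
      intro x x' y y'
      have h1 := hexp (x + x') (y + y')
      have h2 := hexp (x + x') y
      have h3 := hexp (x + x') y'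
      have h4 := hexp x (y + y')
      have h5 := hexp x' (y + y')
      have h6 := hexp x y
      have h7 := hexp x' y
      have h8 := hexp x y'
      have h9 := hexp x' y'
      simp only [Pi.add_apply, add_mul, mul_add, Finset.sum_add_distrib] at h1 h2 h3 h4 h5
      linear_combination h1 - h2 - h3 - h4 - h5 + h6 + h7 + h8 + h9
    have hs : ∀ i j k l : Fin 3, ∑ i', ∑ j', ∑ k', ∑ l', ((Pi.single i 1 : Fin 3 → ℂ) i' *
        (Pi.single j 1 : Fin 3 → ℂ) j') * (((Pi.single k 1 : Fin 3 → ℂ) k' *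
        (Pi.single l 1 : Fin 3 → ℂ) l') * g i' j' k' l') = g i j k l := by
      intro i j k l
      simp [Pi.single_apply]
    intro i j k l
    have h := hpol (Pi.single i 1) (Pi.single k 1) (Pi.single j 1) (Pi.single l 1)
    rw [hs, hs, hs, hs, hsymm k j i l, hsymm k l i j] at h
    linear_combination (1 / 2 : ℂ) * h
  let f : Fin 3 → Fin 3 → ℂ := fun a b => g (a + 1) (b + 1) (a + 2) (b + 2)
  refine ⟨ofMatrix u w f, SymForms.ext fun t t' => ?_⟩
  rw [tangentForm_hom, omega_derU hU u w _ t.2 t'.2, repr_ofMatrix]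
  simp only [← coefG_eq f g (fun _ _ => rfl) hsymm hswap]
  obtain ⟨c, hc⟩ := eq_smul_add_sum_mT hU u w t.2
  obtain ⟨c', hc'⟩ := eq_smul_add_sum_mT hU u w t'.2
  have ht : t = c • e none + ∑ i, ∑ j, mT hU u w i j t • e (some (i, j)) :=
    Subtype.ext (by rw [hc]; simp [e, ← hc])
  have ht' : t' = c' • e none + ∑ i, ∑ j, mT hU u w i j t' • e (some (i, j)) :=
    Subtype.ext (by rw [hc']; simp [e, ← hc'])
  conv_rhs => rw [ht, ht']
  have hnone' : ∀ i j, B.hom (e (some (i, j))) (e none) = 0 := fun i j => by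
    rw [B.symm, hnone]
  simp [LinearMap.sum_apply, hnn, hnone, hnone', g, mul_assoc, Finset.mul_sum]

theorem tangentForm_mem_conequadrics (φ : U₀ →ₗ[ℂ] Uinf) :
    tangentForm hU u w (TSub U₀) le_rfl φ ∈ conequadrics U₀ := by
  rintro t ⟨-, v, hv⟩
  rw [tangentForm_hom, hv]
  exact omega_derU_decomposable hU u w φ v

/-- This ties the restriction map to deformation theory: Im(r_K) is, up to sign, the image of the
derivative of the family of forms on K when U moves and A₀ is fixed. -/
theorem imR_eq_range (A₀ : Submodule ℂ (W3 V)) :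
    imR A₀ U₀ = LinearMap.range (tangentForm hU u w (A₀ ⊓ TSub U₀) inf_le_right) := by
  ext s
  constructor
  · rintro ⟨⟨B, hB⟩, rfl⟩
    obtain ⟨φ, rfl⟩ := exists_tangentForm_eq hU u w B hB
    exact ⟨φ, rfl⟩
  · rintro ⟨φ, rfl⟩
    exact ⟨⟨_, tangentForm_mem_conequadrics hU u w φ⟩, rfl⟩

end ConeQuadrics

/-! ### Linear forms on Sym²K^∨ as symmetric tensors. -/

section Annihilator

variable {K : Type*} [AddCommGroup K] [Module ℂ K] [FiniteDimensional ℂ K]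

theorem trace_comp_smulRight (P : Dual ℂ K →ₗ[ℂ] K) (α β : Dual ℂ K) :
    LinearMap.trace ℂ K (P ∘ₗ α.smulRight β) = α (P β) := by
  have h : P ∘ₗ α.smulRight β = α.smulRight (P β) := by
    ext x; simp
  rw [h, LinearMap.trace_smulRight]

theorem trace_comp_symOf (P : Dual ℂ K →ₗ[ℂ] K) (hP : ∀ α β : Dual ℂ K, α (P β) = β (P α))
    (α β : Dual ℂ K) : LinearMap.trace ℂ K (P ∘ₗ (symOf α β).hom) = α (P β) := by
  have h : (symOf α β).hom = (2⁻¹ : ℂ) • (α.smulRight β + β.smulRight α) := rfl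
  rw [h, LinearMap.comp_smul, LinearMap.comp_add, map_smul, map_add, trace_comp_smulRight,
    trace_comp_smulRight, hP β α, smul_eq_mul]
  ring

/-- The linear form on symmetric forms given by a tensor. -/
def traceForm (P : Dual ℂ K →ₗ[ℂ] K) : Dual ℂ (SymForms K) where
  toFun s := LinearMap.trace ℂ K (P ∘ₗ s.hom)
  map_add' s t := by
    have h : (s + t).hom = s.hom + t.hom := rfl
    rw [h, LinearMap.comp_add, map_add]
  map_smul' c s := by
    have h : (c • s).hom = c • s.hom := rfl
    rw [h, LinearMap.comp_smul, map_smul]; rfl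

theorem traceForm_apply (P : Dual ℂ K →ₗ[ℂ] K) (s : SymForms K) :
    traceForm P s = LinearMap.trace ℂ K (P ∘ₗ s.hom) := rfl

theorem symOf_add_left (α α' β : Dual ℂ K) : symOf (α + α') β = symOf α β + symOf α' β := by
  refine SymForms.ext fun x y => ?_
  change _ = (symOf α β).hom x y + (symOf α' β).hom x y
  simp only [symOf_hom, LinearMap.add_apply]; ring

theorem symOf_smul_left (c : ℂ) (α β : Dual ℂ K) : symOf (c • α) β = c • symOf α β := by
  refine SymForms.ext fun x y => ?_
  change _ = c * (symOf α β).hom x y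
  simp only [symOf_hom, LinearMap.smul_apply, smul_eq_mul]; ring

theorem symOf_comm (α β : Dual ℂ K) : symOf α β = symOf β α := by
  refine SymForms.ext fun x y => ?_
  simp only [symOf_hom]; ring

/-- Every linear form on symmetric forms is given by a symmetric tensor. -/
theorem exists_traceForm_eq (f : Dual ℂ (SymForms K)) : ∃ P : Dual ℂ K →ₗ[ℂ] K,
    (∀ α β : Dual ℂ K, α (P β) = β (P α)) ∧ traceForm P = f := by
  let p : Dual ℂ K →ₗ[ℂ] Dual ℂ (Dual ℂ K) := LinearMap.mk₂ ℂ (fun α β => f (symOf α β))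
    (fun α α' β => by rw [symOf_add_left, map_add])
    (fun c α β => by rw [symOf_smul_left, map_smul])
    (fun α β β' => by rw [symOf_comm, symOf_add_left, map_add, symOf_comm β, symOf_comm β'])
    (fun c α β => by rw [symOf_comm, symOf_smul_left, map_smul, symOf_comm β])
  let P : Dual ℂ K →ₗ[ℂ] K := (evalEquiv ℂ K).symm.toLinearMap ∘ₗ p
  have hPapp : ∀ α β : Dual ℂ K, α (P β) = f (symOf β α) := fun α β => by
    have h : evalEquiv ℂ K (P β) = p β := (evalEquiv ℂ K).apply_symm_apply (p β)
    have := LinearMap.congr_fun h α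
    exact this
  have hP : ∀ α β : Dual ℂ K, α (P β) = β (P α) := fun α β => by
    rw [hPapp, hPapp, symOf_comm]
  refine ⟨P, hP, ?_⟩
  ext s
  rw [s.eq_sum (finBasis ℂ K)]
  simp only [map_sum, map_smul, traceForm_apply, trace_comp_symOf P hP, hPapp]
  simp only [symOf_comm]

/-- In a basis, a symmetric form is a function on unordered pairs of indices. -/
theorem finrank_symForms : finrank ℂ (SymForms K) = finrank ℂ K * (finrank ℂ K + 1) / 2 := by
  let b := finBasis ℂ K
  let e : SymForms K →ₗ[ℂ] (Sym2 (Fin (finrank ℂ K)) → ℂ) :=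
    { toFun := fun s => Sym2.lift ⟨fun i j => s.hom (b i) (b j), fun i j => s.symm _ _⟩
      map_add' := fun s t => by
        funext z; induction z using Sym2.ind; rfl
      map_smul' := fun c s => by
        funext z; induction z using Sym2.ind; rfl }
  have he : Function.Bijective e := by
    constructor
    · intro s t h
      exact SymForms.ext_basis b fun i j => congrFun h s(i, j)
    · intro f
      refine ⟨⟨Matrix.toLinearMap₂ b b (Matrix.of fun i j => f s(i, j)), fun x y => ?_⟩, ?_⟩
      · have h : Matrix.toLinearMap₂ b b (Matrix.of fun i j => f s(i, j)) =
            (Matrix.toLinearMap₂ b b (Matrix.of fun i j => f s(i, j))).flip := by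
          refine LinearMap.ext_basis b b fun i j => ?_
          rw [LinearMap.flip_apply, Matrix.toLinearMap₂_apply_basis,
            Matrix.toLinearMap₂_apply_basis, Matrix.of_apply, Matrix.of_apply, Sym2.eq_swap]
        exact LinearMap.congr_fun₂ h x y
      · funext z
        induction z using Sym2.ind with
        | _ i j => exact Matrix.toLinearMap₂_apply_basis b b _ i j
  rw [(LinearEquiv.ofBijective e he).finrank_eq, finrank_fintype_fun_eq_card, Sym2.card,
    Fintype.card_fin, Nat.choose_two_right, Nat.add_sub_cancel, mul_comm]

end Annihilator

/-! ### The rank of r_K when A₀ contains no decomposable vector. -/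

section ImageOfRestriction

variable {V : Type*} [AddCommGroup V] [Module ℂ V] [FiniteDimensional ℂ V]
  {U₀ Uinf : Submodule ℂ V}
  (hU : IsCompl U₀ Uinf) (u : Basis (Fin 3) ℂ U₀) (w : Basis (Fin 3) ℂ Uinf)
  {A₀ : Submodule ℂ (W3 V)}

variable (A₀) in
/-- The coordinates `m_{ij}` restricted to `K = A₀ ∩ T_{U₀}`. -/
def mK (i j : Fin 3) : Dual ℂ ↥(A₀ ⊓ TSub U₀) := mT hU u w i j ∘ₗ (A₀ ⊓ TSub U₀).subtype

/-- A vector of T_{U₀} whose 3×3 matrix has rank at most one lies on the cone of decomposable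
vectors, whatever its vertex coordinate. This is how the hypothesis on A₀ enters. -/
theorem eq_zero_of_mK_rank_one (hdec : ∀ x ∈ A₀, ¬ IsDecomposable x) (t : ↥(A₀ ⊓ TSub U₀))
    (x y : Fin 3 → ℂ) (h : ∀ i j, mK hU u w A₀ i j t = x i * y j) : t = 0 := by
  obtain ⟨c, hc⟩ := eq_smul_add_sum_mT hU u w t.2.2
  obtain ⟨v, hv⟩ := exists_wedge3_of_rank_one u w c x y
  by_contra h0
  refine hdec t t.2.1 ⟨fun h1 => h0 (Subtype.ext h1), v, ?_⟩
  rw [hv]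
  simp only [← h]
  exact hc

theorem sum_sum_mul_sg (F : Fin 3 → Fin 3 → ℂ) (a : Fin 3) :
    ∑ i, ∑ k, F i k * sg a i k = F (a + 1) (a + 2) - F (a + 2) (a + 1) := by
  simp only [Fin.sum_univ_three]
  fin_cases a <;> simp +decide [sg] <;> ring

theorem trace_tangentForm (P : Dual ℂ ↥(A₀ ⊓ TSub U₀) →ₗ[ℂ] ↥(A₀ ⊓ TSub U₀))
    (φ : U₀ →ₗ[ℂ] Uinf) :
    traceForm P (tangentForm hU u w (A₀ ⊓ TSub U₀) inf_le_right φ) =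
      ∑ i, ∑ j, ∑ k, ∑ l, coefG (fun a b => w.repr (φ (u a)) b) i j k l *
        mK hU u w A₀ i j (P (mK hU u w A₀ k l)) := by
  have h : (tangentForm hU u w (A₀ ⊓ TSub U₀) inf_le_right φ).hom =
      ∑ i, ∑ j, ∑ k, ∑ l, coefG (fun a b => w.repr (φ (u a)) b) i j k l •
        (mK hU u w A₀ i j).smulRight (mK hU u w A₀ k l) := by
    refine LinearMap.ext₂ fun x y => ?_
    rw [tangentForm_hom, omega_derU hU u w φ x.2.2 y.2.2]
    simp only [LinearMap.sum_apply, LinearMap.smul_apply, LinearMap.smulRight_apply, smul_eq_mul]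
    refine Finset.sum_congr rfl fun i _ => Finset.sum_congr rfl fun j _ =>
      Finset.sum_congr rfl fun k _ => Finset.sum_congr rfl fun l _ => ?_
    rw [mul_comm]
    rfl
  let T : (↥(A₀ ⊓ TSub U₀) →ₗ[ℂ] Dual ℂ ↥(A₀ ⊓ TSub U₀)) →ₗ[ℂ] ℂ :=
    LinearMap.trace ℂ _ ∘ₗ LinearMap.llcomp ℂ _ _ _ P
  have hT : ∀ α β : Dual ℂ ↥(A₀ ⊓ TSub U₀), T (α.smulRight β) = α (P β) := trace_comp_smulRight P
  change T _ = _
  rw [h]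
  simp only [map_sum, map_smul, hT, smul_eq_mul]

/-- Killing Im(r_K) means pairing to zero with each 2×2 minor of (m_{ij}), so exchanging two column
indices does not change the values of P. -/
theorem tensor_swap (P : Dual ℂ ↥(A₀ ⊓ TSub U₀) →ₗ[ℂ] ↥(A₀ ⊓ TSub U₀))
    (hP : ∀ α β : Dual ℂ ↥(A₀ ⊓ TSub U₀), α (P β) = β (P α))
    (hkill : ∀ s ∈ imR A₀ U₀, traceForm P s = 0) (i j k l : Fin 3) :
    mK hU u w A₀ i j (P (mK hU u w A₀ k l)) = mK hU u w A₀ i l (P (mK hU u w A₀ k j)) := by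
  let p : Fin 3 → Fin 3 → Fin 3 → Fin 3 → ℂ := fun i j k l =>
    mK hU u w A₀ i j (P (mK hU u w A₀ k l))
  have hsymm : ∀ i j k l, p i j k l = p k l i j := fun i j k l => hP _ _
  have hab : ∀ a b, p (a + 1) (b + 1) (a + 2) (b + 2) = p (a + 1) (b + 2) (a + 2) (b + 1) := by
    intro a b
    -- The elementary matrix at (a, b) selects one minor.
    let f : Fin 3 → Fin 3 → ℂ := fun a' b' => if a' = a then (if b' = b then 1 else 0) else 0
    have h1 := hkill _ (by
      rw [imR_eq_range hU u w]; exact ⟨ofMatrix u w f, rfl⟩)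
    rw [trace_tangentForm, repr_ofMatrix] at h1
    have h2 : ∀ i j k l, coefG f i j k l = sg b j l * sg a i k := fun i j k l => by
      rw [coefG, Finset.sum_eq_single a, Finset.sum_eq_single b]
      · simp [f]
      · intro b' _ hb'; simp [f, hb']
      · simp
      · intro a' _ ha'; simp [f, ha']
      · simp
    have h3 : ∀ i, ∑ j, ∑ k, ∑ l, coefG f i j k l * p i j k l =
        ∑ k, (∑ j, ∑ l, p i j k l * sg b j l) * sg a i k := fun i => by
      rw [Finset.sum_comm]
      refine Finset.sum_congr rfl fun k _ => ?_
      simp only [Finset.sum_mul]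
      refine Finset.sum_congr rfl fun j _ => Finset.sum_congr rfl fun l _ => ?_
      rw [h2]; ring
    have h4 : ∑ i, ∑ j, ∑ k, ∑ l, coefG f i j k l * p i j k l = 0 := h1
    simp only [h3, sum_sum_mul_sg] at h4
    rw [hsymm (a + 2) (b + 1), hsymm (a + 2) (b + 2)] at h4
    linear_combination (1 / 2 : ℂ) * h4
  change p i j k l = p i l k j
  obtain ⟨i1, i2, i3, i4, -⟩ := fin3_arith i
  obtain ⟨j1, j2, j3, j4, -⟩ := fin3_arith j
  rcases fin3_cases i k with rfl | rfl | rfl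
  · exact hsymm _ _ _ _
  · rcases fin3_cases j l with rfl | rfl | rfl
    · rfl
    · have := hab (i + 2) (j + 2)
      rwa [i3, i4, j3, j4] at this
    · have := hab (i + 2) (j + 1)
      rw [i3, i4, j1, j2] at this
      exact this.symm
  · rcases fin3_cases j l with rfl | rfl | rfl
    · rfl
    · have := hab (i + 1) (j + 2)
      rw [i1, i2, j3, j4] at this
      rw [hsymm, hsymm i (j + 1), this]
    · have := hab (i + 1) (j + 1)
      rw [i1, i2, j1, j2] at this
      rw [hsymm, hsymm i (j + 2), this]

/-- A symmetric tensor on `K` of rank at most `3` that annihilates the image of `r_K` is zero. -/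
theorem tensor_eq_zero (hU : IsCompl U₀ Uinf) (u : Basis (Fin 3) ℂ U₀) (w : Basis (Fin 3) ℂ Uinf)
    (hdec : ∀ x ∈ A₀, ¬ IsDecomposable x)
    (P : Dual ℂ ↥(A₀ ⊓ TSub U₀) →ₗ[ℂ] ↥(A₀ ⊓ TSub U₀))
    (hP : ∀ α β : Dual ℂ ↥(A₀ ⊓ TSub U₀), α (P β) = β (P α))
    (hkill : ∀ s ∈ imR A₀ U₀, traceForm P s = 0)
    (hrank : finrank ℂ (LinearMap.range P) ≤ 3) : P = 0 := by
  by_contra hP0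
  -- On a complement C of ker P, of dimension rank P ≤ 3, the symmetric form β(x, y) = x(P y) is
  -- nondegenerate. The map c projects the forms Σ aᵢ bⱼ m_{ij} to C, and `tensor_swap` becomes the
  -- symmetry required by `hasRankOne_of_finrank_le`.
  obtain ⟨C, hC⟩ := Submodule.exists_isCompl (LinearMap.ker P)
  have hPinj : ∀ x ∈ C, P x = 0 → x = 0 := fun x hx h =>
    Submodule.disjoint_def.1 hC.disjoint x h hx
  have hproj : ∀ x, P (C.projectionOnto (LinearMap.ker P) hC.symm x) = P x := fun x => by
    have h := Submodule.projectionOnto_apply_eq_zero_iff hC.symm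
      (x := x - (C.projectionOnto (LinearMap.ker P) hC.symm x : Dual ℂ ↥(A₀ ⊓ TSub U₀)))
    have h2 := h.1 (by rw [map_sub, Submodule.projectionOnto_apply_left, sub_self])
    rw [LinearMap.mem_ker, map_sub, sub_eq_zero] at h2
    exact h2.symm
  let m := mK hU u w A₀
  let k : (Fin 3 → ℂ) →ₗ[ℂ] (Fin 3 → ℂ) →ₗ[ℂ] Dual ℂ ↥(A₀ ⊓ TSub U₀) :=
    LinearMap.mk₂ ℂ (fun a b => ∑ i, ∑ j, (a i * b j) • m i j)
      (fun a a' b => by simp [add_mul, add_smul, Finset.sum_add_distrib])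
      (fun r a b => by simp [mul_assoc, mul_smul, Finset.smul_sum])
      (fun a b b' => by simp [mul_add, add_smul, Finset.sum_add_distrib])
      (fun r a b => by simp [mul_left_comm, mul_smul, Finset.smul_sum])
  have hk : ∀ a b, k a b = ∑ i, ∑ j, (a i * b j) • m i j := fun _ _ => rfl
  have hk1 : ∀ i j, k (Pi.single i 1) (Pi.single j 1) = m i j := fun i j => by
    simp [hk, Pi.single_apply, ite_smul]
  let c : (Fin 3 → ℂ) →ₗ[ℂ] (Fin 3 → ℂ) →ₗ[ℂ] C :=
    k.compr₂ (C.projectionOnto (LinearMap.ker P) hC.symm)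
  have hPc : ∀ a b, P (c a b) = P (k a b) := fun a b => hproj _
  let β : C →ₗ[ℂ] C →ₗ[ℂ] ℂ := LinearMap.mk₂ ℂ (fun x y => x.1 (P y))
    (fun _ _ _ => rfl) (fun _ _ _ => rfl) (fun x y z => by simp) (fun r x y => by simp)
  have hβ : ∀ x y, β x y = x.1 (P y) := fun _ _ => rfl
  have hβc : ∀ x a b, β x (c a b) = k a b (P x) := fun x a b => by
    rw [hβ, hPc, hP]
  have hrank1 : HasRankOne β c := by
    have hfin : finrank ℂ C = finrank ℂ (LinearMap.range P) := by
      have h1 := Submodule.finrank_add_eq_of_isCompl hC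
      have h2 := LinearMap.finrank_range_add_finrank_ker P
      omega
    have hnt : Nontrivial C := by
      apply Module.nontrivial_of_finrank_pos (R := ℂ)
      rw [hfin, Module.finrank_pos_iff, Submodule.nontrivial_iff_ne_bot]
      exact fun h => hP0 (LinearMap.range_eq_bot.1 h)
    refine hasRankOne_of_finrank_le (by simp) (by simp) (by omega) (fun x y => hP _ _) ?_ ?_
    -- If β(x, c a b) is always zero, all m_{ij} vanish on P x, so P x is a multiple of the vertex.
    -- The vertex is decomposable, hence P x = 0.
    · intro x hx
      apply Subtype.ext
      refine hPinj x x.2 (eq_zero_of_mK_rank_one hU u w hdec _ 0 0 fun i j => ?_)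
      have := hx (Pi.single i 1) (Pi.single j 1)
      rw [hβc, hk1] at this
      simpa using this
    · intro a b a' b'
      have key : ∀ a b a' b', β (c a b) (c a' b') = ∑ i, ∑ j, ∑ k, ∑ l,
          (a i * b j) * ((a' k * b' l) * m k l (P (m i j))) := fun a b a' b' => by
        rw [hβc, hPc, hk, hk]
        simp only [map_sum, map_smul, LinearMap.sum_apply, LinearMap.smul_apply, smul_eq_mul,
          Finset.mul_sum]
      rw [key, key]
      refine Finset.sum_congr rfl fun i _ => ?_
      conv_rhs => rw [Finset.sum_comm]
      rw [Finset.sum_comm]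
      refine Finset.sum_congr rfl fun k _ => ?_
      rw [Finset.sum_comm]
      refine Finset.sum_congr rfl fun j _ => Finset.sum_congr rfl fun l _ => ?_
      change _ * (_ * mK hU u w A₀ _ _ (P (mK hU u w A₀ _ _))) =
        _ * (_ * mK hU u w A₀ _ _ (P (mK hU u w A₀ _ _)))
      rw [tensor_swap hU u w P hP hkill k j i l]
      ring
  obtain ⟨θ, hθ, α, γ, H⟩ := hrank1
  apply hθ
  apply Subtype.ext
  -- Rank one for θ says that the matrix of P θ ∈ K is an outer product, so P θ = 0, against θ ≠ 0
  -- in C.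
  refine hPinj θ θ.2 (eq_zero_of_mK_rank_one hU u w hdec _ (fun i => α (Pi.single i 1))
    (fun j => γ (Pi.single j 1)) fun i j => ?_)
  rw [← H, hβc, hk1]

/-- If `dim K ≤ 3`, the map `r_K` is surjective. -/
theorem imR_eq_top (hU : IsCompl U₀ Uinf) (u : Basis (Fin 3) ℂ U₀) (w : Basis (Fin 3) ℂ Uinf)
    (hdec : ∀ x ∈ A₀, ¬ IsDecomposable x) (hK : finrank ℂ ↥(A₀ ⊓ TSub U₀) ≤ 3) :
    imR A₀ U₀ = ⊤ := by
  by_contra h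
  obtain ⟨f, hf0, hf⟩ := Submodule.exists_le_ker_of_lt_top _ (lt_top_iff_ne_top.2 h)
  obtain ⟨P, hP, rfl⟩ := exists_traceForm_eq f
  apply hf0
  have := tensor_eq_zero hU u w hdec P hP (fun s hs => hf hs)
    ((Submodule.finrank_le _).trans hK)
  subst this
  ext s
  simp [traceForm_apply]

/-- If `dim K = 4`, the image of `r_K` is the hyperplane defined by a tensor of rank `4`. -/
theorem exists_imR_eq_hyperplane (hU : IsCompl U₀ Uinf) (u : Basis (Fin 3) ℂ U₀)
    (w : Basis (Fin 3) ℂ Uinf) (hdec : ∀ x ∈ A₀, ¬ IsDecomposable x)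
    (hK : finrank ℂ ↥(A₀ ⊓ TSub U₀) = 4) :
    ∃ P : Dual ℂ ↥(A₀ ⊓ TSub U₀) →ₗ[ℂ] ↥(A₀ ⊓ TSub U₀),
      (∀ α β : Dual ℂ ↥(A₀ ⊓ TSub U₀), α (P β) = β (P α)) ∧ Function.Bijective P ∧
        imR A₀ U₀ = LinearMap.ker (traceForm P) := by
  have hdim : finrank ℂ (Dual ℂ ↥(A₀ ⊓ TSub U₀)) = finrank ℂ ↥(A₀ ⊓ TSub U₀) :=
    Subspace.dual_finrank_eq
  -- A nonzero tensor that kills Im(r_K) cannot have rank at most 3, so it has rank 4.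
  have hbij : ∀ P : Dual ℂ ↥(A₀ ⊓ TSub U₀) →ₗ[ℂ] ↥(A₀ ⊓ TSub U₀), P ≠ 0 →
      (∀ α β : Dual ℂ ↥(A₀ ⊓ TSub U₀), α (P β) = β (P α)) →
      (∀ s ∈ imR A₀ U₀, traceForm P s = 0) → Function.Bijective P := by
    intro P h0 hP hkill
    have hs : Function.Surjective P := by
      rw [← LinearMap.range_eq_top]
      apply Submodule.eq_top_of_finrank_eq
      by_contra hne
      refine h0 (tensor_eq_zero hU u w hdec P hP hkill ?_)
      have := (LinearMap.range P).finrank_le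
      omega
    exact ⟨(LinearMap.injective_iff_surjective_of_finrank_eq_finrank hdim).2 hs, hs⟩
  -- Im(r_K) is an image of the 9-dimensional space Hom(U₀, U_∞), while Sym²K^∨ has dimension 10.
  have hlt : imR A₀ U₀ < ⊤ := by
    rw [lt_top_iff_ne_top]
    intro h
    have h1 : finrank ℂ (imR A₀ U₀) ≤ 9 := by
      rw [imR_eq_range hU u w]
      refine (LinearMap.finrank_range_le _).trans ?_
      rw [Module.finrank_linearMap, finrank_eq_card_basis u, finrank_eq_card_basis w]
      simp
    rw [h, finrank_top, finrank_symForms, hK] at h1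
    omega
  obtain ⟨f, hf0, hf⟩ := Submodule.exists_le_ker_of_lt_top _ hlt
  obtain ⟨P, hP, rfl⟩ := exists_traceForm_eq f
  have h0 : P ≠ 0 := by
    rintro rfl
    exact hf0 (by ext s; simp [traceForm_apply])
  have hPb := hbij P h0 hP fun s hs => hf hs
  refine ⟨P, hP, hPb, le_antisymm hf fun s hs => ?_⟩
  by_contra hs'
  obtain ⟨f', hf's, hf'⟩ := Submodule.exists_le_ker_of_notMem hs'
  obtain ⟨P', hP', rfl⟩ := exists_traceForm_eq f'
  let e := LinearEquiv.ofBijective P hPb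
  have : Nontrivial (Dual ℂ ↥(A₀ ⊓ TSub U₀)) := by
    apply Module.nontrivial_of_finrank_pos (R := ℂ); omega
  -- For an eigenvalue c of P⁻¹P', the tensor P' − cP is singular and still kills Im(r_K), so it is
  -- zero. Hence the annihilator is the line of P.
  obtain ⟨c, hc⟩ := Module.End.exists_eigenvalue (e.symm.toLinearMap ∘ₗ P')
  obtain ⟨v, hv, hv0⟩ := hc.exists_hasEigenvector
  rw [Module.End.mem_eigenspace_iff] at hv
  have hv' : P' v = c • P v := by
    have := congrArg e hv
    rw [map_smul, LinearMap.comp_apply] at this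
    exact (e.apply_symm_apply _).symm.trans this
  have hlin : ∀ s, traceForm (P' - c • P) s = traceForm P' s - c * traceForm P s := fun s => by
    simp [traceForm_apply, LinearMap.sub_comp, LinearMap.smul_comp]
  have hz : P' - c • P = 0 := by
    by_contra hne
    have := hbij _ hne (fun α β => by simp [hP α β, hP' α β]) fun t ht => by
      rw [hlin, LinearMap.mem_ker.1 (hf' ht), LinearMap.mem_ker.1 (hf ht)]; simp
    exact hv0 (this.1 (by simp [hv']))
  apply hf's
  have h3 := hlin s
  rw [hz, LinearMap.mem_ker.1 hs] at h3
  simpa [traceForm_apply] using h3.symm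

/-- The dimension of the space of first order deformations of `U₀` along which the form on `K` does
not move. -/
theorem finrank_ker_tangentForm (hdec : ∀ x ∈ A₀, ¬ IsDecomposable x) (ℓ : ℕ) (hℓ4 : ℓ ≤ 4)
    (hK : finrank ℂ ↥(A₀ ⊓ TSub U₀) = ℓ) :
    (finrank ℂ (LinearMap.ker (tangentForm hU u w (A₀ ⊓ TSub U₀) inf_le_right)) : ℤ) =
      max 0 (9 - (ℓ : ℤ) * (ℓ + 1) / 2) := by
  have h := LinearMap.finrank_range_add_finrank_ker
    (tangentForm hU u w (A₀ ⊓ TSub U₀) inf_le_right)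
  rw [← imR_eq_range, Module.finrank_linearMap, finrank_eq_card_basis u,
    finrank_eq_card_basis w] at h
  simp only [Fintype.card_fin] at h
  rcases Nat.lt_or_ge ℓ 4 with h3 | h4
  · rw [imR_eq_top hU u w hdec (by omega), finrank_top, finrank_symForms, hK] at h
    interval_cases ℓ <;> norm_num at h ⊢ <;> omega
  · obtain rfl : ℓ = 4 := by omega
    obtain ⟨P, hP, hPb, hI⟩ := exists_imR_eq_hyperplane hU u w hdec hK
    have h5 := LinearMap.finrank_range_add_finrank_ker (traceForm P)
    rw [← hI, finrank_symForms, hK] at h5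
    have h6 := (LinearMap.range (traceForm P)).finrank_le
    rw [Module.finrank_self] at h6
    -- Here the formula gives 9 − 10 < 0, truncated to 0: the image is a hyperplane of dimension 9,
    -- so the derivative is injective.
    have h7 : max (0 : ℤ) (9 - ((4 : ℕ) : ℤ) * (((4 : ℕ) : ℤ) + 1) / 2) = 0 := by norm_num
    rw [h7]
    omega

end ImageOfRestriction

/-! ### Darboux coordinates adapted to two Lagrangian subspaces. -/

section Symplectic

variable {W : Type*} [AddCommGroup W] [Module ℂ W] [FiniteDimensional ℂ W]
  {ω : W →ₗ[ℂ] W →ₗ[ℂ] ℂ}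

theorem flip_bijective_of_nondegenerate (hanti : ∀ x y, ω x y = -ω y x)
    (hnd : ∀ x, (∀ y, ω x y = 0) → x = 0) : Function.Bijective ω.flip := by
  have hinj : Function.Injective ω.flip := by
    rw [injective_iff_map_eq_zero]
    intro x hx
    refine hnd x fun y => ?_
    rw [hanti, neg_eq_zero]
    exact LinearMap.congr_fun hx y
  exact ⟨hinj, (LinearMap.injective_iff_surjective_of_finrank_eq_finrank
    Subspace.dual_finrank_eq.symm).1 hinj⟩

/-- A Lagrangian A is the kernel of the surjection W → A^∨ given by ω. -/
theorem finrank_of_lagrangian (hanti : ∀ x y, ω x y = -ω y x)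
    (hnd : ∀ x, (∀ y, ω x y = 0) → x = 0) {A : Submodule ℂ W}
    (hA : ∀ x, x ∈ A ↔ ∀ a ∈ A, ω x a = 0) : finrank ℂ A + finrank ℂ A = finrank ℂ W := by
  let F : W →ₗ[ℂ] Dual ℂ A := A.dualRestrict ∘ₗ ω.flip
  have hs : Function.Surjective F :=
    Subspace.dualRestrict_surjective.comp (flip_bijective_of_nondegenerate hanti hnd).2
  have hk : LinearMap.ker F = A := by
    ext x
    rw [hA, LinearMap.mem_ker]
    constructor
    · intro h a ha
      rw [hanti, neg_eq_zero]
      exact LinearMap.congr_fun h ⟨a, ha⟩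
    · intro h
      ext a
      change ω a x = 0
      rw [hanti, h a a.2, neg_zero]
  have h := LinearMap.finrank_range_add_finrank_ker F
  rw [LinearMap.range_eq_top.2 hs, finrank_top, hk, Subspace.dual_finrank_eq] at h
  exact h

/-- Darboux coordinates adapted to two Lagrangian subspaces. -/
theorem exists_adapted_basis (hanti : ∀ x y, ω x y = -ω y x)
    (hnd : ∀ x, (∀ y, ω x y = 0) → x = 0) {A T : Submodule ℂ W}
    (hA : ∀ x, x ∈ A ↔ ∀ a ∈ A, ω x a = 0) (hT : ∀ x, x ∈ T ↔ ∀ t ∈ T, ω x t = 0) {ℓ m : ℕ}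
    (hAd : finrank ℂ A = ℓ + m) (hTd : finrank ℂ T = ℓ + m) (k : Basis (Fin ℓ) ℂ ↥(A ⊓ T)) :
    ∃ (a t : Fin m → W) (f : Fin ℓ → W),
      Submodule.span ℂ (Set.range (Sum.elim (fun i => (k i : W)) a)) = A ∧
      Submodule.span ℂ (Set.range (Sum.elim (fun i => (k i : W)) t)) = T ∧
      (∀ r s, ω (Sum.elim (fun i => (k i : W)) a r) (Sum.elim f t s) = if r = s then 1 else 0) ∧
      (∀ r s, ω (Sum.elim f t r) (Sum.elim f t s) = 0) := by
  obtain ⟨C, hC⟩ := Submodule.exists_isCompl (A ⊓ T)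
  have hK : finrank ℂ ↥(A ⊓ T) = ℓ := by simpa using finrank_eq_card_basis k
  have hsup : ∀ S : Submodule ℂ W, A ⊓ T ≤ S → (A ⊓ T) ⊔ (C ⊓ S) = S := fun S hS => by
    rw [← sup_inf_assoc_of_le _ hS, hC.sup_eq_top, top_inf_eq]
  have hdis : ∀ S : Submodule ℂ W, (A ⊓ T) ⊓ (C ⊓ S) = ⊥ := fun S => by
    rw [← inf_assoc, hC.inf_eq_bot, bot_inf_eq]
  have hdim : ∀ S : Submodule ℂ W, A ⊓ T ≤ S → finrank ℂ S = ℓ + m →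
      finrank ℂ ↥(C ⊓ S) = m := fun S hS h => by
    have h1 := Submodule.finrank_sup_add_finrank_inf_eq (A ⊓ T) (C ⊓ S)
    rw [hsup S hS, hdis, finrank_bot, hK, h] at h1
    omega
  have hTm := hdim T inf_le_right hTd
  have hAm := hdim A inf_le_left hAd
  let pair : ↥(C ⊓ T) →ₗ[ℂ] Dual ℂ ↥(C ⊓ A) := (C ⊓ A).dualRestrict ∘ₗ ω.flip ∘ₗ (C ⊓ T).subtype
  have hpair : ∀ t a, pair t a = ω a t := fun _ _ => rfl
  -- A vector t of C ∩ T orthogonal to C ∩ A is also orthogonal to K, because T is isotropic. So it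
  -- lies in A, hence in C ∩ K = 0. Thus C ∩ A and C ∩ T are in duality.
  have hinj : Function.Injective pair := by
    rw [injective_iff_map_eq_zero]
    rintro ⟨t, htC, htT⟩ h
    apply Subtype.ext
    have htA : t ∈ A := by
      rw [hA]
      intro a ha
      rw [← hsup A inf_le_left] at ha
      obtain ⟨x, hx, y, hy, rfl⟩ := Submodule.mem_sup.1 ha
      rw [map_add, (hT t).1 htT x hx.2, zero_add, hanti, neg_eq_zero]
      exact LinearMap.congr_fun h ⟨y, hy⟩
    exact Submodule.disjoint_def.1 hC.disjoint t ⟨htA, htT⟩ htC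
  let e : ↥(C ⊓ T) ≃ₗ[ℂ] Dual ℂ ↥(C ⊓ A) := LinearEquiv.ofInjectiveOfFinrankEq pair hinj
    (by rw [Subspace.dual_finrank_eq, hAm, hTm])
  let ab : Basis (Fin m) ℂ ↥(C ⊓ A) := finBasisOfFinrankEq ℂ _ hAm
  let tb : Basis (Fin m) ℂ ↥(C ⊓ T) := ab.dualBasis.map e.symm
  have hat : ∀ i j, ω (ab i) (tb j) = if i = j then 1 else 0 := fun i j => by
    have h1 : e (tb j) = ab.dualBasis j := e.apply_symm_apply _
    have h2 : ω (ab i) (tb j) = ab.dualBasis j (ab i) := LinearMap.congr_fun h1 (ab i)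
    rw [h2, Basis.dualBasis_apply_self]
  have hspan : ∀ (S : Submodule ℂ W) (hS : A ⊓ T ≤ S) (b : Basis (Fin m) ℂ ↥(C ⊓ S)),
      Submodule.span ℂ (Set.range (Sum.elim (fun i => (k i : W)) fun i => (b i : W))) = S :=
    fun S hS b => by
    have h1 : ∀ (S' : Submodule ℂ W) {n : ℕ} (b : Basis (Fin n) ℂ S'),
        Submodule.span ℂ (Set.range fun i => (b i : W)) = S' := fun S' n b => by
      have := congrArg (Submodule.map S'.subtype) b.span_eq
      rw [Submodule.map_span, ← Set.range_comp, Submodule.map_top, Submodule.range_subtype] at this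
      exact this
    rw [Set.Sum.elim_range, Submodule.span_union, h1, h1, hsup S hS]
  have hkk : ∀ i j, ω (k i) (k j) = 0 := fun i j => (hA _).1 (k i).2.1 _ (k j).2.1
  have hka : ∀ i j, ω (k i) (ab j) = 0 := fun i j => (hA _).1 (k i).2.1 _ (ab j).2.2
  have hkt : ∀ i j, ω (k i) (tb j) = 0 := fun i j => (hT _).1 (k i).2.2 _ (tb j).2.2
  have haa : ∀ i j, ω (ab i) (ab j) = 0 := fun i j => (hA _).1 (ab i).2.2 _ (ab j).2.2
  have htt : ∀ i j, ω (tb i) (tb j) = 0 := fun i j => (hT _).1 (tb i).2.2 _ (tb j).2.2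
  have hta : ∀ i j, ω (tb i) (ab j) = if j = i then -1 else 0 := fun i j => by
    rw [hanti, hat, apply_ite Neg.neg, neg_zero]
  let v : Fin ℓ ⊕ (Fin m ⊕ Fin m) → W :=
    Sum.elim (fun i => (k i : W)) (Sum.elim (fun i => (ab i : W)) fun i => (tb i : W))
  have hli : LinearIndependent ℂ v := by
    rw [Fintype.linearIndependent_iff]
    intro g hg
    simp only [Fintype.sum_sum_type, v, Sum.elim_inl, Sum.elim_inr] at hg
    have h1 : ∀ j, g (.inr (.inl j)) = 0 := fun j => by
      have := congrArg (fun x => ω x (tb j)) hg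
      simpa [LinearMap.sum_apply, hkt, hat, htt] using this
    have h2 : ∀ j, g (.inr (.inr j)) = 0 := fun j => by
      have := congrArg (fun x => ω x (ab j)) hg
      simpa [LinearMap.sum_apply, hka, hta, haa] using this
    have h3 : ∑ i, g (.inl i) • k i = 0 := by
      apply Subtype.ext
      simpa [h1, h2] using hg
    have h4 := Fintype.linearIndependent_iff.1 k.linearIndependent _ h3
    rintro (i | i | i)
    exacts [h4 i, h1 i, h2 i]
  -- By nondegeneracy there are vectors dual to the basis of K and orthogonal to all a and t.
  have hex : ∀ j : Fin ℓ, ∃ f' : W, ∀ r, ω (v r) f' = if r = .inl j then 1 else 0 := by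
    intro j
    obtain ⟨F, hF⟩ := LinearMap.exists_extend ((Basis.span hli).constr ℂ
      fun r => if r = .inl j then (1 : ℂ) else 0)
    obtain ⟨f', hf'⟩ := (flip_bijective_of_nondegenerate hanti hnd).2 F
    refine ⟨f', fun r => ?_⟩
    have h1 : ω (v r) f' = F (v r) := LinearMap.congr_fun hf' (v r)
    have h2 := LinearMap.congr_fun hF (Basis.span hli r)
    rw [Basis.constr_basis, LinearMap.comp_apply, Submodule.subtype_apply, Basis.span_apply] at h2
    rw [h1, h2]
  choose f' hf' using hex
  have hkf : ∀ i j, ω (k i) (f' j) = if i = j then 1 else 0 := fun i j => by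
    have := hf' j (.inl i)
    simpa [v] using this
  have haf : ∀ i j, ω (ab i) (f' j) = 0 := fun i j => by
    have := hf' j (.inr (.inl i))
    simpa [v] using this
  have htf : ∀ i j, ω (tb i) (f' j) = 0 := fun i j => by
    have := hf' j (.inr (.inr i))
    simpa [v] using this
  have hak : ∀ i j, ω (ab i) (k j) = 0 := fun i j => by rw [hanti, hka, neg_zero]
  have htk : ∀ i j, ω (tb i) (k j) = 0 := fun i j => by rw [hanti, hkt, neg_zero]
  have hfk : ∀ i j, ω (f' i) (k j) = if j = i then -1 else 0 := fun i j => by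
    rw [hanti, hkf, apply_ite Neg.neg, neg_zero]
  -- Subtracting half of the pairings, along K, makes the dual vectors mutually orthogonal without
  -- changing their pairings with k, a and t.
  let f : Fin ℓ → W := fun i => f' i + ∑ j, (-(2⁻¹ * ω (f' i) (f' j))) • (k j : W)
  have htf' : ∀ i j, ω (tb i) (f j) = 0 := fun i j => by
    simp [f, htf, htk]
  refine ⟨fun i => ab i, fun i => tb i, f, hspan A inf_le_left ab, hspan T inf_le_right tb, ?_, ?_⟩
  · rintro (i | i) (j | j)
    · simp [f, hkf, hkk]
    · simp [hkt]
    · simp [f, haf, hak]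
    · simp [hat]
  · rintro (i | i) (j | j)
    · have h1 : ω (f i) (f j) = ω (f' i) (f' j) + 2⁻¹ * ω (f' j) (f' i) -
          2⁻¹ * ω (f' i) (f' j) := by
        simp [f, LinearMap.sum_apply, hkf, hkk, hfk]
        ring
      simp only [Sum.elim_inl]
      rw [h1, hanti (f' j)]
      ring
    · simp only [Sum.elim_inl, Sum.elim_inr]
      rw [hanti, htf', neg_zero]
    · exact htf' i j
    · exact htt i j

/-- The symplectic form in Darboux coordinates. -/
theorem omega_eq_sum {ι : Type*} [Fintype ι] [DecidableEq ι] (hanti : ∀ x y, ω x y = -ω y x)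
    {b c : ι → W} (hbb : ∀ r s, ω (b r) (b s) = 0) (hcc : ∀ r s, ω (c r) (c s) = 0)
    (hbc : ∀ r s, ω (b r) (c s) = if r = s then 1 else 0)
    (hcard : Fintype.card ι + Fintype.card ι = finrank ℂ W) (x y : W) :
    ω x y = ∑ s, (ω x (b s) * ω y (c s) - ω x (c s) * ω y (b s)) := by
  have hcb : ∀ r s, ω (c r) (b s) = if s = r then -1 else 0 := fun r s => by
    rw [hanti, hbc, apply_ite Neg.neg, neg_zero]
  have hli : LinearIndependent ℂ (Sum.elim b c) := by
    rw [Fintype.linearIndependent_iff]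
    intro g hg
    simp only [Fintype.sum_sum_type, Sum.elim_inl, Sum.elim_inr] at hg
    rintro (j | j)
    · have := congrArg (fun x => ω x (c j)) hg
      simpa [LinearMap.sum_apply, hbc, hcc] using this
    · have := congrArg (fun x => ω x (b j)) hg
      simpa [LinearMap.sum_apply, hcb, hbb] using this
  let B := basisOfLinearIndependentOfCardEqFinrank' _ hli (by rw [Fintype.card_sum, hcard])
  have hB : ∀ r, B r = Sum.elim b c r := fun r => by simp [B]
  let F : W →ₗ[ℂ] W →ₗ[ℂ] ℂ := LinearMap.mk₂ ℂ
    (fun x y => ∑ s, (ω x (b s) * ω y (c s) - ω x (c s) * ω y (b s)))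
    (fun x x' y => by
      rw [← Finset.sum_add_distrib]
      refine Finset.sum_congr rfl fun s _ => ?_
      simp only [map_add, LinearMap.add_apply]; ring)
    (fun r x y => by
      rw [smul_eq_mul, Finset.mul_sum]
      refine Finset.sum_congr rfl fun s _ => ?_
      simp only [map_smul, LinearMap.smul_apply, smul_eq_mul]; ring)
    (fun x y y' => by
      rw [← Finset.sum_add_distrib]
      refine Finset.sum_congr rfl fun s _ => ?_
      simp only [map_add, LinearMap.add_apply]; ring)
    (fun r x y => by
      rw [smul_eq_mul, Finset.mul_sum]
      refine Finset.sum_congr rfl fun s _ => ?_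
      simp only [map_smul, LinearMap.smul_apply, smul_eq_mul]; ring)
  have h : ω = F := by
    refine LinearMap.ext_basis B B fun r s => ?_
    rw [hB, hB]
    change _ = ∑ i, (ω (Sum.elim b c r) (b i) * ω (Sum.elim b c s) (c i) -
      ω (Sum.elim b c r) (c i) * ω (Sum.elim b c s) (b i))
    rcases r with r | r <;> rcases s with s | s <;> simp [hbb, hcc, hbc, hcb]
  exact LinearMap.congr_fun₂ h x y

end Symplectic

/-! ### From a Lagrangian family to a symmetric matrix. -/

section SchurComplement

variable {E : Type*} [AddCommGroup E] [Module ℂ E] [FiniteDimensional ℂ E]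

theorem isUnit_of_map_ev_eq_one {n : Type*} [Fintype n] [DecidableEq n]
    {H : Matrix n n (HolGerm E)} (hH : H.map (ev E) = 1) : IsUnit H := by
  rw [Matrix.isUnit_iff_isUnit_det, isUnit_iff_ev_ne_zero]
  have h := AlgHom.map_det (ev E) H
  rw [AlgHom.mapMatrix_apply, hH, Matrix.det_one] at h
  rw [h]
  exact one_ne_zero

/-- A matrix of germs that comes from a Lagrangian family is equivalent to the sum of a symmetric
matrix that vanishes at `0` and of an identity matrix. -/
theorem exists_symmetric_schurComplement {l : Type*} [Fintype l] [DecidableEq l] {m : ℕ}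
    {H G : Matrix (l ⊕ Fin m) (l ⊕ Fin m) (HolGerm E)} (hH : H.map (ev E) = 1)
    (hG : ∀ i j, ev E (G i j) = 0) (hHG : G * H.transpose = H * G.transpose) :
    ∃ Q : Matrix l l (HolGerm E), Q.transpose = Q ∧ (∀ i j, ev E (Q i j) = 0) ∧
      (∀ i j, dGerm E (Q i j) = dGerm E (G (.inl i) (.inl j))) ∧
      ∀ n, minorIdeal (n + m) (Matrix.of fun s => Sum.elim (fun i => G s (.inl i))
        fun j => H s (.inr j) : Matrix (l ⊕ Fin m) (l ⊕ Fin m) (HolGerm E)) = minorIdeal n Q := by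
  have hu := isUnit_of_map_ev_eq_one hH
  have hd : IsUnit H.det := (Matrix.isUnit_iff_isUnit_det H).1 hu
  have hdt : IsUnit H.transpose.det := by rwa [Matrix.det_transpose]
  -- G and H are the two halves of Darboux coordinates of a moving basis. Normalizing H to 1
  -- presents the subspace as a graph, and the Lagrangian relation becomes the symmetry of τ.
  let τ := H⁻¹ * G
  have hHτ : H * τ = G := by rw [← Matrix.mul_assoc, Matrix.mul_nonsing_inv H hd, Matrix.one_mul]
  have hτ : τ.transpose = τ := by
    have h1 : τ.transpose = G.transpose * H.transpose⁻¹ := by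
      rw [Matrix.transpose_mul, Matrix.transpose_nonsing_inv]
    have h2 : G.transpose = H⁻¹ * (G * H.transpose) := by
      rw [hHG, ← Matrix.mul_assoc, Matrix.nonsing_inv_mul H hd, Matrix.one_mul]
    rw [h1, h2, Matrix.mul_assoc, Matrix.mul_assoc, Matrix.mul_nonsing_inv _ hdt, Matrix.mul_one]
  have hev : ∀ i j, ev E (τ i j) = 0 := fun i j => by
    simp [τ, Matrix.mul_apply, hG]
  -- Differentiate Hτ = G, with τ(0) = 0 and H(0) = 1.
  have hdτ : ∀ i j, dGerm E (τ i j) = dGerm E (G i j) := fun i j => by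
    have h1 : ∀ s, ev E (H i s) = if i = s then 1 else 0 := fun s => by
      have := congrFun₂ hH i s
      rwa [Matrix.map_apply, Matrix.one_apply] at this
    rw [← hHτ, Matrix.mul_apply, map_sum]
    simp only [dGerm_mul, hev, h1, zero_smul, add_zero, ite_smul, one_smul]
    simp
  refine ⟨τ.toBlocks₁₁, ?_, fun i j => hev _ _, fun i j => hdτ _ _, fun n => ?_⟩
  · ext i j
    exact congrFun₂ hτ (.inl i) (.inl j)
  · let D : Matrix (l ⊕ Fin m) (l ⊕ Fin m) (HolGerm E) :=
      Matrix.of fun s => Sum.elim (fun i => G s (.inl i)) fun j => H s (.inr j)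
    change minorIdeal (n + m) D = _
    have hD : D = H * (τ * Matrix.fromBlocks 1 0 0 0 + Matrix.fromBlocks 0 0 0 1) := by
      rw [Matrix.mul_add, ← Matrix.mul_assoc, hHτ]
      conv_rhs => rw [← Matrix.fromBlocks_toBlocks G, ← Matrix.fromBlocks_toBlocks H]
      rw [Matrix.fromBlocks_multiply, Matrix.fromBlocks_multiply, Matrix.fromBlocks_add]
      simp only [Matrix.mul_one, Matrix.mul_zero, add_zero, zero_add]
      ext (i | i) (j | j) <;> simp [D, Matrix.toBlocks₁₁, Matrix.toBlocks₁₂, Matrix.toBlocks₂₁,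
        Matrix.toBlocks₂₂]
    -- H⁻¹D is block triangular with blocks τ₁₁, τ₂₁ and 1; R clears τ₂₁ by column operations.
    let R : Matrix (l ⊕ Fin m) (l ⊕ Fin m) (HolGerm E) :=
      Matrix.fromBlocks 1 0 (-τ.toBlocks₂₁) 1
    have hR : IsUnit R := by
      rw [Matrix.isUnit_iff_isUnit_det, Matrix.det_fromBlocks_zero₁₂]
      simp
    have hfin : H⁻¹ * D * R = Matrix.fromBlocks τ.toBlocks₁₁ 0 0 1 := by
      rw [hD, ← Matrix.mul_assoc, Matrix.nonsing_inv_mul H hd, Matrix.one_mul]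
      conv_lhs => rw [← Matrix.fromBlocks_toBlocks τ]
      rw [Matrix.fromBlocks_multiply, Matrix.fromBlocks_add, Matrix.fromBlocks_multiply]
      simp
    rw [← minorIdeal_mul_mul (n + m) D ((Matrix.isUnit_nonsing_inv_iff).2 hu) hR, hfin,
      minorIdeal_fromBlocks_one]

end SchurComplement

/-! ### The degeneracy loci as rank loci of a family of symmetric forms on K. -/

section LocalForm

variable {V : Type*} [AddCommGroup V] [Module ℂ V] [FiniteDimensional ℂ V]
  {U₀ Uinf : Submodule ℂ V}
  (hU : IsCompl U₀ Uinf) (u : Basis (Fin 3) ℂ U₀) (w : Basis (Fin 3) ℂ Uinf)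
  (A₀ L : Submodule ℂ (W3 V))

/-- The linear form `lam` on the moving vector attached to `a ∈ A₀`. -/
def chartFun (lam : Dual ℂ (W3 V)) (a : A₀) : HolFun (LGChart A₀ L × (U₀ →ₗ[ℂ] Uinf)) :=
  ⟨fun p => lam (map3 (shear hU (-p.2)) ((a : W3 V) + (LGChart.hom p.1 a : W3 V))), by
    let b := finBasis ℂ (W3 V)
    have h3 : (fun p : LGChart A₀ L × (U₀ →ₗ[ℂ] Uinf) =>
        lam (map3 (shear hU (-p.2)) ((a : W3 V) + (LGChart.hom p.1 a : W3 V)))) =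
        ∑ j, (algebraMap ℂ _ (b.coord j (a : W3 V)) + fun p => (b.coord j ∘ₗ L.subtype ∘ₗ
          (LinearMap.applyₗ a) ∘ₗ LGChart.hom ∘ₗ
            LinearMap.fst ℂ (LGChart A₀ L) (U₀ →ₗ[ℂ] Uinf)) p) *
          fun p => lam (map3 (shear hU (-(LinearMap.snd ℂ (LGChart A₀ L) (U₀ →ₗ[ℂ] Uinf) p)))
            (b j)) := by
      funext p
      conv_lhs => rw [← b.sum_repr ((a : W3 V) + (LGChart.hom p.1 a : W3 V))]
      simp only [map_sum, map_smul, Finset.sum_apply]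
      refine Finset.sum_congr rfl fun j _ => ?_
      simp
    rw [h3]
    exact sum_mem fun j _ => mul_mem (add_mem (Subalgebra.algebraMap_mem _ _)
      (linear_mem_HolFun _)) (map3_shear_mem_HolFun hU _ lam _)⟩

theorem chartFun_apply (lam : Dual ℂ (W3 V)) (a : A₀) (p : LGChart A₀ L × (U₀ →ₗ[ℂ] Uinf)) :
    (chartFun hU A₀ L lam a : _ → ℂ) p =
      lam (map3 (shear hU (-p.2)) ((a : W3 V) + (LGChart.hom p.1 a : W3 V))) := rfl

theorem chartFun_zero (lam : Dual ℂ (W3 V)) (a : A₀) :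
    (chartFun hU A₀ L lam a : LGChart A₀ L × (U₀ →ₗ[ℂ] Uinf) → ℂ) 0 = lam a := by
  rw [chartFun_apply]
  have h1 : shear hU (-(0 : LGChart A₀ L × (U₀ →ₗ[ℂ] Uinf)).2) = LinearMap.id := by
    ext v; simp [shear]
  rw [h1, map3_id, Prod.fst_zero, map_zero]
  simp

/-- Along a line through the origin the function is a polynomial in the parameter, with Taylor
coefficients given by `map3_id_sub_smul`. The minus sign comes from the inverse shear. -/
theorem dFun_chartFun (lam : Dual ℂ (W3 V)) (a : A₀) (q : LGChart A₀ L) (φ : U₀ →ₗ[ℂ] Uinf) :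
    dFun (chartFun hU A₀ L lam a) (q, φ) = lam (LGChart.hom q a) - lam (derU hU φ a) := by
  rw [dFun_apply]
  let N := nilp hU φ
  let x : W3 V := LGChart.hom q a
  have h : (fun t : ℂ => (chartFun hU A₀ L lam a : _ → ℂ) (t • (q, φ))) = fun t : ℂ =>
      lam a + t * (lam x - lam (der N a)) + t ^ 2 * ((lam (der₂ N a) - lam (der N x)) +
        t * (lam (der₂ N x) - lam (map3 N a)) - t ^ 2 * lam (map3 N x)) := by
    funext t
    rw [chartFun_apply]
    have h1 : shear hU (-(t • (q, φ)).2) = LinearMap.id - t • N := by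
      rw [shear_neg, Prod.smul_snd, map_smul]
    have h2 : ((LGChart.hom (t • (q, φ)).1 a : L) : W3 V) = t • x := by
      rw [Prod.smul_fst, map_smul]; rfl
    rw [h1, h2, map3_id_sub_smul]
    simp only [LinearMap.sub_apply, LinearMap.add_apply, LinearMap.smul_apply, LinearMap.id_apply,
      map_add, map_sub, map_smul, smul_eq_mul]
    ring
  rw [h]
  set c1 := lam x - lam (der N a) with hc1
  generalize lam (der₂ N a) - lam (der N x) = c2
  generalize lam (der₂ N x) - lam (map3 N a) = c3
  generalize lam (map3 N x) = c4
  generalize lam (a : W3 V) = c0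
  have hp : HasDerivAt (fun t : ℂ => c0 + t * c1 + t ^ 2 * (c2 + t * c3 - t ^ 2 * c4)) c1 0 := by
    have h1 := ((hasDerivAt_id (0 : ℂ)).mul_const c1).const_add c0
    have h2 := (((hasDerivAt_id (0 : ℂ)).mul_const c3).const_add c2).sub
      ((hasDerivAt_pow 2 (0 : ℂ)).mul_const c4)
    have h3 := h1.add ((hasDerivAt_pow 2 (0 : ℂ)).mul h2)
    refine h3.congr_deriv ?_
    simp
  exact hp.deriv

theorem IsLagrangian.iff_omega {A : Submodule ℂ (W3 V)} (hA : IsLagrangian A) (x : W3 V) :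
    x ∈ A ↔ ∀ a ∈ A, omega hU u w x a = 0 := by
  simp only [← wedgeMul_eq_zero_iff]
  exact hA x

theorem IsLagrangian.finrank_eq (hU : IsCompl U₀ Uinf) (u : Basis (Fin 3) ℂ U₀)
    (w : Basis (Fin 3) ℂ Uinf) {A : Submodule ℂ (W3 V)} (hA : IsLagrangian A) :
    finrank ℂ A = 10 := by
  have h := finrank_of_lagrangian (omega_antisymm hU u w)
    (fun x hx => omega_nondegenerate hU u w hx) (hA.iff_omega hU u w)
  rw [finrank_W3 hU u w] at h
  omega

/-- The linear form on `⋀³ V ⧸ T_{U₀}` given by an element of `T_{U₀}`. -/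
def quotForm : TSub U₀ →ₗ[ℂ] Dual ℂ (W3 V ⧸ TSub U₀) where
  toFun t := (TSub U₀).liftQ ((omega hU u w).flip t) fun s hs => by
    rw [LinearMap.mem_ker, LinearMap.flip_apply]
    exact TSub_isotropic hU u w hs t.2
  map_add' t t' := by
    refine Submodule.linearMap_qext _ (LinearMap.ext fun x => ?_)
    exact map_add (omega hU u w x) (t : W3 V) t'
  map_smul' c t := by
    refine Submodule.linearMap_qext _ (LinearMap.ext fun x => ?_)
    exact map_smul (omega hU u w x) c (t : W3 V)

/-- Every linear form on the quotient lifts to ω(·, x); it vanishes on the Lagrangian T_{U₀} exactly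
when x lies in T_{U₀}. -/
theorem quotForm_surjective : Function.Surjective (quotForm hU u w) := by
  intro F
  obtain ⟨x, hx⟩ := (flip_bijective_of_nondegenerate (omega_antisymm hU u w)
    (fun x hx => omega_nondegenerate hU u w hx)).2 (F ∘ₗ (TSub U₀).mkQ)
  have hx' : ∀ y, omega hU u w y x = F ((TSub U₀).mkQ y) := fun y => LinearMap.congr_fun hx y
  have hxT : x ∈ TSub U₀ := by
    rw [mem_TSub_iff hU u w]
    intro s hs
    rw [omega_antisymm, hx', Submodule.mkQ_apply, (Submodule.Quotient.mk_eq_zero _).2 hs,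
      map_zero, neg_zero]
  refine ⟨⟨x, hxT⟩, ?_⟩
  apply Submodule.linearMap_qext
  ext y
  exact hx' y

theorem span_range_subtype {W : Type*} [AddCommGroup W] [Module ℂ W] {S : Submodule ℂ W}
    {ι : Type*} {v : ι → W} (hv : Submodule.span ℂ (Set.range v) = S) (h : ∀ i, v i ∈ S) :
    Submodule.span ℂ (Set.range fun i => (⟨v i, h i⟩ : S)) = ⊤ := by
  apply Submodule.map_injective_of_injective S.injective_subtype
  rw [Submodule.map_span, ← Set.range_comp, Submodule.map_top, Submodule.range_subtype]
  exact hv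

/-- In suitable coordinates, the degeneracy loci are the rank loci of a family of symmetric forms
on `K`, whose derivative is computed. -/
theorem exists_localForm (hA : IsLagrangian A₀) (hL : IsLagrangian L) {ℓ : ℕ} (hℓ : ℓ ≤ 10)
    (k : Basis (Fin ℓ) ℂ ↥(A₀ ⊓ TSub U₀)) :
    ∃ Q : Matrix (Fin ℓ) (Fin ℓ) (HolGerm (LGChart A₀ L × (U₀ →ₗ[ℂ] Uinf))),
      Q.transpose = Q ∧ (∀ i j, ev _ (Q i j) = 0) ∧
      (∀ i j q φ, dGerm _ (Q i j) (q, φ) =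
        omega hU u w (LGChart.hom q ⟨k i, (k i).2.1⟩ : W3 V) (k j) -
          omega hU u w (derU hU φ (k i)) (k j)) ∧
      ∀ n ≤ ℓ, ZFamily hU A₀ L n = minorIdeal (ℓ - n + 1) Q := by
  have hanti := omega_antisymm hU u w
  obtain ⟨m, hm⟩ : ∃ m, ℓ + m = 10 := ⟨10 - ℓ, by omega⟩
  obtain ⟨a, t, f, hspA, hspT, hbc, hcc⟩ := exists_adapted_basis hanti
    (fun x hx => omega_nondegenerate hU u w hx) (hA.iff_omega hU u w)
    (fun x => mem_TSub_iff hU u w) ((hA.finrank_eq hU u w).trans hm.symm)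
    ((finrank_TSub hU u w).trans hm.symm) k
  set b : Fin ℓ ⊕ Fin m → W3 V := Sum.elim (fun i => (k i : W3 V)) a with hb
  set c : Fin ℓ ⊕ Fin m → W3 V := Sum.elim f t with hc
  set bT : Fin ℓ ⊕ Fin m → W3 V := Sum.elim (fun i => (k i : W3 V)) t with hbT
  have hbA : ∀ s, b s ∈ A₀ := fun s => by
    rw [← hspA]; exact Submodule.subset_span ⟨s, rfl⟩
  have hbTT : ∀ s, bT s ∈ TSub U₀ := fun s => by
    rw [← hspT]; exact Submodule.subset_span ⟨s, rfl⟩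
  have hbb : ∀ r s, omega hU u w (b r) (b s) = 0 := fun r s =>
    (hA.iff_omega hU u w _).1 (hbA r) _ (hbA s)
  have hω := omega_eq_sum hanti hbb hcc hbc (by
    rw [finrank_W3 hU u w, Fintype.card_sum, Fintype.card_fin, Fintype.card_fin]; omega)
  -- `Z y s` is the pairing with y of the s-th moving basis vector of A, transported back by the
  -- inverse shear.
  let Z : W3 V → Fin ℓ ⊕ Fin m → HolFun (LGChart A₀ L × (U₀ →ₗ[ℂ] Uinf)) := fun y s =>
    chartFun hU A₀ L ((omega hU u w).flip y) ⟨b s, hbA s⟩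
  let H : Matrix (Fin ℓ ⊕ Fin m) (Fin ℓ ⊕ Fin m) (HolGerm (LGChart A₀ L × (U₀ →ₗ[ℂ] Uinf))) :=
    Matrix.of fun s s' => germHom _ (Z (c s') s)
  let G : Matrix (Fin ℓ ⊕ Fin m) (Fin ℓ ⊕ Fin m) (HolGerm (LGChart A₀ L × (U₀ →ₗ[ℂ] Uinf))) :=
    Matrix.of fun s s' => germHom _ (Z (b s') s)
  have hH : H.map (ev _) = 1 := by
    ext s s'
    rw [Matrix.map_apply, Matrix.one_apply, ← hbc s s']
    exact chartFun_zero hU A₀ L ((omega hU u w).flip (c s')) ⟨b s, hbA s⟩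
  have hG : ∀ s s', ev _ (G s s') = 0 := fun s s' => by
    rw [← hbb s s']
    exact chartFun_zero hU A₀ L ((omega hU u w).flip (b s')) ⟨b s, hbA s⟩
  -- The moving subspace stays isotropic; written in Darboux coordinates, this is the relation
  -- between G and H.
  have hHG : G * H.transpose = H * G.transpose := by
    ext s s'
    rw [Matrix.mul_apply, Matrix.mul_apply, ← sub_eq_zero, ← Finset.sum_sub_distrib]
    have h1 : ∑ r, (Z (b r) s * Z (c r) s' - Z (c r) s * Z (b r) s') = 0 := by
      apply Subtype.ext
      funext p
      have h2 : wedgeMul (map3 (shear hU (-p.2)) (b s + (LGChart.hom p.1 ⟨b s, hbA s⟩ : W3 V)))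
          (map3 (shear hU (-p.2)) (b s' + (LGChart.hom p.1 ⟨b s', hbA s'⟩ : W3 V))) = 0 :=
        omega_map3_eq_zero _ ((mem_lgSubmodule_iff A₀ L hA hL (LGChart.hom p.1)).1 p.1.2 _
          ⟨⟨b s, hbA s⟩, rfl⟩ _ ⟨⟨b s', hbA s'⟩, rfl⟩)
      rw [wedgeMul_eq_zero_iff hU u w, hω] at h2
      have h3 : ((∑ r, (Z (b r) s * Z (c r) s' - Z (c r) s * Z (b r) s') :
          HolFun (LGChart A₀ L × (U₀ →ₗ[ℂ] Uinf))) : _ → ℂ) p =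
          ∑ r, ((Z (b r) s * Z (c r) s' - Z (c r) s * Z (b r) s' :
            HolFun (LGChart A₀ L × (U₀ →ₗ[ℂ] Uinf))) : _ → ℂ) p := by
        simp
      rw [h3]
      exact h2
    have h4 := congrArg (germHom _) h1
    rw [map_sum, map_zero] at h4
    simp only [map_sub, map_mul] at h4
    exact h4
  obtain ⟨Q, hQt, hQ0, hQd, hQm⟩ := exists_symmetric_schurComplement hH hG hHG
  refine ⟨Q, hQt, hQ0, fun i j q φ => ?_, fun n hn => ?_⟩
  · rw [hQd]
    change dGerm _ (germHom _ (Z (b (.inl j)) (.inl i))) (q, φ) = _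
    rw [dGerm_germHom]
    exact dFun_chartFun hU A₀ L _ _ q φ
  -- T_{U₀} is spanned by k and t, which belong to b and to c respectively: the matrix of the family
  -- has its first columns in G and its last columns in H.
  · rw [← hQm, ZFamily, rankLE_eq_minorIdeal (10 - n) _ (degMap_mem_HolFun hU A₀ L)
      (fun s => ⟨b s, hbA s⟩) (span_range_subtype hspA hbA)
      (fun s => quotForm hU u w ⟨bT s, hbTT s⟩) (by
        have h1 := congrArg (Submodule.map (quotForm hU u w)) (span_range_subtype hspT hbTT)
        rw [Submodule.map_span, ← Set.range_comp, Submodule.map_top,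
          LinearMap.range_eq_top.2 (quotForm_surjective hU u w)] at h1
        exact h1), ← minorIdeal_transpose]
    -- The invertible block of size m = 10 − ℓ absorbs m of the 11 − n rows of a minor.
    have h1 : 10 - n + 1 = ℓ - n + 1 + m := by omega
    rw [h1]
    congr 1
    ext s (r | r) <;> rfl

end LocalForm

/-- Determinantal scheme structures commute with restriction to a linear parameter space. -/
theorem map_pullback_rankLE {E F X Y : Type*} [AddCommGroup E] [Module ℂ E] [FiniteDimensional ℂ E]
    [AddCommGroup F] [Module ℂ F] [FiniteDimensional ℂ F] [AddCommGroup X] [Module ℂ X]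
    [FiniteDimensional ℂ X] [AddCommGroup Y] [Module ℂ Y] [FiniteDimensional ℂ Y] (i : ℕ)
    (Φ : E → (X →ₗ[ℂ] Y)) (hΦ : ∀ (x : X) (y : Dual ℂ Y), (fun e => y (Φ e x)) ∈ HolFun E)
    (j : F →ₗ[ℂ] E) : (rankLE i Φ).map (pullback j) = rankLE i fun f => Φ (j f) := by
  rw [rankLE_eq_minorIdeal i Φ hΦ _ (finBasis ℂ X).span_eq _ (finBasis ℂ (Dual ℂ Y)).span_eq,
    rankLE_eq_minorIdeal i (fun f => Φ (j f)) (fun x y => (HolFun.comp j ⟨_, hΦ x y⟩).2) _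
      (finBasis ℂ X).span_eq _ (finBasis ℂ (Dual ℂ Y)).span_eq]
  exact map_minorIdeal (pullback j : HolGerm E →+* HolGerm F) _ _

/-! ### Tangent vectors of the Lagrangian Grassmannian as quadratic forms. -/

section LagrangianChart

variable {V : Type*} [AddCommGroup V] [Module ℂ V] [FiniteDimensional ℂ V]
  {U₀ Uinf : Submodule ℂ V}
  (hU : IsCompl U₀ Uinf) (u : Basis (Fin 3) ℂ U₀) (w : Basis (Fin 3) ℂ Uinf)
  (A₀ L : Submodule ℂ (W3 V))

theorem map_pullback_ZFamily (k : ℕ) :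
    (ZFamily hU A₀ L k).map (pullback (LinearMap.inr ℂ (LGChart A₀ L) (U₀ →ₗ[ℂ] Uinf))) =
      ZLocus hU A₀ k := by
  rw [ZFamily, map_pullback_rankLE _ _ (degMap_mem_HolFun hU A₀ L), ZLocus]
  congr 1
  funext φ
  rw [LinearMap.inr_apply, map_zero, degMap, LinearMap.comp_zero, add_zero]

theorem LGChart.omega_symm (q : LGChart A₀ L) (a b : A₀) :
    omega hU u w (LGChart.hom q a : W3 V) b = omega hU u w (LGChart.hom q b : W3 V) a := by
  have h : wedgeMul (a : W3 V) (LGChart.hom q b : W3 V) +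
      wedgeMul (LGChart.hom q a : W3 V) (b : W3 V) = 0 := q.2 a b
  have h2 := congrArg (vol hU u w) h
  rw [map_add, map_zero, ← omega_apply, ← omega_apply, omega_antisymm hU u w (a : W3 V)] at h2
  linear_combination h2

/-- The quadratic form on a subspace of `A₀` given by a tangent vector of the Lagrangian
Grassmannian. -/
def lgForm (S : Submodule ℂ (W3 V)) (hS : S ≤ A₀) : LGChart A₀ L →ₗ[ℂ] SymForms S where
  toFun q := ⟨(omega hU u w ∘ₗ L.subtype ∘ₗ LGChart.hom q ∘ₗ Submodule.inclusion hS).compl₂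
    S.subtype, fun x y => LGChart.omega_symm hU u w A₀ L q (Submodule.inclusion hS x)
      (Submodule.inclusion hS y)⟩
  map_add' q q' := by
    refine SymForms.ext fun x y => ?_
    change omega hU u w ((LGChart.hom (q + q') (Submodule.inclusion hS x) : L) : W3 V) y =
      omega hU u w ((LGChart.hom q (Submodule.inclusion hS x) : L) : W3 V) y +
        omega hU u w ((LGChart.hom q' (Submodule.inclusion hS x) : L) : W3 V) y
    rw [map_add, LinearMap.add_apply, Submodule.coe_add, map_add, LinearMap.add_apply]
  map_smul' r q := by
    refine SymForms.ext fun x y => ?_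
    change omega hU u w ((LGChart.hom (r • q) (Submodule.inclusion hS x) : L) : W3 V) y =
      r * omega hU u w ((LGChart.hom q (Submodule.inclusion hS x) : L) : W3 V) y
    rw [map_smul, LinearMap.smul_apply, Submodule.coe_smul, map_smul]; rfl

/-- The form ω identifies L with the dual of A₀, so points of the chart are arbitrary symmetric
forms on A₀. A form on S is extended to A₀ by composing with a projection onto S. -/
theorem lgForm_surjective (hA : IsLagrangian A₀) (hL : IsLagrangian L) (hAL : IsCompl A₀ L)
    (S : Submodule ℂ (W3 V)) (hS : S ≤ A₀) : Function.Surjective (lgForm hU u w A₀ L S hS) := by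
  intro s
  obtain ⟨π, hπ⟩ := LinearMap.exists_leftInverse_of_injective (Submodule.inclusion hS)
    (LinearMap.ker_eq_bot.2 (Submodule.inclusion_injective hS))
  have hπ' : ∀ x, π (Submodule.inclusion hS x) = x := fun x => LinearMap.congr_fun hπ x
  let P : L →ₗ[ℂ] Dual ℂ A₀ := A₀.dualRestrict ∘ₗ omega hU u w ∘ₗ L.subtype
  have hP : Function.Bijective P := by
    have hinj : Function.Injective P := by
      rw [injective_iff_map_eq_zero]
      intro l hl
      apply Subtype.ext
      refine Submodule.disjoint_def.1 hAL.disjoint l ?_ l.2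
      rw [hA.iff_omega hU u w]
      intro a ha
      exact LinearMap.congr_fun hl ⟨a, ha⟩
    refine ⟨hinj, (LinearMap.injective_iff_surjective_of_finrank_eq_finrank ?_).1 hinj⟩
    rw [Subspace.dual_finrank_eq, hA.finrank_eq hU u w, hL.finrank_eq hU u w]
  let e := LinearEquiv.ofBijective P hP
  let q : A₀ →ₗ[ℂ] L := e.symm.toLinearMap ∘ₗ s.hom.compl₁₂ π π
  have hq : ∀ a b : A₀, omega hU u w (q a : W3 V) b = s.hom (π a) (π b) := fun a b =>
    LinearMap.congr_fun (e.apply_symm_apply (s.hom.compl₁₂ π π a)) b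
  have hqm : q ∈ lgSubmodule A₀ L := by
    rw [mem_lgSubmodule_iff A₀ L hA hL]
    rintro _ ⟨a, rfl⟩ _ ⟨b, rfl⟩
    rw [wedgeMul_eq_zero_iff hU u w]
    change omega hU u w ((a : W3 V) + q a) (b + q b) = 0
    simp only [map_add, LinearMap.add_apply]
    rw [(hA.iff_omega hU u w _).1 a.2 _ b.2, (hL.iff_omega hU u w _).1 (q a).2 _ (q b).2,
      omega_antisymm hU u w (a : W3 V), hq, hq, s.symm]
    ring
  refine ⟨⟨q, hqm⟩, SymForms.ext fun x y => ?_⟩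
  have h := hq (Submodule.inclusion hS x) (Submodule.inclusion hS y)
  rw [hπ', hπ'] at h
  exact h

end LagrangianChart

/-! ### Isomorphisms of germs induced by bijective pullbacks. -/

section GermIsomorphism

variable {E F G : Type*} [AddCommGroup E] [Module ℂ E] [FiniteDimensional ℂ E]
  [AddCommGroup F] [Module ℂ F] [FiniteDimensional ℂ F]
  [AddCommGroup G] [Module ℂ G] [FiniteDimensional ℂ G]

theorem pullback_pullback (i : E →ₗ[ℂ] F) (j : F →ₗ[ℂ] G) (f : HolGerm G) :
    pullback i (pullback j f) = pullback (j ∘ₗ i) f := by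
  obtain ⟨f, rfl⟩ := germHom_surjective f
  rfl

theorem pullback_id (f : HolGerm E) : pullback LinearMap.id f = f := by
  obtain ⟨f, rfl⟩ := germHom_surjective f
  rfl

/-- A bijective pullback induces isomorphisms of germs. -/
def germIsoOfBijective (α : HolGerm F →ₐ[ℂ] HolGerm E) (hα : Function.Bijective α)
    {I : Ideal (HolGerm E)} {J : Ideal (HolGerm F)} (h : J.map α = I) : GermIso I J :=
  (Ideal.quotientEquivAlg J I (AlgEquiv.ofBijective α hα) h.symm).symm

theorem germIsoOfBijective_mk_eq_iff {α : HolGerm F →ₐ[ℂ] HolGerm E} (hα : Function.Bijective α)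
    {I : Ideal (HolGerm E)} {J : Ideal (HolGerm F)} (h : J.map α = I) (f : HolGerm E)
    (g : HolGerm F) : germIsoOfBijective α hα h (Ideal.Quotient.mk I f) = Ideal.Quotient.mk J g ↔
      f - α g ∈ I := by
  rw [germIsoOfBijective, AlgEquiv.symm_apply_eq, ← Ideal.Quotient.eq]
  rfl

theorem mem_of_map_mem {α : HolGerm F →ₐ[ℂ] HolGerm E} (hα : Function.Bijective α)
    {J : Ideal (HolGerm F)} {g : HolGerm F} : α g ∈ J.map α ↔ g ∈ J := by
  refine ⟨fun h => ?_, fun h => Ideal.mem_map_of_mem α h⟩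
  obtain ⟨x, hx, hxg⟩ := (Ideal.mem_map_iff_of_surjective α hα.2).1 h
  rwa [← hα.1 hxg]

end GermIsomorphism

/-! ### Coordinate changes built from linear coordinates and a family of forms. -/

section FamilyOfForms

variable {E K : Type*} [AddCommGroup E] [Module ℂ E] [FiniteDimensional ℂ E]
  [AddCommGroup K] [Module ℂ K] [FiniteDimensional ℂ K] {n : ℕ} (b : Basis (Fin n) ℂ K)

theorem dGerm_symLin {Q : Matrix (Fin n) (Fin n) (HolGerm E)} {σ : E →ₗ[ℂ] SymForms K}
    (hd : ∀ i j x, dGerm E (Q i j) x = (σ x).hom (b i) (b j)) (y : Dual ℂ (SymForms K)) :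
    dGerm E (symLin b Q y) = y ∘ₗ σ := by
  ext x
  rw [map_symLin, symLin_apply]
  conv_rhs => rw [LinearMap.comp_apply, dual_symForms_eq_sum b y]
  simp [LinearMap.sum_apply, hd]

theorem dualMap_bijective {M : Type*} [AddCommGroup M] [Module ℂ M] {f : E →ₗ[ℂ] M}
    (hf : Function.Bijective f) : Function.Bijective fun y : Dual ℂ M => y ∘ₗ f :=
  (LinearEquiv.ofBijective f hf).dualMap.bijective

variable {M H : Type*} [AddCommGroup M] [Module ℂ M] [AddCommGroup H] [Module ℂ H]

/-- The substitution given by linear coordinates with values in `M` and a family of forms. -/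
def pairLin (p : E →ₗ[ℂ] M) (Q : Matrix (Fin n) (Fin n) (HolGerm E)) (ρ : SymForms K →ₗ[ℂ] H) :
    Dual ℂ (M × H) →ₗ[ℂ] HolGerm E :=
  linGerm ∘ₗ (LinearMap.inl ℂ M H ∘ₗ p).dualMap + symLin b Q ∘ₗ (LinearMap.inr ℂ M H ∘ₗ ρ).dualMap

theorem pairLin_apply (p : E →ₗ[ℂ] M) (Q : Matrix (Fin n) (Fin n) (HolGerm E))
    (ρ : SymForms K →ₗ[ℂ] H) (y : Dual ℂ (M × H)) : pairLin b p Q ρ y =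
      linGerm (y ∘ₗ LinearMap.inl ℂ M H ∘ₗ p) + symLin b Q (y ∘ₗ LinearMap.inr ℂ M H ∘ₗ ρ) := rfl

theorem ev_pairLin (p : E →ₗ[ℂ] M) {Q : Matrix (Fin n) (Fin n) (HolGerm E)}
    (hQ : ∀ i j, ev E (Q i j) = 0) (ρ : SymForms K →ₗ[ℂ] H) (y : Dual ℂ (M × H)) :
    ev E (pairLin b p Q ρ y) = 0 := by
  rw [pairLin_apply, map_add, ev_linGerm, ev_symLin b hQ, add_zero]

/-- The derivative is dual to the linear map (p, ρσ), so the hypothesis of the inverse function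
theorem is reduced to linear algebra. -/
theorem dGerm_pairLin_bijective {p : E →ₗ[ℂ] M} {Q : Matrix (Fin n) (Fin n) (HolGerm E)}
    {ρ : SymForms K →ₗ[ℂ] H} {σ : E →ₗ[ℂ] SymForms K}
    (hd : ∀ i j x, dGerm E (Q i j) x = (σ x).hom (b i) (b j))
    (hb : Function.Bijective (p.prod (ρ ∘ₗ σ))) :
    Function.Bijective fun y => dGerm E (pairLin b p Q ρ y) := by
  have h : (fun y => dGerm E (pairLin b p Q ρ y)) = fun y => y ∘ₗ p.prod (ρ ∘ₗ σ) := by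
    funext y
    rw [pairLin_apply, map_add, dGerm_linGerm, dGerm_symLin b hd]
    ext x
    simp only [LinearMap.add_apply, LinearMap.comp_apply, ← map_add]
    simp
  rw [h]
  exact dualMap_bijective hb

end FamilyOfForms

/-! ### Moving the family over the second factor into the image of its derivative. -/

section Normalization

variable {E₁ E₂ K : Type*} [AddCommGroup E₁] [Module ℂ E₁] [FiniteDimensional ℂ E₁]
  [AddCommGroup E₂] [Module ℂ E₂] [FiniteDimensional ℂ E₂]
  [AddCommGroup K] [Module ℂ K] [FiniteDimensional ℂ K] {n : ℕ} (b : Basis (Fin n) ℂ K)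

/-- Since Q(0) = 0 and g(0) = 1, the derivatives of g do not contribute: the normalization keeps the
tangent map. -/
theorem dGerm_congruence {E : Type*} [AddCommGroup E] [Module ℂ E] [FiniteDimensional ℂ E]
    {g Q : Matrix (Fin n) (Fin n) (HolGerm E)} (hg : g.map (ev E) = 1)
    (hQ : ∀ i j, ev E (Q i j) = 0) (i j : Fin n) :
    dGerm E ((g.transpose * Q * g) i j) = dGerm E (Q i j) := by
  have hg' : ∀ i j, ev E (g i j) = if i = j then 1 else 0 := fun i j => by
    have := congrFun₂ hg i j
    rwa [Matrix.map_apply, Matrix.one_apply] at this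
  simp only [Matrix.mul_apply, Matrix.transpose_apply, map_sum, dGerm_mul, map_mul, hQ, hg',
    mul_zero, zero_smul, add_zero, ite_smul, one_smul, Finset.sum_const_zero, zero_add]
  simp

theorem symLin_traceForm {A : Type*} [AddCommGroup A] [Module ℂ A] (Q : Matrix (Fin n) (Fin n) A)
    {P : Dual ℂ K →ₗ[ℂ] K} (hP : ∀ α β : Dual ℂ K, α (P β) = β (P α)) :
    symLin b Q (traceForm P) = ∑ i, ∑ j, b.coord i (P (b.coord j)) • Q i j := by
  simp only [symLin_apply, traceForm_apply, trace_comp_symOf P hP]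

theorem map_pullback_transpose {E F : Type*} [AddCommGroup E] [Module ℂ E] [FiniteDimensional ℂ E]
    [AddCommGroup F] [Module ℂ F] [FiniteDimensional ℂ F] (i : E →ₗ[ℂ] F)
    {Q : Matrix (Fin n) (Fin n) (HolGerm F)} (hQt : Q.transpose = Q) :
    (Q.map (pullback i)).transpose = Q.map (pullback i) := by
  rw [← Matrix.transpose_map, hQt]

theorem ev_map_pullback {E F : Type*} [AddCommGroup E] [Module ℂ E] [FiniteDimensional ℂ E]
    [AddCommGroup F] [Module ℂ F] [FiniteDimensional ℂ F] (i : E →ₗ[ℂ] F)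
    {Q : Matrix (Fin n) (Fin n) (HolGerm F)} (hQ0 : ∀ r s, ev _ (Q r s) = 0) (r s : Fin n) :
    ev E ((Q.map (pullback i)) r s) = 0 := by
  rw [Matrix.map_apply, ev_algHom, hQ0]

theorem dGerm_map_pullback_inr {Q : Matrix (Fin n) (Fin n) (HolGerm (E₁ × E₂))}
    {σ₁ : E₁ →ₗ[ℂ] SymForms K} {σ₂ : E₂ →ₗ[ℂ] SymForms K}
    (hd : ∀ i j x φ, dGerm _ (Q i j) (x, φ) = (σ₁ x).hom (b i) (b j) + (σ₂ φ).hom (b i) (b j))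
    (i j : Fin n) (φ : E₂) :
    dGerm E₂ ((Q.map (pullback (LinearMap.inr ℂ E₁ E₂))) i j) φ = (σ₂ φ).hom (b i) (b j) := by
  rw [Matrix.map_apply, dGerm_pullback, LinearMap.comp_apply, LinearMap.inr_apply, hd, map_zero]
  exact zero_add _

/-- After a change of frame of `K`, the family of forms on the second factor has values in the
image of its derivative. -/
theorem exists_normalized_family {Q : Matrix (Fin n) (Fin n) (HolGerm (E₁ × E₂))}
    (hQt : Q.transpose = Q) (hQ0 : ∀ i j, ev _ (Q i j) = 0) {σ₁ : E₁ →ₗ[ℂ] SymForms K}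
    {σ₂ : E₂ →ₗ[ℂ] SymForms K}
    (hd : ∀ i j x φ, dGerm _ (Q i j) (x, φ) = (σ₁ x).hom (b i) (b j) + (σ₂ φ).hom (b i) (b j))
    (hσ : LinearMap.range σ₂ = ⊤ ∨ LinearMap.ker σ₂ = ⊥ ∧ ∃ P : Dual ℂ K →ₗ[ℂ] K,
      (∀ α β : Dual ℂ K, α (P β) = β (P α)) ∧ Function.Bijective P ∧
        LinearMap.range σ₂ = LinearMap.ker (traceForm P)) :
    ∃ Q' : Matrix (Fin n) (Fin n) (HolGerm (E₁ × E₂)), Q'.transpose = Q' ∧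
      (∀ i j, ev _ (Q' i j) = 0) ∧ (∀ i j, dGerm _ (Q' i j) = dGerm _ (Q i j)) ∧
      (∀ k, minorIdeal k Q' = minorIdeal k Q) ∧
      ∀ y : Dual ℂ (SymForms K), (∀ φ, y (σ₂ φ) = 0) →
        symLin b (Q'.map (pullback (LinearMap.inr ℂ E₁ E₂))) y = 0 := by
  -- When the derivative is onto there is no condition to satisfy. Otherwise the image is the
  -- hyperplane of P, and a change of frame has to kill trace(PQ₀).
  rcases hσ with htop | ⟨hker, P, hP, hPb, hrange⟩
  · refine ⟨Q, hQt, hQ0, fun _ _ => rfl, fun _ => rfl, fun y hy => ?_⟩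
    have : y = 0 := by
      ext s
      obtain ⟨φ, rfl⟩ := LinearMap.range_eq_top.1 htop s
      exact hy φ
    rw [this, map_zero]
  let Q₀ := Q.map (pullback (LinearMap.inr ℂ E₁ E₂))
  have hQ₀t : Q₀.transpose = Q₀ := map_pullback_transpose _ hQt
  have hQ₀0 : ∀ i j, ev _ (Q₀ i j) = 0 := ev_map_pullback _ hQ0
  have hQ₀d : ∀ i j φ, dGerm _ (Q₀ i j) φ = (σ₂ φ).hom (b i) (b j) := dGerm_map_pullback_inr b hd
  let Pm : Matrix (Fin n) (Fin n) ℂ := Matrix.of fun i j => b.coord i (P (b.coord j))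
  have hPmt : Pm.transpose = Pm := by
    ext i j
    exact hP (b.coord j) (b.coord i)
  have hPm : IsUnit Pm := by
    have h1 : Pm = LinearMap.toMatrix b.dualBasis b P := by
      ext i j
      rw [LinearMap.toMatrix_apply, Basis.coe_dualBasis]
      rfl
    rw [h1, Matrix.isUnit_iff_isUnit_det]
    exact LinearEquiv.isUnit_det (LinearEquiv.ofBijective P hPb) b.dualBasis b
  obtain ⟨g, hg1, hgt⟩ := exists_congruence_trace_eq_zero hPm hPmt hQ₀t hQ₀0 (by
      rw [eq_top_iff]
      intro y _
      obtain ⟨y', rfl⟩ := LinearMap.dualMap_surjective_of_injective (LinearMap.ker_eq_bot.1 hker) y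
      rw [dual_symForms_eq_sum b y']
      simp only [map_sum, map_smul]
      refine Submodule.sum_mem _ fun i _ => Submodule.sum_mem _ fun j _ =>
        Submodule.smul_mem _ _ (Submodule.subset_span ⟨(i, j), ?_⟩)
      ext φ
      exact hQ₀d i j φ) (by
      have h1 := symLin_traceForm b (Q₀.map (dGerm E₂)) hP
      have h2 : symLin b (Q₀.map (dGerm E₂)) (traceForm P) = 0 := by
        rw [← map_symLin, dGerm_symLin b hQ₀d]
        ext φ
        exact (hrange ▸ LinearMap.mem_range_self σ₂ φ : σ₂ φ ∈ LinearMap.ker (traceForm P))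
      rw [h1] at h2
      exact h2)
  -- The change of frame found over E₂ is extended, constantly along E₁, to the whole parameter
  -- space.
  let g' := g.map (pullback (LinearMap.snd ℂ E₁ E₂))
  have hgg : ∀ i j, g' i j = pullback (LinearMap.snd ℂ E₁ E₂) (g i j) := fun _ _ => rfl
  have hg' : g'.map (ev _) = 1 := by
    rw [← hg1]
    ext i j
    rw [Matrix.map_apply, Matrix.map_apply, hgg, ev_algHom]
  have hgu := isUnit_of_map_ev_eq_one hg'
  have hgut : IsUnit g'.transpose := by
    rw [Matrix.isUnit_iff_isUnit_det, Matrix.det_transpose, ← Matrix.isUnit_iff_isUnit_det]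
    exact hgu
  have hmap : (g'.transpose * Q * g').map (pullback (LinearMap.inr ℂ E₁ E₂)) =
      g.transpose * Q₀ * g := by
    have h1 : g'.map (pullback (LinearMap.inr ℂ E₁ E₂)) = g := by
      ext i j
      rw [Matrix.map_apply, hgg, pullback_pullback, LinearMap.snd_comp_inr,
        pullback_id]
    rw [Matrix.map_mul, Matrix.map_mul, Matrix.transpose_map, h1]
  refine ⟨g'.transpose * Q * g', ?_, fun i j => ?_, dGerm_congruence hg' hQ0,
    fun k => minorIdeal_mul_mul k Q hgut hgu, fun y hy => ?_⟩
  · rw [Matrix.transpose_mul, Matrix.transpose_mul, Matrix.transpose_transpose, hQt,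
      Matrix.mul_assoc]
  · simp [Matrix.mul_apply, hQ0]
  · rw [hmap]
    -- A linear form that vanishes on the hyperplane is a multiple of the trace against P.
    have hy1 : y ∈ Submodule.span ℂ (Set.range fun _ : Unit => traceForm P) := by
      apply mem_span_of_iInf_ker_le_ker
      rw [iInf_const, ← hrange]
      rintro _ ⟨φ, rfl⟩
      exact hy φ
    rw [Set.range_const, Submodule.mem_span_singleton] at hy1
    obtain ⟨c, rfl⟩ := hy1
    rw [map_smul, symLin_traceForm b _ hP, Finset.sum_comm]
    have h1 : ∑ j, ∑ i, b.coord i (P (b.coord j)) • (g.transpose * Q₀ * g) i j =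
        (Pm.map (algebraMap ℂ _) * (g.transpose * Q₀ * g)).trace := by
      rw [Matrix.trace]
      refine Finset.sum_congr rfl fun j _ => ?_
      rw [Matrix.diag_apply, Matrix.mul_apply]
      refine Finset.sum_congr rfl fun i _ => ?_
      rw [Matrix.map_apply, Algebra.smul_def, hP]
      rfl
    rw [h1, hgt, smul_zero]

end Normalization

/-! ### Local product structure, compatible with the fibre over A₀. -/

section LocalStructure

variable {E₁ E₂ K : Type*} [AddCommGroup E₁] [Module ℂ E₁] [FiniteDimensional ℂ E₁]
  [AddCommGroup E₂] [Module ℂ E₂] [FiniteDimensional ℂ E₂]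
  [AddCommGroup K] [Module ℂ K] [FiniteDimensional ℂ K] {n : ℕ} (b : Basis (Fin n) ℂ K)

theorem map_minorIdeal_algHom {R S m m' : Type*} [CommRing R] [CommRing S] [Algebra ℂ R]
    [Algebra ℂ S] (α : R →ₐ[ℂ] S) (k : ℕ) (M : Matrix m m' R) :
    (minorIdeal k M).map α = minorIdeal k (M.map α) := map_minorIdeal (α : R →+* S) k M

theorem map_symRankLE {E : Type*} [AddCommGroup E] [Module ℂ E] [FiniteDimensional ℂ E]
    {α : HolGerm (SymForms K) →ₐ[ℂ] HolGerm E} {Q : Matrix (Fin n) (Fin n) (HolGerm E)}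
    (hQ : Q.transpose = Q) (hα : ∀ y, α (linGerm y) = symLin b Q y) (i : ℕ) :
    (symRankLE K i).map α = minorIdeal (i + 1) Q := by
  rw [symRankLE_eq_minorIdeal b, map_minorIdeal_algHom, map_genericSym b hQ hα]

/-- `hH` says that the family takes its values in H; retracting onto H then changes nothing. -/
theorem symLin_comp_retraction {A : Type*} [AddCommGroup A] [Module ℂ A]
    {Q : Matrix (Fin n) (Fin n) A} {H : Submodule ℂ (SymForms K)}
    (hH : ∀ y : Dual ℂ (SymForms K), (∀ s ∈ H, y s = 0) → symLin b Q y = 0)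
    {ρ : SymForms K →ₗ[ℂ] H} (hρ : ∀ s : H, ρ s = s) (y : Dual ℂ (SymForms K)) :
    symLin b Q (y ∘ₗ H.subtype ∘ₗ ρ) = symLin b Q y := by
  rw [← sub_eq_zero, ← map_sub]
  refine hH _ fun s hs => ?_
  have h : (ρ s : SymForms K) = s := congrArg Subtype.val (hρ ⟨s, hs⟩)
  rw [LinearMap.sub_apply, LinearMap.comp_apply, LinearMap.comp_apply, Submodule.subtype_apply, h,
    sub_self]

theorem exists_retraction {M : Type*} [AddCommGroup M] [Module ℂ M] (S : Submodule ℂ M) :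
    ∃ ρ : M →ₗ[ℂ] S, ∀ s : S, ρ s = s := by
  obtain ⟨ρ, hρ⟩ := LinearMap.exists_leftInverse_of_injective S.subtype S.ker_subtype
  exact ⟨ρ, fun s => LinearMap.congr_fun hρ s⟩

/-- The local structure of the rank loci of a family of symmetric forms parametrized by
`E₁ × E₂`, and of its restriction to `0 × E₂`. -/
theorem exists_germIso_carries {Q : Matrix (Fin n) (Fin n) (HolGerm (E₁ × E₂))}
    (hQt : Q.transpose = Q) (hQ0 : ∀ i j, ev _ (Q i j) = 0) {σ₁ : E₁ →ₗ[ℂ] SymForms K}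
    (hσ₁ : Function.Surjective σ₁) {σ₂ : E₂ →ₗ[ℂ] SymForms K} {H : Submodule ℂ (SymForms K)}
    (hHσ : H = LinearMap.range σ₂)
    (hd : ∀ i j x φ, dGerm _ (Q i j) (x, φ) = (σ₁ x).hom (b i) (b j) + (σ₂ φ).hom (b i) (b j))
    (hH : ∀ y : Dual ℂ (SymForms K), (∀ s ∈ H, y s = 0) →
      symLin b (Q.map (pullback (LinearMap.inr ℂ E₁ E₂))) y = 0)
    (i : ℕ) {I : Ideal (HolGerm (E₁ × E₂))} (hI : I = minorIdeal (i + 1) Q) :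
    ∃ (d : ℕ) (M' : Submodule ℂ (Fin d → ℂ))
      (e : GermIso I (smoothProd (Fin d → ℂ) (symRankLE K i))),
      finrank ℂ M' = finrank ℂ (LinearMap.ker σ₂) ∧
      e.Carries (pushGerm (LinearMap.inr ℂ E₁ E₂) (I.map (pullback (LinearMap.inr ℂ E₁ E₂))))
        (prodSubgerm M' H (symRankLE K i)) := by
  have hrange : ∀ φ, σ₂ φ ∈ H := fun φ => by rw [hHσ]; exact ⟨φ, rfl⟩
  -- The kernel of σ = σ₁ + σ₂ projects onto S₁ with kernel N, so retractions onto S₁ and N complete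
  -- σ to a linear isomorphism. As `lam` is linear, the fibre 0 × E₂ goes to 0 × N, which becomes
  -- M'.
  let S₁ := H.comap σ₁
  let N := LinearMap.ker σ₂
  obtain ⟨lam, hlam⟩ := exists_retraction S₁
  obtain ⟨π, hπ⟩ := exists_retraction N
  obtain ⟨ρ, hρ⟩ := exists_retraction H
  let c := coords (S₁ × N)
  let p : E₁ × E₂ →ₗ[ℂ] (Fin (finrank ℂ (S₁ × N)) → ℂ) := c.toLinearMap ∘ₗ lam.prodMap π
  let σ : E₁ × E₂ →ₗ[ℂ] SymForms K := σ₁ ∘ₗ LinearMap.fst ℂ E₁ E₂ + σ₂ ∘ₗ LinearMap.snd ℂ E₁ E₂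
  have hσ : ∀ i j x, dGerm _ (Q i j) x = (σ x).hom (b i) (b j) := fun i j x => hd i j x.1 x.2
  have hbij : Function.Bijective (p.prod (LinearMap.id ∘ₗ σ)) := by
    constructor
    · rw [injective_iff_map_eq_zero]
      rintro ⟨x, φ⟩ h
      have h1 : p (x, φ) = 0 := congrArg Prod.fst h
      have h2 : σ₁ x + σ₂ φ = 0 := congrArg Prod.snd h
      have h3 : (lam x, π φ) = 0 := c.map_eq_zero_iff.1 h1
      have hx : x ∈ S₁ := by
        rw [Submodule.mem_comap, eq_neg_of_add_eq_zero_left h2]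
        exact H.neg_mem (hrange φ)
      have hx0 : x = 0 := by
        have h4 := hlam ⟨x, hx⟩
        have h5 : lam x = 0 := congrArg Prod.fst h3
        rw [h5] at h4
        exact (congrArg Subtype.val h4).symm
      rw [hx0, map_zero, zero_add] at h2
      have hφ0 : φ = 0 := by
        have h4 := hπ ⟨φ, h2⟩
        have h5 : π φ = 0 := congrArg Prod.snd h3
        rw [h5] at h4
        exact (congrArg Subtype.val h4).symm
      rw [hx0, hφ0]; rfl
    · rintro ⟨z, t⟩
      obtain ⟨⟨s, ν⟩, rfl⟩ := c.surjective z
      obtain ⟨x₀, hx₀⟩ := hσ₁ t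
      obtain ⟨φ₀, hφ₀⟩ : ∃ φ₀, σ₂ φ₀ = σ₁ ((lam x₀ - s : S₁) : E₁) := by
        have : σ₁ ((lam x₀ - s : S₁) : E₁) ∈ H := (lam x₀ - s : S₁).2
        rwa [hHσ] at this
      refine ⟨(x₀ - lam x₀ + s, φ₀ - π φ₀ + ν), Prod.ext ?_ ?_⟩
      · refine congrArg c (Prod.ext ?_ ?_)
        · change lam (x₀ - lam x₀ + s) = s
          rw [map_add, map_sub, hlam, hlam, sub_self, zero_add]
        · change π (φ₀ - π φ₀ + ν) = ν
          rw [map_add, map_sub, hπ, hπ, sub_self, zero_add]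
      · change σ₁ (x₀ - lam x₀ + s) + σ₂ (φ₀ - π φ₀ + ν) = t
        have h1 : σ₂ (π φ₀) = 0 := (π φ₀).2
        have h2 : σ₂ ν = 0 := ν.2
        rw [map_add σ₂, map_sub σ₂, h1, h2, hφ₀, map_add, map_sub, hx₀, Submodule.coe_sub, map_sub]
        abel
  let M' : Submodule ℂ (Fin (finrank ℂ (S₁ × N)) → ℂ) :=
    LinearMap.range (c.toLinearMap ∘ₗ LinearMap.inr ℂ S₁ N)
  have hinj : Function.Injective (c.toLinearMap ∘ₗ LinearMap.inr ℂ S₁ N) :=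
    c.injective.comp LinearMap.inr_injective
  let c' : N ≃ₗ[ℂ] M' := LinearEquiv.ofInjective _ hinj
  let Q₀ := Q.map (pullback (LinearMap.inr ℂ E₁ E₂))
  have hQ₀t : Q₀.transpose = Q₀ := map_pullback_transpose _ hQt
  have hQ₀0 : ∀ i j, ev _ (Q₀ i j) = 0 := ev_map_pullback _ hQ0
  have hQ₀d : ∀ i j φ, dGerm _ (Q₀ i j) φ = (σ₂ φ).hom (b i) (b j) := dGerm_map_pullback_inr b hd
  let p₂ : E₂ →ₗ[ℂ] M' := c'.toLinearMap ∘ₗ π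
  have hbij₂ : Function.Bijective (p₂.prod (ρ ∘ₗ σ₂)) := by
    have hρσ : ∀ φ, (ρ (σ₂ φ) : SymForms K) = σ₂ φ := fun φ =>
      congrArg Subtype.val (hρ ⟨σ₂ φ, hrange φ⟩)
    constructor
    · rw [injective_iff_map_eq_zero]
      intro φ h
      have h1 : c' (π φ) = 0 := congrArg Prod.fst h
      have h2 : ρ (σ₂ φ) = 0 := congrArg Prod.snd h
      have h3 : σ₂ φ = 0 := by rw [← hρσ, h2]; rfl
      have h4 := hπ ⟨φ, h3⟩
      have h5 : π φ = 0 := c'.map_eq_zero_iff.1 h1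
      rw [h5] at h4
      exact (congrArg Subtype.val h4).symm
    · rintro ⟨z, t⟩
      obtain ⟨ν, rfl⟩ := c'.surjective z
      obtain ⟨φ₀, hφ₀⟩ : ∃ φ₀, σ₂ φ₀ = t := hHσ.le t.2
      refine ⟨φ₀ - π φ₀ + ν, Prod.ext ?_ ?_⟩
      · change c' (π (φ₀ - π φ₀ + ν)) = c' ν
        rw [map_add, map_sub, hπ, hπ, sub_self, zero_add]
      · change ρ (σ₂ (φ₀ - π φ₀ + ν)) = t
        have h1 : σ₂ (π φ₀) = 0 := (π φ₀).2
        have h2 : σ₂ ν = 0 := ν.2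
        rw [map_add σ₂, map_sub σ₂, h1, h2, hφ₀, sub_zero, add_zero, hρ]
  let α := pullLin (pairLin b p Q LinearMap.id) (ev_pairLin b p hQ0 LinearMap.id)
  have hα : Function.Bijective α := pullLin_bijective _ _ (dGerm_pairLin_bijective b hσ hbij)
  let β := pullLin (pairLin b p₂ Q₀ ρ) (ev_pairLin b p₂ hQ₀0 ρ)
  have hβ : Function.Bijective β := pullLin_bijective _ _ (dGerm_pairLin_bijective b hQ₀d hbij₂)
  have hαlin : ∀ y, α (linGerm y) = pairLin b p Q LinearMap.id y := pullLin_linGerm _ _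
  have hβlin : ∀ y, β (linGerm y) = pairLin b p₂ Q₀ ρ y := pullLin_linGerm _ _
  have hretr := symLin_comp_retraction b hH hρ
  -- The coordinates α of the total space and β of the fibre are compatible with the inclusions. It
  -- suffices to compare linear forms; on the factor of symmetric forms, equality holds because the
  -- restricted family has values in H.
  have hsq : (pullback (LinearMap.inr ℂ E₁ E₂)).comp α =
      β.comp (pullback (M'.subtype.prodMap H.subtype)) := by
    refine IsPull.ext ((isPull_pullback _).comp (isPull_pullLin _ _))
      ((isPull_pullLin _ _).comp (isPull_pullback _)) fun y => ?_
    rw [AlgHom.comp_apply, AlgHom.comp_apply, hαlin, pullback_linGerm, hβlin, pairLin_apply,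
      pairLin_apply, map_add, pullback_linGerm]
    congr 1
    · congr 1
      ext φ
      change y (c (lam 0, π φ), 0) = y (c (0, π φ), 0)
      rw [map_zero]
    · have h1 := map_symLin b (pullback (LinearMap.inr ℂ E₁ E₂)).toLinearMap Q
        (y ∘ₗ LinearMap.inr ℂ _ _ ∘ₗ LinearMap.id)
      refine h1.trans ((hretr _).symm.trans ?_)
      congr 1
  have hJ : (smoothProd (Fin (finrank ℂ (S₁ × N)) → ℂ) (symRankLE K i)).map α = I := by
    rw [smoothProd, Ideal.map_mapₐ, hI]
    refine map_symRankLE b hQt (fun y => ?_) i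
    rw [AlgHom.comp_apply, pullback_linGerm, hαlin, pairLin_apply]
    have h1 : (y ∘ₗ LinearMap.snd ℂ (Fin (finrank ℂ (S₁ × N)) → ℂ) (SymForms K)) ∘ₗ
        LinearMap.inl ℂ _ _ ∘ₗ p = 0 := by
      ext x <;> simp
    rw [h1, map_zero, zero_add]
    rfl
  have hJ₂ : (smoothProd M' (interSubspace H (symRankLE K i))).map β =
      I.map (pullback (LinearMap.inr ℂ E₁ E₂)) := by
    rw [smoothProd, interSubspace, Ideal.map_mapₐ, Ideal.map_mapₐ, hI]
    refine (map_symRankLE b hQ₀t (fun y => ?_) i).trans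
      (map_minorIdeal_algHom (pullback (LinearMap.inr ℂ E₁ E₂)) _ _).symm
    rw [AlgHom.comp_apply, AlgHom.comp_apply, pullback_linGerm, pullback_linGerm, hβlin,
      pairLin_apply]
    have h1 : ((y ∘ₗ H.subtype) ∘ₗ LinearMap.snd ℂ M' H) ∘ₗ LinearMap.inl ℂ _ _ ∘ₗ p₂ = 0 := by
      ext x; simp
    rw [h1, map_zero, zero_add]
    exact hretr y
  have hle : I ≤ pushGerm (LinearMap.inr ℂ E₁ E₂) (I.map (pullback (LinearMap.inr ℂ E₁ E₂))) :=
    Ideal.le_comap_map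
  refine ⟨_, M', germIsoOfBijective α hα hJ, ?_, hle, ?_, fun f g hfg => ?_⟩
  · exact LinearMap.finrank_range_of_inj hinj
  · rw [smoothProd, Ideal.map_le_iff_le_comap, prodSubgerm, pushGerm, Ideal.comap_comapₐ]
    intro f hf
    rw [Ideal.mem_comap, AlgHom.comp_apply, pullback_pullback]
    have h1 := Ideal.mem_map_of_mem (pullback (LinearMap.snd ℂ M' H))
      (Ideal.mem_map_of_mem (pullback H.subtype) hf)
    rw [pullback_pullback] at h1
    exact h1
  · rw [germIsoOfBijective_mk_eq_iff] at hfg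
    -- f and α g differ by an element of I, which is contained in the ideal of the fibre.
    have h1 : f ∈ pushGerm (LinearMap.inr ℂ E₁ E₂) (I.map (pullback (LinearMap.inr ℂ E₁ E₂))) ↔
        α g ∈ pushGerm (LinearMap.inr ℂ E₁ E₂) (I.map (pullback (LinearMap.inr ℂ E₁ E₂))) := by
      have h2 := hle hfg
      constructor
      · intro h3
        have := Ideal.sub_mem _ h3 h2
        rwa [sub_sub_cancel] at this
      · intro h3
        have := Ideal.add_mem _ h2 h3
        rwa [sub_add_cancel] at this
    rw [h1, pushGerm, Ideal.mem_comap, ← AlgHom.comp_apply, hsq, AlgHom.comp_apply, ← hJ₂,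
      mem_of_map_mem hβ]
    rfl

/-- If the derivative of a family of symmetric forms is injective and the family has values in its
image, then its rank loci are the linear sections of the spaces of forms of bounded rank. -/
theorem nonempty_germIso_interSubspace {Q : Matrix (Fin n) (Fin n) (HolGerm E₂)}
    (hQt : Q.transpose = Q) (hQ0 : ∀ i j, ev _ (Q i j) = 0)
    {σ₂ : E₂ →ₗ[ℂ] SymForms K} (hker : LinearMap.ker σ₂ = ⊥) {H : Submodule ℂ (SymForms K)}
    (hHσ : H = LinearMap.range σ₂)
    (hd : ∀ i j φ, dGerm _ (Q i j) φ = (σ₂ φ).hom (b i) (b j))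
    (hH : ∀ y : Dual ℂ (SymForms K), (∀ s ∈ H, y s = 0) → symLin b Q y = 0)
    (i : ℕ) {I : Ideal (HolGerm E₂)} (hI : I = minorIdeal (i + 1) Q) :
    Nonempty (GermIso I (interSubspace H (symRankLE K i))) := by
  subst hHσ
  obtain ⟨ρ, hρ⟩ := exists_retraction (LinearMap.range σ₂)
  let m : Dual ℂ (LinearMap.range σ₂) →ₗ[ℂ] HolGerm E₂ := symLin b Q ∘ₗ ρ.dualMap
  have hm : ∀ y, ev _ (m y) = 0 := fun y => ev_symLin b hQ0 _
  have hbij : Function.Bijective (ρ ∘ₗ σ₂) := by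
    have hρσ : ∀ φ, ρ (σ₂ φ) = ⟨σ₂ φ, φ, rfl⟩ := fun φ => hρ ⟨σ₂ φ, φ, rfl⟩
    constructor
    · rw [injective_iff_map_eq_zero]
      intro φ h
      rw [LinearMap.comp_apply, hρσ] at h
      have h1 : φ ∈ LinearMap.ker σ₂ := congrArg Subtype.val h
      rwa [hker, Submodule.mem_bot] at h1
    · rintro ⟨_, φ, rfl⟩
      exact ⟨φ, hρσ φ⟩
  have hα : Function.Bijective (pullLin m hm) := by
    apply pullLin_bijective
    have h1 : (fun y => dGerm E₂ (m y)) = fun y => y ∘ₗ ρ ∘ₗ σ₂ := by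
      funext y
      exact dGerm_symLin b hd (y ∘ₗ ρ)
    rw [h1]
    exact dualMap_bijective hbij
  refine ⟨germIsoOfBijective (pullLin m hm) hα ?_⟩
  rw [interSubspace, Ideal.map_mapₐ, hI]
  refine map_symRankLE b hQt (fun y => ?_) i
  rw [AlgHom.comp_apply, pullback_linGerm, pullLin_linGerm]
  exact symLin_comp_retraction b hH hρ y

end LocalStructure

end EPW

end

/-! ### Assembly of the theorem. -/

open EPW in
theorem mainTheorem6 {V : Type*} [AddCommGroup V] [Module ℂ V] [FiniteDimensional ℂ V]
    (hV : Module.finrank ℂ V = 6)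
    (A₀ : Submodule ℂ (W3 V)) (hA : IsLagrangian A₀) (hdec : ∀ x ∈ A₀, ¬ IsDecomposable x)
    (U₀ : Submodule ℂ V) (hU₀ : Module.finrank ℂ U₀ = 3)
    (ℓ : ℕ) (hℓ4 : ℓ ≤ 4) (hℓ : Module.finrank ℂ ↥(A₀ ⊓ TSub U₀) = ℓ)
    -- arbitrary affine charts of `LG(⋀³ V)` and `Gr(3, V)` around `[A₀]` and `[U₀]`
    (L : Submodule ℂ (W3 V)) (hL : IsLagrangian L) (hAL : IsCompl A₀ L)
    (Uinf : Submodule ℂ V) (hU : IsCompl U₀ Uinf) :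
    (∀ k ≤ ℓ, ∃ (d : ℕ) (M' : Submodule ℂ (Fin d → ℂ))
      (e : GermIso (ZFamily hU A₀ L k)
        (smoothProd (Fin d → ℂ) (symRankLE ↥(A₀ ⊓ TSub U₀) (ℓ - k)))),
      (Module.finrank ℂ M' : ℤ) = max 0 (9 - (ℓ : ℤ) * (ℓ + 1) / 2) ∧
      e.Carries (ZFiber hU A₀ L k)
        (prodSubgerm M' (imR A₀ U₀) (symRankLE ↥(A₀ ⊓ TSub U₀) (ℓ - k)))) ∧
    (ℓ = 4 →
      Nonempty (GermIso (ZLocus hU A₀ 2)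
        (interSubspace (imR A₀ U₀) (symRankLE ↥(A₀ ⊓ TSub U₀) 2))) ∧
      -- `Im(r_K)` is the hyperplane defined by a tensor `P ∈ Sym² K` of maximal rank
      ∃ P : Module.Dual ℂ ↥(A₀ ⊓ TSub U₀) →ₗ[ℂ] ↥(A₀ ⊓ TSub U₀),
        (∀ α β : Module.Dual ℂ ↥(A₀ ⊓ TSub U₀), α (P β) = β (P α)) ∧ Function.Bijective P ∧
        ∀ s : SymForms ↥(A₀ ⊓ TSub U₀), s ∈ imR A₀ U₀ ↔
          LinearMap.trace ℂ ↥(A₀ ⊓ TSub U₀) (P ∘ₗ s.hom) = 0) := by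
  have hUinf : finrank ℂ Uinf = 3 := by
    have := Submodule.finrank_add_eq_of_isCompl hU
    omega
  let u : Basis (Fin 3) ℂ U₀ := finBasisOfFinrankEq ℂ _ hU₀
  let w : Basis (Fin 3) ℂ Uinf := finBasisOfFinrankEq ℂ _ hUinf
  let b : Basis (Fin ℓ) ℂ ↥(A₀ ⊓ TSub U₀) := finBasisOfFinrankEq ℂ _ hℓ
  -- The two partial derivatives of the family of forms on K are σ₁ and −τ. The sign changes neither
  -- the kernel nor the image.
  let σ₁ := lgForm hU u w A₀ L (A₀ ⊓ TSub U₀) inf_le_left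
  let τ := tangentForm hU u w (A₀ ⊓ TSub U₀) inf_le_right
  have hσ₁ : Function.Surjective σ₁ := lgForm_surjective hU u w A₀ L hA hL hAL _ _
  have hker : LinearMap.ker (-τ) = LinearMap.ker τ := LinearMap.ker_neg τ
  have hrange : imR A₀ U₀ = LinearMap.range (-τ) := by
    rw [LinearMap.range_neg, imR_eq_range hU u w]
  have hdim : (finrank ℂ (LinearMap.ker (-τ)) : ℤ) = max 0 (9 - (ℓ : ℤ) * (ℓ + 1) / 2) := by
    rw [hker]; exact finrank_ker_tangentForm hU u w hdec ℓ hℓ4 hℓ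
  have hker4 : ℓ = 4 → LinearMap.ker (-τ) = ⊥ := fun h => by
    subst h
    rw [← Submodule.finrank_eq_zero]
    have h1 : max (0 : ℤ) (9 - ((4 : ℕ) : ℤ) * (((4 : ℕ) : ℤ) + 1) / 2) = 0 := by norm_num
    rw [h1] at hdim
    exact_mod_cast hdim
  obtain ⟨Q, hQt, hQ0, hQd, hQZ⟩ := exists_localForm hU u w A₀ L hA hL (by omega) b
  have hd : ∀ i j x φ, dGerm _ (Q i j) (x, φ) =
      (σ₁ x).hom (b i) (b j) + ((-τ) φ).hom (b i) (b j) := fun i j x φ => by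
    rw [hQd, sub_eq_add_neg]
    rfl
  -- For ℓ ≤ 3 the map r_K is onto; for ℓ = 4 its image is a nondegenerate hyperplane and τ is
  -- injective, so straightening applies.
  obtain ⟨Q', hQ't, hQ'0, hQ'd, hQ'm, hQ'H⟩ := exists_normalized_family b hQt hQ0 hd (by
    rw [← hrange]
    rcases Nat.lt_or_ge ℓ 4 with h3 | h4
    · exact Or.inl (imR_eq_top hU u w hdec (by omega))
    · exact Or.inr ⟨hker4 (by omega), exists_imR_eq_hyperplane hU u w hdec (by omega)⟩)
  have hH : ∀ y : Dual ℂ (SymForms ↥(A₀ ⊓ TSub U₀)), (∀ s ∈ imR A₀ U₀, y s = 0) →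
      symLin b (Q'.map (pullback (LinearMap.inr ℂ (LGChart A₀ L) (U₀ →ₗ[ℂ] Uinf)))) y = 0 :=
    fun y hy => hQ'H y fun φ => hy _ (by rw [hrange]; exact ⟨φ, rfl⟩)
  have hZ : ∀ k ≤ ℓ, ZFamily hU A₀ L k = minorIdeal (ℓ - k + 1) Q' := fun k hk => by
    rw [hQ'm, hQZ k hk]
  refine ⟨fun k hk => ?_, fun h4 => ⟨?_, ?_⟩⟩
  · obtain ⟨d, M', e, he, hc⟩ := exists_germIso_carries b hQ't hQ'0 hσ₁ hrange
      (fun i j x φ => by rw [hQ'd, hd]) hH (ℓ - k) (hZ k hk)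
    rw [map_pullback_ZFamily] at hc
    exact ⟨d, M', e, by rw [he, hdim], hc⟩
  -- With τ injective there is no smooth factor left: the fibre germ is the linear section itself.
  · refine nonempty_germIso_interSubspace b (map_pullback_transpose _ hQ't)
      (ev_map_pullback _ hQ'0) (hker4 h4) hrange
      (dGerm_map_pullback_inr b fun i j x φ => by rw [hQ'd, hd]) hH 2 ?_
    have h2 : ℓ - 2 + 1 = 2 + 1 := by omega
    rw [← map_pullback_ZFamily hU A₀ L, hZ 2 (by omega), h2]
    exact map_minorIdeal_algHom _ _ _
  · obtain ⟨P, hP, hPb, hI⟩ := exists_imR_eq_hyperplane hU u w hdec (hℓ.trans h4)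
    refine ⟨P, hP, hPb, fun s => ?_⟩
    rw [hI]
    rfl
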